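/- Let $\mathbb D$ be the open unit disc in $\mathbb C$, $\overline{\mathbb D}$ its closure, and $\mathbb C_+=\{s\in\mathbb C:\operatorname{Re}s>0\}$. Consider the following three spaces of complex-valued functions, each with pointwise operations and the supremum norm. * $A(\overline{\mathbb D}^{\mathbb N})$: the functions $f:\overline{\mathbb D}^{\mathbb N}\to\mathbb C$ that are continuous for the product topology and separately holomorphic on $\mathbb D^{\mathbb N}$ (holomorphic on $\mathbb D$ in each coordinate when all other coordinates are fixed in $\mathbb D$). * $\mathcal A(\mathbb C_+)$: the uniformly continuous functions $f:\mathbb C_+\to\mathbb C$ for which there are $a_1,a_2,\ldots\in\mathbb C$ such that the Dirichlet series $\sum_{n=1}^\infty a_n n^{-s}$ converges to $f(s)$ for every $s\in\mathbb C_+$. * $\mathcal A_u(B_{c_0})$: the uniformly continuous, complex Fréchet differentiable functions $f:B_{c_0}\to\mathbb C$, where $B_{c_0}$ is the open unit ball of the space $c_0$ of complex null sequences with the supremum norm. All functions in these spaces are bounded, and each of the three spaces is a (unital) Banach algebra. The Banach algebra $A(\overline{\mathbb D}^{\mathbb N})$ is isometrically isomorphic, as a Banach algebra, to $\mathcal A(\mathbb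 C_+)$ and also to $\mathcal A_u(B_{c_0})$. -/

import Mathlib

open Set Filter Topology Metric
open scoped BoundedContinuousFunction ZeroAtInfty

/-- The closed polydisc `D̄^ℕ`, with the product topology. -/
abbrev ClosedPolydisc : Type := ℕ → closedBall (0 : ℂ) 1

/-- `f` is separately holomorphic on the open polydisc `D^ℕ`: if all coordinates but the `i`-th
are fixed in the open disc, then `f` is holomorphic in the `i`-th coordinate on the open disc. -/
def SeparatelyHolomorphic (f : ClosedPolydisc → ℂ) : Prop :=
  ∀ z : ClosedPolydisc, (∀ j, (z j : ℂ) ∈ ball (0 : ℂ) 1) → ∀ i : ℕ,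
    ∃ h : ℂ → ℂ, DifferentiableOn ℂ h (ball (0 : ℂ) 1) ∧
      ∀ w : closedBall (0 : ℂ) 1, (w : ℂ) ∈ ball (0 : ℂ) 1 → f (Function.update z i w) = h w

/-- The algebra `A(D̄^ℕ)` of continuous functions on `D̄^ℕ` that are separately holomorphic on
`D^ℕ`. It carries the supremum norm of `C(D̄^ℕ, ℂ)`. -/
def polydiscAlgebra : Subalgebra ℂ C(ClosedPolydisc, ℂ) where
  carrier := {f | SeparatelyHolomorphic f}
  mul_mem' := by
    intro f g hf hg z hz i
    obtain ⟨h, hd, he⟩ := hf z hz i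
    obtain ⟨k, kd, ke⟩ := hg z hz i
    exact ⟨h * k, hd.mul kd, fun w hw => by simp [he w hw, ke w hw]⟩
  add_mem' := by
    intro f g hf hg z hz i
    obtain ⟨h, hd, he⟩ := hf z hz i
    obtain ⟨k, kd, ke⟩ := hg z hz i
    exact ⟨h + k, hd.add kd, fun w hw => by simp [he w hw, ke w hw]⟩
  algebraMap_mem' := by
    intro c z _ i
    exact ⟨fun _ => c, differentiableOn_const c, fun w _ => by simp⟩

/-- The open right half-plane `ℂ₊`. -/
def rightHalfPlane : Set ℂ := {s | 0 < s.re}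

/-- The set `A(ℂ₊)` of all uniformly continuous functions on `ℂ₊` that are the pointwise sum of
a Dirichlet series `∑ aₙ / n ^ s` convergent (perhaps only conditionally) on `ℂ₊`. -/
def dirichletFunctions : Set (rightHalfPlane → ℂ) :=
  {f | UniformContinuous f ∧ ∃ a : ℕ → ℂ, ∀ s : rightHalfPlane,
    Tendsto (fun N : ℕ => ∑ n ∈ Finset.Icc 1 N, a n / (n : ℂ) ^ (s : ℂ)) atTop (𝓝 (f s))}

/-- The open unit ball of `c₀`. As `ℕ` is discrete, `C₀(ℕ, ℂ)` is the space of complex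
sequences that converge to zero, with the supremum norm. -/
def unitBallC0 : Set C₀(ℕ, ℂ) := ball 0 1

/-- The set `A_u(B_{c₀})` of all uniformly continuous, complex Fréchet differentiable functions
on the open unit ball of `c₀`. -/
def ballFunctions : Set (unitBallC0 → ℂ) :=
  {f | UniformContinuous f ∧ ∃ F : C₀(ℕ, ℂ) → ℂ,
    DifferentiableOn ℂ F unitBallC0 ∧ ∀ x : unitBallC0, f x = F x}

/-! Both isomorphisms are compositions with a map into the closed polydisc: `bohrPoint`, which sends
`s` to the sequence of `p⁻ˢ` over the primes (the Bohr lift), and `ballPoint`, the inclusion of the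
ball of `c₀`. Polynomials in finitely many coordinates are dense in the polydisc algebra
(`polydiscAlgebra_le_coordClosure`), so it is enough to check on polynomials that composition
preserves norms. An isometry from a complete space has closed range, so surjectivity reduces to
uniform approximation (`exists_polydiscAlgebra_eq_of_approx`).

Isometry. For the ball, truncated points of the open polydisc lie in the image and suffice by
density. For the half-plane, mean values bound each coefficient of a Dirichlet polynomial by its
supremum. Hence the norm on the polydisc is at most the number of monomials times the norm on the
half-plane; applied to `Q ^ k`, whose number of monomials is polynomial in `k`, this loses its
factor after `k`-th roots.

Half-plane, range. Partial sums at a fixed `s` are bounded, uniformly in their length, by the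
supremum norm of a Dirichlet polynomial (`exists_norm_dirichlet_tail_le`, a Perron-type formula with
an absolutely convergent kernel); so uniform limits of Dirichlet polynomials still have convergent
Dirichlet series. Conversely, Gaussian means along vertical lines approximate a uniformly continuous
`f` uniformly and turn its series into an absolutely convergent one
(`exists_dirichletPolynomial_close`).

Ball, range. Bounded pointwise limits of holomorphic functions are holomorphic
(`differentiableAt_of_tendsto_of_bounded`), so restrictions are Fréchet differentiable. Conversely,
`F (r x)` is a uniform limit of sums of homogeneous polynomials, and each of these extends
continuously to the polydisc (`IsHomogeneousPolynomial.exists_extension`). That is an induction on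
the degree: failure to extend yields disjoint blocks with large derivatives, which a Schur-type
lemma excludes. -/

/-! ### Taylor coefficients on the unit disc -/

/-- The `n`-th Taylor coefficient at `0`. -/
noncomputable def taylorCoeff (f : ℂ → ℂ) (n : ℕ) : ℂ :=
  (n.factorial : ℂ)⁻¹ * iteratedDeriv n f 0

theorem hasSum_taylorCoeff {f : ℂ → ℂ} (hf : DifferentiableOn ℂ f (ball 0 1)) {w : ℂ}
    (hw : w ∈ ball (0 : ℂ) 1) : HasSum (fun n => taylorCoeff f n * w ^ n) (f w) := by
  convert! Complex.hasSum_taylorSeries_on_ball hf hw using 1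
  funext n
  simp only [taylorCoeff, sub_zero, smul_eq_mul]
  ring

/-- Cauchy's estimate on circles of radius `r < 1`, then `r → 1`; nothing is assumed about `f` on
the unit circle. -/
theorem norm_taylorCoeff_le {f : ℂ → ℂ} {C : ℝ} (hf : DifferentiableOn ℂ f (ball 0 1))
    (hC : ∀ w ∈ ball (0 : ℂ) 1, ‖f w‖ ≤ C) (n : ℕ) : ‖taylorCoeff f n‖ ≤ C := by
  have key : ∀ r ∈ Ioo (0 : ℝ) 1, ‖taylorCoeff f n‖ ≤ C / r ^ n := by
    intro r hr
    have hsub : closedBall (0 : ℂ) r ⊆ ball 0 1 := closedBall_subset_ball hr.2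
    have h1 : DiffContOnCl ℂ f (ball 0 r) :=
      (hf.mono (by rw [closure_ball _ hr.1.ne']; exact hsub)).diffContOnCl
    have h2 := Complex.norm_iteratedDeriv_le_of_forall_mem_sphere_norm_le n hr.1 h1
      (fun z hz => hC z (hsub (sphere_subset_closedBall hz)))
    have h3 : (0 : ℝ) < n.factorial := by positivity
    rw [taylorCoeff, norm_mul, norm_inv, Complex.norm_natCast, inv_mul_le_iff₀ h3]
    rwa [mul_div_assoc] at h2
  have hlim : Tendsto (fun r : ℝ => C / r ^ n) (𝓝[<] 1) (𝓝 C) := by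
    have : ContinuousAt (fun r : ℝ => C / r ^ n) 1 := by
      apply ContinuousAt.div <;> first | fun_prop | simp
    have h := this.tendsto
    simp only [one_pow, div_one] at h
    exact h.mono_left nhdsWithin_le_nhds
  refine ge_of_tendsto hlim ?_
  filter_upwards [Ioo_mem_nhdsLT (zero_lt_one (α := ℝ))] with r hr using key r hr

theorem norm_le_of_hasSum_of_geometric_tail {f : ℕ → ℂ} {a : ℂ} {K r : ℝ} {M : ℕ} (hr0 : 0 ≤ r)
    (hr1 : r < 1) (hf : HasSum f a) (h0 : ∀ j < M, f j = 0) (hK : ∀ j, ‖f j‖ ≤ K * r ^ j) :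
    ‖a‖ ≤ K * r ^ M / (1 - r) := by
  have h1 : HasSum (fun j => f (j + M)) a := by
    rw [hasSum_nat_add_iff M, Finset.sum_eq_zero (fun j hj => h0 j (Finset.mem_range.1 hj)),
      add_zero]
    exact hf
  have h2 : HasSum (fun j => K * r ^ M * r ^ j) (K * r ^ M * (1 - r)⁻¹) :=
    (hasSum_geometric_of_lt_one hr0 hr1).mul_left _
  rw [← h1.tsum_eq, div_eq_mul_inv]
  refine tsum_of_norm_bounded h2 fun j => (hK _).trans_eq ?_
  rw [pow_add]; ring

/-- A primitive `M`-th root of unity. -/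
noncomputable def rootUnity (M : ℕ) : ℂ := Complex.exp (2 * Real.pi * Complex.I / M)

theorem norm_rootUnity (M : ℕ) : ‖rootUnity M‖ = 1 := by
  have : (2 * Real.pi * Complex.I / M : ℂ) = ((2 * Real.pi / M : ℝ) : ℂ) * Complex.I := by
    push_cast; ring
  rw [rootUnity, this, Complex.norm_exp_ofReal_mul_I]

/-- The mean of `ω⁻ᵏ φ(rω)` over the `M`-th roots of unity `ω`. -/
noncomputable def rootMean (M k : ℕ) (r : ℝ) (φ : ℂ → ℂ) : ℂ :=
  (M : ℂ)⁻¹ * ∑ l ∈ Finset.range M, (rootUnity M ^ l)⁻¹ ^ k * φ (r * rootUnity M ^ l)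

theorem sum_rootUnity {M : ℕ} (hM : M ≠ 0) {k : ℕ} (hk : k < M) (j : ℕ) :
    (M : ℂ)⁻¹ * ∑ l ∈ Finset.range M, (rootUnity M ^ l)⁻¹ ^ k * (rootUnity M ^ l) ^ j =
      if j % M = k then 1 else 0 := by
  have hprim : IsPrimitiveRoot (rootUnity M) M := Complex.isPrimitiveRoot_exp M hM
  set ζ := rootUnity M with hζ
  have hζ0 : ζ ≠ 0 := hprim.ne_zero hM
  have hM' : (M : ℂ) ≠ 0 := by exact_mod_cast hM
  have hq : ∀ l, (ζ ^ l)⁻¹ ^ k * (ζ ^ l) ^ j = (ζ⁻¹ ^ k * ζ ^ j) ^ l := by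
    intro l
    rw [mul_pow, ← pow_mul, ← pow_mul, ← pow_mul, ← inv_pow, ← pow_mul, mul_comm k, mul_comm j]
  simp_rw [hq]
  have hmod : ζ ^ j = ζ ^ (j % M) := by
    conv_lhs => rw [← Nat.mod_add_div j M, pow_add, pow_mul, hprim.pow_eq_one, one_pow, mul_one]
  split_ifs with h
  · have : ζ⁻¹ ^ k * ζ ^ j = 1 := by
      rw [hmod, h, ← mul_pow, inv_mul_cancel₀ hζ0, one_pow]
    simp only [this, one_pow, Finset.sum_const, Finset.card_range, nsmul_eq_mul, mul_one]
    exact inv_mul_cancel₀ hM'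
  · have hne : ζ⁻¹ ^ k * ζ ^ j ≠ 1 := by
      intro h1
      apply h
      rw [hmod, inv_pow, inv_mul_eq_one₀ (pow_ne_zero _ hζ0)] at h1
      exact (hprim.pow_inj hk (Nat.mod_lt _ (Nat.pos_of_ne_zero hM)) h1).symm
    have hpow : (ζ⁻¹ ^ k * ζ ^ j) ^ M = 1 := by
      rw [mul_pow, ← pow_mul, ← pow_mul, mul_comm k, mul_comm j, pow_mul, pow_mul, inv_pow,
        hprim.pow_eq_one, inv_one, one_pow, one_pow, one_mul]
    rw [geom_sum_eq hne, hpow, sub_self, zero_div, mul_zero]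

/-- Aliasing: averaging over the `M`-th roots of unity keeps exactly the exponents congruent to `k`
modulo `M`. These finite means replace Cauchy's integral, so that only linear combinations and
limits are ever taken. -/
theorem hasSum_rootMean {M k : ℕ} (hM : M ≠ 0) (hk : k < M) {r : ℝ} (hr0 : 0 ≤ r) (hr1 : r < 1)
    {φ : ℂ → ℂ} {c : ℕ → ℂ} (hφ : ∀ w ∈ ball (0 : ℂ) 1, HasSum (fun n => c n * w ^ n) (φ w)) :
    HasSum (fun j => if j % M = k then c j * r ^ j else 0) (rootMean M k r φ) := by
  have h1 : ∀ l ∈ Finset.range M, HasSum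
      (fun j => (rootUnity M ^ l)⁻¹ ^ k * (c j * (r * rootUnity M ^ l) ^ j))
      ((rootUnity M ^ l)⁻¹ ^ k * φ (r * rootUnity M ^ l)) := fun l _ => by
    refine (hφ _ ?_).mul_left _
    rw [mem_ball_zero_iff, norm_mul, norm_pow, norm_rootUnity, one_pow, mul_one]
    simpa [abs_of_nonneg hr0] using hr1
  convert! (hasSum_sum h1).mul_left (M : ℂ)⁻¹ using 1
  funext j
  have h2 := congrArg (c j * (r : ℂ) ^ j * ·) (sum_rootUnity hM hk j)
  simp only [mul_ite, mul_one, mul_zero] at h2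
  rw [← h2, mul_left_comm, Finset.mul_sum]
  congr 1
  refine Finset.sum_congr rfl fun l _ => ?_
  rw [mul_pow]; ring

theorem norm_rootMean_sub_le {M k : ℕ} (hM : M ≠ 0) (hk : k < M) {r : ℝ} (hr0 : 0 ≤ r)
    (hr1 : r < 1) {φ : ℂ → ℂ} {c : ℕ → ℂ} {C : ℝ} (hc : ∀ n, ‖c n‖ ≤ C)
    (hφ : ∀ w ∈ ball (0 : ℂ) 1, HasSum (fun n => c n * w ^ n) (φ w)) :
    ‖rootMean M k r φ - c k * r ^ k‖ ≤ C * r ^ M / (1 - r) := by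
  have h1 := hasSum_rootMean hM hk hr0 hr1 hφ
  have h2 : HasSum (fun j => if j = k then c k * (r : ℂ) ^ k else 0) (c k * r ^ k) :=
    hasSum_ite_eq k _
  have hC : 0 ≤ C := (norm_nonneg _).trans (hc 0)
  refine norm_le_of_hasSum_of_geometric_tail hr0 hr1 (h1.sub h2) ?_ ?_
  · intro j hj
    rw [Nat.mod_eq_of_lt hj]
    by_cases h : j = k <;> simp [h]
  · intro j
    have : ‖c j * (r : ℂ) ^ j‖ ≤ C * r ^ j := by
      rw [norm_mul, norm_pow, Complex.norm_real, Real.norm_of_nonneg hr0]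
      gcongr
      exact hc j
    by_cases h : j = k
    · subst h
      simp only [Nat.mod_eq_of_lt hk, if_true, sub_self, norm_zero]
      positivity
    · by_cases h' : j % M = k
      · simpa [h, h'] using this
      · simp only [h, h', if_false, sub_self, norm_zero]
        positivity

/-- Aliasing replaces `z ^ j` by `z ^ (j % M)`. The two agree for `j < M` and differ by at most 2
otherwise, so the error is a geometric tail, uniform up to `‖z‖ = 1`. -/
theorem norm_sum_rootMean_sub_le {M : ℕ} (hM : M ≠ 0) {r : ℝ} (hr0 : 0 ≤ r)
    (hr1 : r < 1) {φ : ℂ → ℂ} {c : ℕ → ℂ} {C : ℝ} (hc : ∀ n, ‖c n‖ ≤ C)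
    (hφ : ∀ w ∈ ball (0 : ℂ) 1, HasSum (fun n => c n * w ^ n) (φ w)) {z : ℂ} (hz : ‖z‖ ≤ 1) :
    ‖∑ k ∈ Finset.range M, rootMean M k r φ * z ^ k - φ (r * z)‖ ≤ 2 * C * r ^ M / (1 - r) := by
  have h1 := hasSum_sum (s := Finset.range M) fun k hk =>
    (hasSum_rootMean hM (Finset.mem_range.1 hk) hr0 hr1 hφ).mul_right (z ^ k)
  have h2 := hφ (r * z) (by
    rw [mem_ball_zero_iff, norm_mul, Complex.norm_real, Real.norm_of_nonneg hr0]
    nlinarith [norm_nonneg z])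
  have hC : 0 ≤ C := (norm_nonneg _).trans (hc 0)
  have h3 : ∀ j, ∑ k ∈ Finset.range M, (if j % M = k then c j * (r : ℂ) ^ j else 0) * z ^ k =
      c j * r ^ j * z ^ (j % M) := by
    intro j
    rw [Finset.sum_eq_single_of_mem (j % M)
      (Finset.mem_range.2 (Nat.mod_lt _ (Nat.pos_of_ne_zero hM)))]
    · simp
    · intro k _ hk
      simp [hk.symm]
  simp_rw [h3] at h1
  refine norm_le_of_hasSum_of_geometric_tail hr0 hr1 (h1.sub h2) ?_ ?_
  · intro j hj
    rw [Nat.mod_eq_of_lt hj]; ring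
  · intro j
    have : c j * (r : ℂ) ^ j * z ^ (j % M) - c j * (r * z) ^ j =
        c j * r ^ j * (z ^ (j % M) - z ^ j) := by ring
    rw [this, norm_mul, norm_mul, norm_pow, Complex.norm_real, Real.norm_of_nonneg hr0]
    have h4 : ‖z ^ (j % M) - z ^ j‖ ≤ 2 := by
      refine (norm_sub_le _ _).trans ?_
      rw [norm_pow, norm_pow]
      linarith [pow_le_one₀ (n := j % M) (norm_nonneg z) hz, pow_le_one₀ (n := j) (norm_nonneg z) hz]
    calc ‖c j‖ * r ^ j * ‖z ^ (j % M) - z ^ j‖ ≤ C * r ^ j * 2 := by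
          gcongr
          exact hc j
      _ = _ := by ring

/-! ### The polydisc algebra is closed -/

/-- The restriction of `f` to the line through `z` in the direction of the `i`-th coordinate. -/
noncomputable def slice (f : ClosedPolydisc → ℂ) (z : ClosedPolydisc) (i : ℕ) (w : ℂ) : ℂ :=
  open Classical in if h : w ∈ closedBall (0 : ℂ) 1 then f (Function.update z i ⟨w, h⟩) else 0

theorem slice_coe (f : ClosedPolydisc → ℂ) (z : ClosedPolydisc) (i : ℕ)
    (w : closedBall (0 : ℂ) 1) : slice f z i w = f (Function.update z i w) := by
  simp only [slice, w.2, dite_true]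

theorem slice_of_mem_ball (f : ClosedPolydisc → ℂ) (z : ClosedPolydisc) (i : ℕ) {w : ℂ}
    (hw : w ∈ ball (0 : ℂ) 1) :
    slice f z i w = f (Function.update z i ⟨w, ball_subset_closedBall hw⟩) :=
  slice_coe f z i ⟨w, ball_subset_closedBall hw⟩

theorem separatelyHolomorphic_iff {f : ClosedPolydisc → ℂ} :
    SeparatelyHolomorphic f ↔ ∀ z : ClosedPolydisc, (∀ j, (z j : ℂ) ∈ ball (0 : ℂ) 1) → ∀ i : ℕ,
      DifferentiableOn ℂ (slice f z i) (ball 0 1) := by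
  constructor
  · intro hf z hz i
    obtain ⟨h, hd, he⟩ := hf z hz i
    exact hd.congr fun w hw => by rw [slice_of_mem_ball _ _ _ hw, he _ hw]
  · intro hf z hz i
    exact ⟨_, hf z hz i, fun w _ => (slice_coe f z i w).symm⟩

theorem isClosed_polydiscAlgebra : IsClosed (polydiscAlgebra : Set C(ClosedPolydisc, ℂ)) := by
  apply IsSeqClosed.isClosed
  intro g f hg hgf
  refine separatelyHolomorphic_iff.2 fun z hz i => ?_
  have h1 : TendstoUniformlyOn (fun n => slice (g n) z i) (slice f z i) atTop (ball 0 1) := by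
    have := ContinuousMap.tendsto_iff_tendstoUniformly.1 hgf
    rw [Metric.tendstoUniformly_iff] at this
    rw [Metric.tendstoUniformlyOn_iff]
    intro ε hε
    filter_upwards [this ε hε] with n hn w hw
    rw [slice_of_mem_ball _ _ _ hw, slice_of_mem_ball _ _ _ hw]
    exact hn _
  exact h1.tendstoLocallyUniformlyOn.differentiableOn
    (Eventually.of_forall fun n => separatelyHolomorphic_iff.1 (hg n) z hz i) isOpen_ball

instance completeSpace_polydiscAlgebra : CompleteSpace polydiscAlgebra :=
  isClosed_polydiscAlgebra.completeSpace_coe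

/-! ### Coordinate polynomials are dense in the polydisc algebra -/

/-- The `i`-th coordinate function on the closed polydisc. -/
def coord (i : ℕ) : C(ClosedPolydisc, ℂ) := ⟨fun z => z i, by fun_prop⟩

@[simp] theorem coord_apply (i : ℕ) (z : ClosedPolydisc) : coord i z = z i := rfl

theorem coord_mem_polydiscAlgebra (i : ℕ) : coord i ∈ polydiscAlgebra := by
  intro z _ j
  by_cases h : i = j
  · subst h
    exact ⟨id, differentiableOn_id, fun w _ => by simp⟩
  · exact ⟨fun _ => z i, differentiableOn_const _, fun w _ => by simp [h]⟩

/-- The closure of the algebra of polynomials in finitely many coordinates. -/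
noncomputable def coordClosure : Subalgebra ℂ C(ClosedPolydisc, ℂ) :=
  (Algebra.adjoin ℂ (range coord)).topologicalClosure

theorem isClosed_coordClosure : IsClosed (coordClosure : Set C(ClosedPolydisc, ℂ)) :=
  Subalgebra.isClosed_topologicalClosure _

theorem coord_mem_coordClosure (i : ℕ) : coord i ∈ coordClosure :=
  Subalgebra.le_topologicalClosure _ (Algebra.subset_adjoin (mem_range_self i))

theorem dense_openPolydisc : Dense {z : ClosedPolydisc | ∀ j, (z j : ℂ) ∈ ball (0 : ℂ) 1} := by
  have h1 : Dense {w : closedBall (0 : ℂ) 1 | (w : ℂ) ∈ ball (0 : ℂ) 1} := by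
    rw [Subtype.dense_iff]
    have : ((↑) '' {w : closedBall (0 : ℂ) 1 | (w : ℂ) ∈ ball (0 : ℂ) 1} : Set ℂ) = ball 0 1 := by
      ext w
      constructor
      · rintro ⟨v, hv, rfl⟩
        exact hv
      · intro hw
        exact ⟨⟨w, ball_subset_closedBall hw⟩, hw, rfl⟩
    rw [this, closure_ball _ one_ne_zero]
  have := dense_pi (α := fun _ : ℕ => closedBall (0 : ℂ) 1) univ fun _ _ => h1
  convert! this using 1
  ext z
  simp

/-- Separate holomorphy is available only where all coordinates lie in the open disc; estimates made
there pass to the closed polydisc by density. -/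
theorem norm_le_of_forall_openPolydisc {h : C(ClosedPolydisc, ℂ)} {ε : ℝ} (hε : 0 ≤ ε)
    (H : ∀ z : ClosedPolydisc, (∀ j, (z j : ℂ) ∈ ball (0 : ℂ) 1) → ‖h z‖ ≤ ε) : ‖h‖ ≤ ε := by
  rw [ContinuousMap.norm_le _ hε]
  intro z
  have : IsClosed {z | ‖h z‖ ≤ ε} := isClosed_le (by fun_prop) continuous_const
  exact this.closure_subset_iff.2 (fun z hz => H z hz) (dense_openPolydisc z)

theorem tendstoUniformly_polydisc_iff {ι α : Type*} {l : Filter ι} {F : ι → α → ClosedPolydisc}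
    {f : α → ClosedPolydisc} : TendstoUniformly F f l ↔
      ∀ i, TendstoUniformly (fun k z => (F k z i : ℂ)) (fun z => (f z i : ℂ)) l := by
  simp only [tendstoUniformly_iff_tendsto, Pi.uniformity, tendsto_iInf, tendsto_comap_iff,
    uniformity_subtype]
  rfl

theorem tendsto_comp_of_tendstoUniformly {ι : Type*} {l : Filter ι}
    {T : ι → C(ClosedPolydisc, ClosedPolydisc)}
    (hT : TendstoUniformly (fun k z => T k z) (fun z => z) l)
    (g : C(ClosedPolydisc, ℂ)) : Tendsto (fun k => g.comp (T k)) l (𝓝 g) := by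
  rw [ContinuousMap.tendsto_iff_tendstoUniformly]
  exact (CompactSpace.uniformContinuous_of_continuous g.continuous).comp_tendstoUniformly hT

/-- The map that replaces the `n`-th coordinate by a constant. -/
def updateCoord (n : ℕ) (c : closedBall (0 : ℂ) 1) : C(ClosedPolydisc, ClosedPolydisc) :=
  ⟨fun z => Function.update z n c, by fun_prop⟩

theorem comp_updateCoord_mem {g : C(ClosedPolydisc, ℂ)} (hg : g ∈ polydiscAlgebra) (n : ℕ)
    {c : closedBall (0 : ℂ) 1} (hc : (c : ℂ) ∈ ball (0 : ℂ) 1) :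
    g.comp (updateCoord n c) ∈ polydiscAlgebra := by
  intro z hz i
  by_cases h : i = n
  · subst h
    exact ⟨fun _ => g (Function.update z i c), differentiableOn_const _,
      fun w _ => by simp [updateCoord]⟩
  · obtain ⟨k, hk, he⟩ := hg (Function.update z n c) (fun j => by
      by_cases hj : j = n
      · subst hj; simpa using hc
      · simpa [hj] using hz j) i
    refine ⟨k, hk, fun w hw => ?_⟩
    rw [← he w hw, Function.update_comm (Ne.symm h)]
    rfl

/-- The map that replaces all coordinates from the `n`-th on by `0`. -/
def truncate (n : ℕ) : C(ClosedPolydisc, ClosedPolydisc) :=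
  ⟨fun z i => if i < n then z i else ⟨0, by simp⟩, by
    refine continuous_pi fun i => ?_
    by_cases h : i < n
    · simp only [h, if_true]; fun_prop
    · simp only [h, if_false]; fun_prop⟩

theorem truncate_apply (n : ℕ) (z : ClosedPolydisc) (i : ℕ) :
    truncate n z i = if i < n then z i else ⟨0, by simp⟩ := rfl

theorem comp_truncate_mem {g : C(ClosedPolydisc, ℂ)} (hg : g ∈ polydiscAlgebra) (n : ℕ) :
    g.comp (truncate n) ∈ polydiscAlgebra := by
  intro z hz i
  by_cases h : i < n
  · obtain ⟨k, hk, he⟩ := hg (truncate n z) (fun j => by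
      rw [truncate_apply]
      split_ifs
      · exact hz j
      · simp) i
    refine ⟨k, hk, fun w hw => ?_⟩
    rw [← he w hw, ContinuousMap.comp_apply]
    congr 1
    ext j
    by_cases hj : j = i
    · subst hj; simp [truncate_apply, h]
    · simp [truncate_apply, hj]
  · refine ⟨fun _ => g (truncate n z), differentiableOn_const _, fun w _ => ?_⟩
    rw [ContinuousMap.comp_apply]
    congr 1
    ext j
    by_cases hj : j = i
    · subst hj; simp [truncate_apply, h]
    · simp [truncate_apply, hj]

theorem tendsto_comp_truncate (g : C(ClosedPolydisc, ℂ)) :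
    Tendsto (fun n => g.comp (truncate n)) atTop (𝓝 g) := by
  refine tendsto_comp_of_tendstoUniformly (tendstoUniformly_polydisc_iff.2 fun i => ?_) g
  rw [Metric.tendstoUniformly_iff]
  intro ε hε
  filter_upwards [eventually_gt_atTop i] with n hn z
  simpa [truncate_apply, hn] using hε

/-- The map that multiplies the `n`-th coordinate by `r`. -/
def dilateCoord (n : ℕ) (r : Icc (0 : ℝ) 1) : C(ClosedPolydisc, ClosedPolydisc) :=
  ⟨fun z => Function.update z n ⟨(r : ℝ) * z n, by
      have h1 := mem_closedBall_zero_iff.1 (z n).2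
      rw [mem_closedBall_zero_iff, norm_mul, Complex.norm_real, Real.norm_of_nonneg r.2.1]
      exact mul_le_one₀ r.2.2 (norm_nonneg _) h1⟩, by fun_prop⟩

theorem dilateCoord_apply_self (n : ℕ) (r : Icc (0 : ℝ) 1) (z : ClosedPolydisc) :
    (dilateCoord n r z n : ℂ) = (r : ℝ) * z n := by simp [dilateCoord]

theorem dilateCoord_apply_of_ne {n i : ℕ} (h : i ≠ n) (r : Icc (0 : ℝ) 1) (z : ClosedPolydisc) :
    dilateCoord n r z i = z i := by simp [dilateCoord, h]

/-- Dilation makes the expansion in the `n`-th coordinate converge geometrically up to the boundary;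
by uniform continuity on the compact polydisc it costs little. -/
theorem exists_dilateCoord_close (g : C(ClosedPolydisc, ℂ)) (n : ℕ) :
    g ∈ closure {h | ∃ r : Icc (0 : ℝ) 1, (r : ℝ) < 1 ∧ h = g.comp (dilateCoord n r)} := by
  have hr : ∀ k : ℕ, (1 - 1 / ((k : ℝ) + 1)) ∈ Icc (0 : ℝ) 1 := fun k => by
    have : 1 / ((k : ℝ) + 1) ≤ 1 := by rw [div_le_one (by positivity)]; linarith [k.cast_nonneg (α := ℝ)]
    have : 0 ≤ 1 / ((k : ℝ) + 1) := by positivity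
    constructor <;> linarith
  refine mem_closure_of_tendsto (f := fun k : ℕ => g.comp (dilateCoord n ⟨_, hr k⟩)) (b := atTop)
    (tendsto_comp_of_tendstoUniformly (tendstoUniformly_polydisc_iff.2 fun i => ?_) g)
    (Eventually.of_forall fun k => ⟨⟨_, hr k⟩, ?_, rfl⟩)
  · by_cases hi : i = n
    · subst hi
      rw [Metric.tendstoUniformly_iff]
      intro ε hε
      filter_upwards [(tendsto_one_div_add_atTop_nhds_zero_nat (𝕜 := ℝ)).eventually
        (gt_mem_nhds hε)] with k hk z
      rw [dilateCoord_apply_self, dist_eq_norm]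
      have h1 := mem_closedBall_zero_iff.1 (z i).2
      have h2 : (z i : ℂ) - ((1 - 1 / ((k : ℝ) + 1) : ℝ) : ℂ) * z i =
        ((1 / ((k : ℝ) + 1) : ℝ) : ℂ) * z i := by push_cast; ring
      rw [h2, norm_mul, Complex.norm_real, Real.norm_of_nonneg (by positivity)]
      refine lt_of_le_of_lt ?_ hk
      exact mul_le_of_le_one_right (by positivity) h1
    · simp only [dilateCoord_apply_of_ne hi]
      rw [Metric.tendstoUniformly_iff]
      intro ε hε
      exact Eventually.of_forall fun _ _ => by simpa using hε
  · have : 0 < 1 / ((k : ℝ) + 1) := by positivity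
    show 1 - 1 / ((k : ℝ) + 1) < 1
    linarith

theorem mul_rootUnity_pow_mem_ball {r : ℝ} (hr0 : 0 ≤ r) (hr1 : r < 1) (M l : ℕ) :
    (r * rootUnity M ^ l : ℂ) ∈ ball (0 : ℂ) 1 := by
  rw [mem_ball_zero_iff, norm_mul, norm_pow, norm_rootUnity, one_pow, mul_one, Complex.norm_real,
    Real.norm_of_nonneg hr0]
  exact hr1

theorem dependsOn_comp_updateCoord {g : C(ClosedPolydisc, ℂ)} {n : ℕ}
    (hg : DependsOn g (Iio (n + 1))) (c : closedBall (0 : ℂ) 1) :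
    DependsOn (g.comp (updateCoord n c)) (Iio n) := by
  intro x y hxy
  refine hg fun i hi => ?_
  by_cases h : i = n
  · subst h; simp [updateCoord]
  · simpa [updateCoord, h] using hxy i (lt_of_le_of_ne (Nat.lt_succ_iff.1 hi) h)

/-- Induction on the number of variables: after dilating the last variable, `g` is a uniform limit
of polynomials in it whose coefficients involve only the earlier variables. -/
theorem mem_coordClosure_of_dependsOn (n : ℕ) : ∀ g ∈ polydiscAlgebra, DependsOn g (Iio n) →
    g ∈ coordClosure := by
  induction n with
  | zero =>
    intro g _ hd
    have : g = algebraMap ℂ _ (g fun _ => ⟨0, by simp⟩) := by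
      ext z
      exact hd fun i hi => absurd hi (by simp)
    rw [this]
    exact coordClosure.algebraMap_mem _
  | succ n ih =>
    intro g hg hd
    refine closure_minimal ?_ isClosed_coordClosure (exists_dilateCoord_close g n)
    rintro _ ⟨r, hr1, rfl⟩
    have hr0 := r.2.1
    let pt : ℕ → ℕ → closedBall (0 : ℂ) 1 := fun M l =>
      ⟨_, ball_subset_closedBall (mul_rootUnity_pow_mem_ball hr0 hr1 M l)⟩
    -- Up to aliasing, `d M k` is the `k`-th Taylor coefficient in coordinate `n` times `r ^ k`. It
    -- is a finite combination of copies of `g` with that coordinate frozen inside the open disc, so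
    -- the induction hypothesis applies.
    let d : ℕ → ℕ → C(ClosedPolydisc, ℂ) := fun M k =>
      (M : ℂ)⁻¹ • ∑ l ∈ Finset.range M, (rootUnity M ^ l)⁻¹ ^ k • g.comp (updateCoord n (pt M l))
    have hmem : ∀ M k, d M k ∈ coordClosure := fun M k =>
      Subalgebra.smul_mem _ (Subalgebra.sum_mem _ fun l _ => Subalgebra.smul_mem _
        (ih _ (comp_updateCoord_mem hg n (mul_rootUnity_pow_mem_ball hr0 hr1 M l))
          (dependsOn_comp_updateCoord hd _)) _) _
    have hlim : Tendsto (fun M : ℕ => 2 * ‖g‖ * (r : ℝ) ^ M / (1 - r)) atTop (𝓝 0) := by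
      have := ((tendsto_pow_atTop_nhds_zero_of_lt_one hr0 hr1).const_mul (2 * ‖g‖)).div_const
        (1 - (r : ℝ))
      simpa using this
    refine isClosed_coordClosure.mem_of_tendsto (b := atTop)
      (f := fun M => ∑ k ∈ Finset.range M, d M k * coord n ^ k) ?_
      (Eventually.of_forall fun M => Subalgebra.sum_mem _ fun k _ =>
        Subalgebra.mul_mem _ (hmem M k) (Subalgebra.pow_mem _ (coord_mem_coordClosure n) k))
    rw [tendsto_iff_norm_sub_tendsto_zero]
    refine squeeze_zero' (Eventually.of_forall fun _ => norm_nonneg _) ?_ hlim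
    filter_upwards [eventually_ne_atTop 0] with M hM
    have h1r : 0 < 1 - (r : ℝ) := by linarith
    refine norm_le_of_forall_openPolydisc (by positivity) fun z hz => ?_
    have hφd := separatelyHolomorphic_iff.1 hg z hz n
    have hφC : ∀ w ∈ ball (0 : ℂ) 1, ‖slice g z n w‖ ≤ ‖g‖ := fun w hw => by
      rw [slice_of_mem_ball _ _ _ hw]
      exact g.norm_coe_le_norm _
    have key := norm_sum_rootMean_sub_le hM hr0 hr1 (norm_taylorCoeff_le hφd hφC)
      (fun w hw => hasSum_taylorCoeff hφd hw) (z := z n) (mem_closedBall_zero_iff.1 (z n).2)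
    convert! key using 2
    simp only [ContinuousMap.sub_apply, ContinuousMap.sum_apply, ContinuousMap.mul_apply,
      ContinuousMap.pow_apply, coord_apply]
    congr 1
    · refine Finset.sum_congr rfl fun k _ => ?_
      congr 1
      simp only [d, rootMean, ContinuousMap.smul_apply, ContinuousMap.sum_apply, smul_eq_mul]
      congr 1
      refine Finset.sum_congr rfl fun l _ => ?_
      rw [slice_of_mem_ball _ _ _ (mul_rootUnity_pow_mem_ball hr0 hr1 M l)]
      rfl
    · rw [ContinuousMap.comp_apply]
      exact (slice_coe g z n ⟨(r : ℝ) * z n, _⟩).symm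

theorem polydiscAlgebra_le_coordClosure : polydiscAlgebra ≤ coordClosure := by
  intro g hg
  refine isClosed_coordClosure.mem_of_tendsto (tendsto_comp_truncate g)
    (Eventually.of_forall fun n => mem_coordClosure_of_dependsOn n _ (comp_truncate_mem hg n) ?_)
  intro x y hxy
  rw [ContinuousMap.comp_apply, ContinuousMap.comp_apply]
  congr 1
  ext i
  by_cases hi : i < n
  · simp [truncate_apply, hi, hxy i hi]
  · simp [truncate_apply, hi]

/-! ### Pull-backs of the polydisc algebra -/

section Pullback

variable {X : Type*} [TopologicalSpace X]

/-- Composition of functions on the closed polydisc with a continuous map `τ : X → D̄^ℕ`. -/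
noncomputable def pullback (τ : C(X, ClosedPolydisc)) : C(ClosedPolydisc, ℂ) →ₐ[ℂ] (X →ᵇ ℂ) where
  toFun g := (BoundedContinuousFunction.mkOfCompact g).compContinuous τ
  map_one' := by ext; rfl
  map_mul' _ _ := by ext; rfl
  map_zero' := by ext; rfl
  map_add' _ _ := by ext; rfl
  commutes' _ := by ext; rfl

@[simp] theorem pullback_apply (τ : C(X, ClosedPolydisc)) (g : C(ClosedPolydisc, ℂ)) (x : X) :
    pullback τ g x = g (τ x) := rfl

theorem norm_pullback_le (τ : C(X, ClosedPolydisc)) (g : C(ClosedPolydisc, ℂ)) :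
    ‖pullback τ g‖ ≤ ‖g‖ :=
  (BoundedContinuousFunction.norm_le (norm_nonneg _)).2 fun _ => g.norm_coe_le_norm _

theorem continuous_pullback (τ : C(X, ClosedPolydisc)) : Continuous (pullback τ) :=
  AddMonoidHomClass.continuous_of_bound (pullback τ) 1 fun g => by
    simpa using norm_pullback_le τ g

theorem norm_le_norm_pullback_of_adjoin {τ : C(X, ClosedPolydisc)}
    (h : ∀ g ∈ Algebra.adjoin ℂ (range coord), ‖g‖ ≤ ‖pullback τ g‖) {g : C(ClosedPolydisc, ℂ)}
    (hg : g ∈ polydiscAlgebra) : ‖g‖ ≤ ‖pullback τ g‖ :=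
  closure_minimal (s := (Algebra.adjoin ℂ (range coord) : Set C(ClosedPolydisc, ℂ)))
    (t := {g | ‖g‖ ≤ ‖pullback τ g‖}) h
    (isClosed_le continuous_norm (continuous_pullback τ).norm) (polydiscAlgebra_le_coordClosure hg)

/-- The pull-back, restricted to the polydisc algebra. -/
noncomputable def pullbackHom (τ : C(X, ClosedPolydisc)) : polydiscAlgebra →ₐ[ℂ] (X →ᵇ ℂ) :=
  (pullback τ).comp polydiscAlgebra.val

@[simp] theorem pullbackHom_apply (τ : C(X, ClosedPolydisc)) (g : polydiscAlgebra) (x : X) :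
    pullbackHom τ g x = (g : C(ClosedPolydisc, ℂ)) (τ x) := rfl

theorem isometry_pullbackHom {τ : C(X, ClosedPolydisc)}
    (h : ∀ g ∈ Algebra.adjoin ℂ (range coord), ‖g‖ ≤ ‖pullback τ g‖) :
    Isometry (pullbackHom τ) :=
  AddMonoidHomClass.isometry_of_norm (pullbackHom τ) fun g =>
    le_antisymm (norm_pullback_le τ _) (norm_le_norm_pullback_of_adjoin h g.2)

theorem isClosed_range_pullbackHom {τ : C(X, ClosedPolydisc)} (h : Isometry (pullbackHom τ)) :
    IsClosed ((pullbackHom τ).range : Set (X →ᵇ ℂ)) := by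
  rw [AlgHom.coe_range]
  exact h.isClosedEmbedding.isClosed_range

theorem exists_algEquiv_of_isometry {τ : C(X, ClosedPolydisc)} (h : Isometry (pullbackHom τ))
    {S : Set (X → ℂ)} (h1 : ∀ g ∈ polydiscAlgebra, (fun x => g (τ x)) ∈ S)
    (h2 : ∀ f ∈ S, ∃ g ∈ polydiscAlgebra, ∀ x, f x = g (τ x)) :
    ∃ A : Subalgebra ℂ (X →ᵇ ℂ),
      (fun f : X →ᵇ ℂ => (f : X → ℂ)) '' (A : Set (X →ᵇ ℂ)) = S ∧
      CompleteSpace A ∧ ∃ e : polydiscAlgebra ≃ₐ[ℂ] A, Isometry e := by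
  refine ⟨(pullbackHom τ).range, ?_, (isClosed_range_pullbackHom h).completeSpace_coe,
    AlgEquiv.ofInjective (pullbackHom τ) h.injective, fun x y => h x y⟩
  apply Subset.antisymm
  · rintro _ ⟨_, ⟨g, rfl⟩, rfl⟩
    exact h1 g g.2
  · intro f hf
    obtain ⟨g, hg, he⟩ := h2 f hf
    exact ⟨_, ⟨⟨g, hg⟩, rfl⟩, funext fun x => (he x).symm⟩

/-- The range is closed because it is an isometric image of a complete space. Boundedness of `f` is
not assumed: it comes from an approximation with error 1. -/
theorem exists_polydiscAlgebra_eq_of_approx {τ : C(X, ClosedPolydisc)}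
    (h : Isometry (pullbackHom τ)) {f : X → ℂ} (hf : Continuous f)
    (H : ∀ ε > 0, ∃ g ∈ polydiscAlgebra, ∀ x, ‖g (τ x) - f x‖ ≤ ε) :
    ∃ g ∈ polydiscAlgebra, ∀ x, f x = g (τ x) := by
  obtain ⟨g₁, -, h₁⟩ := H 1 one_pos
  have hbdd : ∀ x, ‖f x‖ ≤ ‖g₁‖ + 1 := fun x => by
    have h2 := g₁.norm_coe_le_norm (τ x)
    have h3 := norm_sub_norm_le (f x) (g₁ (τ x))
    rw [norm_sub_rev] at h3
    linarith [h₁ x]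
  let f' : X →ᵇ ℂ := BoundedContinuousFunction.ofNormedAddCommGroup f hf _ hbdd
  have hf' : f' ∈ closure ((pullbackHom τ).range : Set (X →ᵇ ℂ)) := by
    rw [Metric.mem_closure_iff]
    intro ε hε
    obtain ⟨g, hg, hgf⟩ := H (ε / 2) (half_pos hε)
    refine ⟨pullbackHom τ ⟨g, hg⟩, ⟨_, rfl⟩, lt_of_le_of_lt ?_ (half_lt_self hε)⟩
    rw [BoundedContinuousFunction.dist_le (half_pos hε).le]
    intro x
    rw [dist_comm, dist_eq_norm]
    exact hgf x
  rw [(isClosed_range_pullbackHom h).closure_eq] at hf'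
  obtain ⟨g, hg⟩ := hf'
  exact ⟨g, g.2, fun x => (DFunLike.congr_fun hg x).symm⟩

end Pullback

/-! ### Coefficients of exponential sums -/

theorem norm_integral_exp_le {ω T : ℝ} (hω : ω ≠ 0) :
    ‖∫ t in (0 : ℝ)..T, Complex.exp (ω * Complex.I * t)‖ ≤ 2 / |ω| := by
  have h0 : (ω * Complex.I : ℂ) ≠ 0 := by simp [hω]
  rw [integral_exp_mul_complex h0, norm_div]
  have h1 : ‖(ω * Complex.I : ℂ)‖ = |ω| := by simp
  rw [h1]
  gcongr
  refine (norm_sub_le _ _).trans ?_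
  have h2 : ∀ x : ℝ, ‖Complex.exp (ω * Complex.I * x)‖ = 1 := fun x => by
    have : (ω * Complex.I * x : ℂ) = ((ω * x : ℝ) : ℂ) * Complex.I := by push_cast; ring
    rw [this, Complex.norm_exp_ofReal_mul_I]
  rw [h2, h2]; norm_num

/-- Bohr's mean value: after multiplication by `exp (-i ω_β t)` and integration over `[0, T]`, the
other frequencies contribute a bounded amount `K`, negligible against `T`. -/
theorem norm_coeff_le_of_expSum {ι : Type*} {S : Finset ι} {c : ι → ℂ} {ω : ι → ℝ}
    (hω : InjOn ω S) {M : ℝ} (hM : ∀ t : ℝ, ‖∑ α ∈ S, c α * Complex.exp (ω α * Complex.I * t)‖ ≤ M)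
    {β : ι} (hβ : β ∈ S) : ‖c β‖ ≤ M := by
  classical
  set K : ℝ := ∑ α ∈ S.erase β, ‖c α‖ * (2 / |ω α - ω β|) with hK
  have key : ∀ T : ℝ, 0 < T → ‖c β‖ ≤ M + K / T := by
    intro T hT
    have h1 : ‖∫ t in (0 : ℝ)..T, ∑ α ∈ S, c α * Complex.exp ((ω α - ω β : ℝ) * Complex.I * t)‖ ≤
        M * |T - 0| := by
      refine intervalIntegral.norm_integral_le_of_norm_le_const fun t _ => ?_
      have : ∑ α ∈ S, c α * Complex.exp ((ω α - ω β : ℝ) * Complex.I * t) =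
          (∑ α ∈ S, c α * Complex.exp (ω α * Complex.I * t)) *
            Complex.exp ((-(ω β * t) : ℝ) * Complex.I) := by
        rw [Finset.sum_mul]
        refine Finset.sum_congr rfl fun α _ => ?_
        rw [mul_assoc (c α), ← Complex.exp_add]
        congr 2
        push_cast; ring
      rw [this, norm_mul, Complex.norm_exp_ofReal_mul_I, mul_one]
      exact hM t
    rw [intervalIntegral.integral_finsetSum (fun α _ =>
      (Continuous.intervalIntegrable (by fun_prop) _ _)), ← Finset.add_sum_erase _ _ hβ] at h1
    simp only [intervalIntegral.integral_const_mul] at h1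
    have h2 : ‖∑ α ∈ S.erase β, c α * ∫ t in (0 : ℝ)..T,
        Complex.exp ((ω α - ω β : ℝ) * Complex.I * t)‖ ≤ K := by
      refine (norm_sum_le _ _).trans (Finset.sum_le_sum fun α hα => ?_)
      rw [norm_mul]
      gcongr
      refine norm_integral_exp_le fun h => ?_
      exact (Finset.ne_of_mem_erase hα) (hω (Finset.mem_of_mem_erase hα) hβ (sub_eq_zero.1 h))
    have h3 : c β * ∫ t in (0 : ℝ)..T, Complex.exp ((ω β - ω β : ℝ) * Complex.I * t) = T * c β := by
      simp [mul_comm]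
    rw [h3, sub_zero, abs_of_pos hT] at h1
    have h4 : ‖(T : ℂ) * c β‖ = T * ‖c β‖ := by
      rw [norm_mul, Complex.norm_real, Real.norm_of_nonneg hT.le]
    have h5 : T * ‖c β‖ ≤ M * T + K := by
      rw [← h4]
      have := norm_sub_norm_le ((T : ℂ) * c β) (-∑ α ∈ S.erase β, c α * ∫ t in (0 : ℝ)..T,
        Complex.exp ((ω α - ω β : ℝ) * Complex.I * t))
      rw [sub_neg_eq_add, norm_neg] at this
      linarith
    rw [show M + K / T = (M * T + K) / T by field_simp, le_div_iff₀ hT]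
    linarith
  have hlim : Tendsto (fun T : ℝ => M + K / T) atTop (𝓝 (M + 0)) :=
    tendsto_const_nhds.add (tendsto_const_nhds.div_atTop tendsto_id)
  rw [add_zero] at hlim
  refine ge_of_tendsto hlim ?_
  filter_upwards [eventually_gt_atTop 0] with T hT using key T hT

/-- On the line `Re s = σ` the sum has the distinct frequencies `-log n`; the weight `n ^ (-σ)`
disappears as `σ → 0`. -/
theorem norm_coeff_le_of_dirichletSum {ι : Type*} {S : Finset ι} {c : ι → ℂ} {n : ι → ℕ}
    (hn : InjOn n S) (hn0 : ∀ α ∈ S, n α ≠ 0) {M : ℝ}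
    (hM : ∀ s : ℂ, 0 < s.re → ‖∑ α ∈ S, c α * (n α : ℂ) ^ (-s)‖ ≤ M)
    {β : ι} (hβ : β ∈ S) : ‖c β‖ ≤ M := by
  have key : ∀ σ : ℝ, 0 < σ → ‖c β‖ * (n β : ℝ) ^ (-σ) ≤ M := by
    intro σ hσ
    have h1 : ∀ t : ℝ, ∑ α ∈ S, (c α * (n α : ℂ) ^ (-(σ : ℂ))) *
        Complex.exp ((-Real.log (n α) : ℝ) * Complex.I * t) =
        ∑ α ∈ S, c α * (n α : ℂ) ^ (-(σ + t * Complex.I : ℂ)) := by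
      intro t
      refine Finset.sum_congr rfl fun α hα => ?_
      have h0 : (n α : ℂ) ≠ 0 := by exact_mod_cast hn0 α hα
      rw [mul_assoc, neg_add, Complex.cpow_add _ _ h0, Complex.cpow_def_of_ne_zero h0 (-(t * _)),
        ← Complex.natCast_log]
      congr 3
      push_cast; ring
    have h2 := norm_coeff_le_of_expSum (S := S) (c := fun α => c α * (n α : ℂ) ^ (-(σ : ℂ)))
      (ω := fun α => -Real.log (n α)) (M := M) ?_ (fun t => ?_) hβ
    · rw [norm_mul, Complex.norm_natCast_cpow_of_pos (Nat.pos_of_ne_zero (hn0 β hβ))] at h2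
      simpa using h2
    · intro α hα γ hγ h
      apply hn hα hγ
      have h3 : ∀ δ ∈ S, (0 : ℝ) < n δ := fun δ hδ => by
        exact_mod_cast Nat.pos_of_ne_zero (hn0 δ hδ)
      exact_mod_cast Real.log_injOn_pos (h3 α hα) (h3 γ hγ) (neg_injective h)
    · rw [h1]
      exact hM _ (by simpa using hσ)
  have h0 : (n β : ℝ) ≠ 0 := by exact_mod_cast hn0 β hβ
  have hlim : Tendsto (fun σ : ℝ => ‖c β‖ * (n β : ℝ) ^ (-σ)) (𝓝[>] 0) (𝓝 ‖c β‖) := by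
    have : ContinuousAt (fun σ : ℝ => ‖c β‖ * (n β : ℝ) ^ (-σ)) 0 :=
      continuousAt_const.mul (ContinuousAt.rpow continuousAt_const continuousAt_neg (Or.inl h0))
    have h := this.tendsto
    simp only [neg_zero, Real.rpow_zero, mul_one] at h
    exact h.mono_left nhdsWithin_le_nhds
  refine le_of_tendsto hlim ?_
  filter_upwards [self_mem_nhdsWithin] with σ hσ using key σ hσ

/-! ### The Bohr lift -/

theorem norm_natCast_cpow_neg_le_one {n : ℕ} (hn : n ≠ 0) {s : ℂ} (hs : 0 ≤ s.re) :
    ‖(n : ℂ) ^ (-s)‖ ≤ 1 := by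
  rw [Complex.norm_natCast_cpow_of_pos (Nat.pos_of_ne_zero hn)]
  exact Real.rpow_le_one_of_one_le_of_nonpos
    (by exact_mod_cast Nat.one_le_iff_ne_zero.2 hn) (by simpa using hs)

/-- The `i`-th prime number. -/
noncomputable def nthPrime (i : ℕ) : ℕ := Nat.nth Nat.Prime i

theorem prime_nthPrime (i : ℕ) : (nthPrime i).Prime := Nat.prime_nth_prime i

theorem nthPrime_injective : Function.Injective nthPrime :=
  Nat.nth_injective Nat.infinite_setOfPred_prime

/-- The point `(pᵢ⁻ˢ)ᵢ` of the closed polydisc. -/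
noncomputable def bohrPoint : C(rightHalfPlane, ClosedPolydisc) where
  toFun s i := ⟨(nthPrime i : ℂ) ^ (-(s : ℂ)), by
    rw [mem_closedBall_zero_iff]
    exact norm_natCast_cpow_neg_le_one (prime_nthPrime i).ne_zero (le_of_lt s.2)⟩
  continuous_toFun := by
    refine continuous_pi fun i => Continuous.subtype_mk ?_ _
    refine Continuous.const_cpow (by fun_prop) (Or.inl ?_)
    exact_mod_cast (prime_nthPrime i).ne_zero

@[simp] theorem bohrPoint_apply (s : rightHalfPlane) (i : ℕ) :
    (bohrPoint s i : ℂ) = (nthPrime i : ℂ) ^ (-(s : ℂ)) := rfl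

/-- The number with exponent `α i` at the `i`-th prime. -/
noncomputable def bohrIndex (α : ℕ →₀ ℕ) : ℕ := α.prod fun i k => nthPrime i ^ k

theorem bohrIndex_ne_zero (α : ℕ →₀ ℕ) : bohrIndex α ≠ 0 :=
  Finset.prod_ne_zero_iff.2 fun i _ => pow_ne_zero _ (prime_nthPrime i).ne_zero

theorem bohrIndex_injective : Function.Injective bohrIndex := by
  have key : ∀ α : ℕ →₀ ℕ,
      (bohrIndex α).factorization = α.embDomain ⟨nthPrime, nthPrime_injective⟩ := by
    intro α
    rw [← Nat.prod_pow_factorization_eq_self (f := α.embDomain ⟨nthPrime, nthPrime_injective⟩)]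
    · rw [Finsupp.prod_embDomain]
      rfl
    · intro p hp
      rw [Finsupp.support_embDomain, Finset.mem_map] at hp
      obtain ⟨i, _, rfl⟩ := hp
      exact prime_nthPrime i
  intro α β h
  have := congrArg Nat.factorization h
  rw [key, key] at this
  exact Finsupp.embDomain_injective _ this

/-- The completely multiplicative function `n ↦ n⁻ˢ`. -/
noncomputable def natCpowHom (s : ℂ) : ℕ →* ℂ where
  toFun n := (n : ℂ) ^ (-s)
  map_one' := by simp
  map_mul' m n := by push_cast; exact Complex.natCast_mul_natCast_cpow m n _

theorem bohrIndex_cpow (α : ℕ →₀ ℕ) (s : ℂ) :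
    (bohrIndex α : ℂ) ^ (-s) = α.prod fun i k => ((nthPrime i : ℂ) ^ (-s)) ^ k := by
  change natCpowHom s (bohrIndex α) = _
  rw [bohrIndex, Finsupp.prod, map_prod]
  simp only [map_pow]
  rfl

theorem aeval_coord_apply (Q : MvPolynomial ℕ ℂ) (z : ClosedPolydisc) :
    MvPolynomial.aeval coord Q z =
      ∑ α ∈ Q.support, Q.coeff α * α.prod fun i k => (z i : ℂ) ^ k := by
  rw [MvPolynomial.aeval_def, MvPolynomial.eval₂_eq, ContinuousMap.sum_apply]
  refine Finset.sum_congr rfl fun α _ => ?_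
  rw [ContinuousMap.mul_apply, ContinuousMap.prod_apply]
  rfl

theorem pullback_bohrPoint_aeval (Q : MvPolynomial ℕ ℂ) (s : rightHalfPlane) :
    pullback bohrPoint (MvPolynomial.aeval coord Q) s =
      ∑ α ∈ Q.support, Q.coeff α * (bohrIndex α : ℂ) ^ (-(s : ℂ)) := by
  rw [pullback_apply, aeval_coord_apply]
  simp only [bohrPoint_apply, bohrIndex_cpow]

theorem norm_coeff_le_norm_pullback (Q : MvPolynomial ℕ ℂ) (α : ℕ →₀ ℕ) :
    ‖Q.coeff α‖ ≤ ‖pullback bohrPoint (MvPolynomial.aeval coord Q)‖ := by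
  by_cases h : α ∈ Q.support
  · refine norm_coeff_le_of_dirichletSum (c := fun α => MvPolynomial.coeff α Q)
      (n := bohrIndex) bohrIndex_injective.injOn
      (fun α _ => bohrIndex_ne_zero α) (fun s hs => ?_) h
    have := pullback_bohrPoint_aeval Q ⟨s, hs⟩
    simp only at this
    rw [← this]
    exact BoundedContinuousFunction.norm_coe_le_norm _ _
  · rw [MvPolynomial.notMem_support_iff.1 h, norm_zero]
    exact norm_nonneg _

theorem norm_aeval_le_card_mul (Q : MvPolynomial ℕ ℂ) (z : ClosedPolydisc) :
    ‖MvPolynomial.aeval coord Q z‖ ≤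
      Q.support.card * ‖pullback bohrPoint (MvPolynomial.aeval coord Q)‖ := by
  rw [aeval_coord_apply, ← nsmul_eq_mul]
  refine norm_sum_le_of_le _ (fun α _ => ?_) |>.trans (Finset.sum_const _).le
  rw [norm_mul, Finsupp.prod, norm_prod]
  refine (mul_le_of_le_one_right (norm_nonneg _) ?_).trans (norm_coeff_le_norm_pullback Q α)
  refine Finset.prod_le_one (fun _ _ => norm_nonneg _) fun i _ => ?_
  rw [norm_pow]
  exact pow_le_one₀ (norm_nonneg _) (mem_closedBall_zero_iff.1 (z i).2)

/-- Powers of `Q` use no new variables and their degrees grow linearly, so the number of monomials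
is polynomial in `k`. -/
theorem card_support_pow_le (Q : MvPolynomial ℕ ℂ) (k : ℕ) :
    (Q ^ k).support.card ≤ (k * Q.totalDegree + 1) ^ Q.vars.card := by
  classical
  have h : (Q ^ k).support ⊆
      Q.vars.finsupp fun _ => Finset.range (k * Q.totalDegree + 1) := by
    intro α hα
    rw [Finset.mem_finsupp_iff]
    constructor
    · intro i hi
      exact MvPolynomial.vars_pow Q k ((MvPolynomial.mem_vars_iff_mem_support i).2 ⟨α, hα, hi⟩)
    · intro i hi
      rw [Finset.mem_range, Nat.lt_succ_iff]
      calc α i ≤ α.sum fun _ e => e := by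
            by_cases h0 : i ∈ α.support
            · exact Finset.single_le_sum (f := fun j => α j) (fun _ _ => Nat.zero_le _) h0
            · rw [Finsupp.notMem_support_iff.1 h0]; exact Nat.zero_le _
        _ ≤ (Q ^ k).totalDegree := MvPolynomial.le_totalDegree hα
        _ ≤ _ := MvPolynomial.totalDegree_pow Q k
  refine (Finset.card_le_card h).trans ?_
  rw [Finset.card_finsupp, Finset.prod_const, Finset.card_range]

theorem le_of_forall_pow_le {x M : ℝ} {d v : ℕ} (hM : 0 ≤ M)
    (h : ∀ k : ℕ, x ^ k ≤ ((k * d + 1 : ℕ) : ℝ) ^ v * M ^ k) : x ≤ M := by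
  by_contra! hlt
  have hx0 : 0 < x := hM.trans_lt hlt
  have hq : |M / x| < 1 := by
    rw [abs_of_nonneg (by positivity), div_lt_one hx0]; exact hlt
  have hlim := (tendsto_pow_const_mul_const_pow_of_abs_lt_one v hq).const_mul (((d : ℝ) + 1) ^ v)
  rw [mul_zero] at hlim
  refine absurd (ge_of_tendsto hlim ?_) (by norm_num : ¬ (1 : ℝ) ≤ 0)
  filter_upwards [eventually_ge_atTop 1] with k hk
  have hk' : (1 : ℝ) ≤ k := by exact_mod_cast hk
  rw [div_pow, ← mul_assoc, ← mul_pow, ← mul_div_assoc, le_div_iff₀ (by positivity), one_mul]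
  refine (h k).trans ?_
  gcongr
  push_cast
  nlinarith

/-- The power trick: the crude bound `norm_aeval_le_card_mul` for `Q ^ k` becomes sharp after `k`-th
roots. This avoids Kronecker's theorem on the density of the line `t ↦ (pᵢ⁻ⁱᵗ)ᵢ` in the torus. -/
theorem norm_le_norm_pullback_bohrPoint {g : C(ClosedPolydisc, ℂ)}
    (hg : g ∈ Algebra.adjoin ℂ (range coord)) : ‖g‖ ≤ ‖pullback bohrPoint g‖ := by
  rw [Algebra.adjoin_range_eq_range_aeval] at hg
  obtain ⟨Q, rfl⟩ := hg
  refine (ContinuousMap.norm_le _ (norm_nonneg _)).2 fun z => ?_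
  refine le_of_forall_pow_le (d := Q.totalDegree) (v := Q.vars.card)
    (norm_nonneg _) fun k => ?_
  have h1 := norm_aeval_le_card_mul (Q ^ k) z
  simp only [map_pow, ContinuousMap.pow_apply, norm_pow] at h1
  refine h1.trans ?_
  gcongr
  · exact_mod_cast card_support_pow_le Q k
  · refine (BoundedContinuousFunction.norm_le (by positivity)).2 fun s => ?_
    rw [BoundedContinuousFunction.pow_apply, norm_pow]
    gcongr
    exact BoundedContinuousFunction.norm_coe_le_norm _ _

theorem isometry_pullbackHom_bohrPoint : Isometry (pullbackHom bohrPoint) :=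
  isometry_pullbackHom fun _ => norm_le_norm_pullback_bohrPoint

/-! ### A truncation kernel on vertical lines -/

section Kernel

open MeasureTheory FourierTransform

theorem integrable_norm_rpow_neg_verticalLine {c r : ℝ} (hc : 0 < c) (hr : 1 < r) :
    Integrable fun ξ : ℝ => ‖(c + 2 * Real.pi * ξ * Complex.I : ℂ)‖ ^ (-r) := by
  -- The modulus dominates both `c` and `|ξ|`, hence their average.
  set m : ℝ := min c 1 / 2 with hm
  have hm0 : 0 < m := by positivity
  have hlow : ∀ ξ : ℝ, m * (1 + ‖ξ‖) ≤ ‖(c + 2 * Real.pi * ξ * Complex.I : ℂ)‖ := by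
    intro ξ
    have h1 : c ≤ ‖(c + 2 * Real.pi * ξ * Complex.I : ℂ)‖ := by
      have := Complex.abs_re_le_norm (c + 2 * Real.pi * ξ * Complex.I : ℂ)
      simp only [Complex.add_re, Complex.ofReal_re, Complex.mul_re, Complex.I_re, Complex.I_im,
        mul_zero, Complex.mul_im, Complex.ofReal_im, Complex.re_ofNat, Complex.im_ofNat, zero_mul,
        mul_one, add_zero, sub_zero] at this
      simpa using (le_abs_self c).trans this
    have h2 : |ξ| ≤ ‖(c + 2 * Real.pi * ξ * Complex.I : ℂ)‖ := by
      have h3 := Complex.abs_im_le_norm (c + 2 * Real.pi * ξ * Complex.I : ℂ)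
      have h4 : (c + 2 * Real.pi * ξ * Complex.I : ℂ).im = 2 * Real.pi * ξ := by simp
      rw [h4, abs_mul, abs_of_pos Real.two_pi_pos] at h3
      have : 1 ≤ 2 * Real.pi := by linarith [Real.pi_gt_three]
      nlinarith [abs_nonneg ξ]
    have h5 : min c 1 ≤ c := min_le_left _ _
    have h6 : min c 1 ≤ 1 := min_le_right _ _
    rw [hm, Real.norm_eq_abs]
    nlinarith [abs_nonneg ξ]
  have hpos : ∀ ξ : ℝ, 0 < m * (1 + ‖ξ‖) := fun ξ => by positivity
  have hint : Integrable fun ξ : ℝ => m ^ (-r) * (1 + ‖ξ‖) ^ (-r) :=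
    (integrable_one_add_norm (by simpa using hr)).const_mul _
  refine hint.mono' ?_ (Eventually.of_forall fun ξ => ?_)
  · refine Continuous.aestronglyMeasurable ?_
    refine Continuous.rpow_const (by fun_prop) fun ξ => Or.inl ?_
    exact ((hpos ξ).trans_le (hlow ξ)).ne'
  · rw [Real.norm_of_nonneg (by positivity), ← Real.mul_rpow hm0.le (by positivity)]
    exact Real.rpow_le_rpow_of_nonpos (hpos ξ) (hlow ξ) (by linarith)

theorem verticalLine_ne_zero {c : ℝ} (hc : 0 < c) (ξ : ℝ) :
    (c + 2 * Real.pi * ξ * Complex.I : ℂ) ≠ 0 := by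
  intro h
  have := congrArg Complex.re h
  simp at this
  linarith

theorem integrableOn_id_mul_exp_neg {c : ℝ} (hc : 0 < c) :
    IntegrableOn (fun x : ℝ => x * Real.exp (-c * x)) (Ioi 0) := by
  have := integrableOn_rpow_mul_exp_neg_mul_rpow (p := 1) (s := 1) (by norm_num) (by norm_num) hc
  simpa using this

theorem integral_id_mul_exp_neg {v : ℂ} (hv : 0 < v.re) :
    ∫ x in Ioi (0 : ℝ), (x : ℂ) * Complex.exp (-v * x) = 1 / v ^ 2 := by
  have hv0 : v ≠ 0 := fun h => by simp [h] at hv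
  have hnorm : ∀ x : ℝ, ‖Complex.exp (-v * x)‖ = Real.exp (-v.re * x) := fun x => by
    rw [Complex.norm_exp]; simp
  have hderiv : ∀ x ∈ Ici (0 : ℝ), HasDerivAt
      (fun x : ℝ => -((x : ℂ) / v + 1 / v ^ 2) * Complex.exp (-v * x))
      ((x : ℂ) * Complex.exp (-v * x)) x := by
    intro x _
    have h1 : HasDerivAt (fun x : ℝ => (x : ℂ)) 1 x := Complex.ofRealCLM.hasDerivAt
    have h2 := ((h1.div_const v).add_const (1 / v ^ 2)).neg.mul ((h1.const_mul (-v)).cexp)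
    convert! h2 using 1
    simp only [Pi.neg_apply]
    field_simp
    ring
  have hint : IntegrableOn (fun x : ℝ => (x : ℂ) * Complex.exp (-v * x)) (Ioi 0) := by
    refine (integrableOn_id_mul_exp_neg hv).mono' (by fun_prop) ?_
    refine (ae_restrict_mem measurableSet_Ioi).mono fun x hx => ?_
    rw [norm_mul, hnorm, Complex.norm_real, Real.norm_of_nonneg (le_of_lt hx)]
  have hlim : Tendsto (fun x : ℝ => -((x : ℂ) / v + 1 / v ^ 2) * Complex.exp (-v * x)) atTop
      (𝓝 0) := by
    rw [tendsto_zero_iff_norm_tendsto_zero]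
    have h1 : Tendsto (fun x : ℝ => (x * Real.exp (-v.re * x)) * ‖v‖⁻¹ +
        Real.exp (-v.re * x) * ‖1 / v ^ 2‖) atTop (𝓝 (0 * ‖v‖⁻¹ + 0 * ‖1 / v ^ 2‖)) := by
      have h2 := tendsto_rpow_mul_exp_neg_mul_atTop_nhds_zero 1 v.re hv
      have h3 := tendsto_rpow_mul_exp_neg_mul_atTop_nhds_zero 0 v.re hv
      simp only [Real.rpow_one, Real.rpow_zero, one_mul] at h2 h3
      exact (h2.mul_const _).add (h3.mul_const _)
    simp only [zero_mul, add_zero] at h1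
    refine squeeze_zero' (Eventually.of_forall fun _ => norm_nonneg _) ?_ h1
    filter_upwards [eventually_ge_atTop 0] with x hx
    rw [norm_mul, norm_neg, hnorm]
    have := norm_add_le ((x : ℂ) / v) (1 / v ^ 2)
    rw [norm_div, Complex.norm_real, Real.norm_of_nonneg hx] at this
    calc _ ≤ (x / ‖v‖ + ‖1 / v ^ 2‖) * Real.exp (-v.re * x) := by gcongr
      _ = _ := by rw [div_eq_mul_inv]; ring
  rw [integral_Ioi_of_hasDerivAt_of_tendsto' hderiv hint hlim]
  simp

/-- Fourier inversion for the ramp `x₊ exp (-c x)`, whose transform is `1 / (c + 2πiξ)²`. Unlike the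
step function of Perron's formula, the ramp is continuous and its transform is integrable. -/
theorem integral_exp_div_sq_verticalLine {c : ℝ} (hc : 0 < c) (x : ℝ) :
    ∫ ξ : ℝ, Complex.exp ((c + 2 * Real.pi * ξ * Complex.I) * x) /
      (c + 2 * Real.pi * ξ * Complex.I) ^ 2 = ((max x 0 : ℝ) : ℂ) := by
  let g : ℝ → ℂ := fun x => ((max x 0 * Real.exp (-c * x) : ℝ) : ℂ)
  have hgc : Continuous g := by fun_prop
  have hgi : g = (Ioi 0).indicator fun x => ((x * Real.exp (-c * x) : ℝ) : ℂ) := by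
    ext x
    by_cases hx : x ∈ Ioi 0
    · rw [indicator_of_mem hx]
      simp [g, max_eq_left (mem_Ioi.1 hx).le]
    · rw [indicator_of_notMem hx]
      simp [g, max_eq_right (not_lt.1 (mem_Ioi.not.1 hx))]
  have hg : Integrable g := by
    rw [hgi, integrable_indicator_iff measurableSet_Ioi]
    exact (integrableOn_id_mul_exp_neg hc).ofReal
  have hF : 𝓕 g = fun ξ : ℝ => 1 / (c + 2 * Real.pi * ξ * Complex.I : ℂ) ^ 2 := by
    ext ξ
    have hre : 0 < (c + 2 * Real.pi * ξ * Complex.I : ℂ).re := by simpa using hc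
    rw [← integral_id_mul_exp_neg hre, Real.fourier_eq', ← integral_indicator measurableSet_Ioi]
    congr 1
    ext x
    rw [hgi]
    by_cases hx : x ∈ Ioi 0
    · rw [indicator_of_mem hx, indicator_of_mem hx]
      push_cast
      rw [smul_eq_mul, mul_left_comm, ← Complex.exp_add]
      congr 2
      simp
      ring
    · rw [indicator_of_notMem hx, indicator_of_notMem hx, smul_zero]
  have hFi : Integrable (𝓕 g) := by
    rw [hF]
    refine (integrable_norm_rpow_neg_verticalLine hc one_lt_two).mono' ?_
      (Eventually.of_forall fun ξ => ?_)
    · refine Continuous.aestronglyMeasurable ?_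
      exact Continuous.div continuous_const (by fun_prop) fun ξ =>
        pow_ne_zero _ (verticalLine_ne_zero hc ξ)
    · rw [Real.rpow_neg (norm_nonneg _)]
      simp
  have hinv := congrFun (hgc.fourierInv_fourier_eq hg hFi) x
  rw [Real.fourierInv_eq', hF] at hinv
  have h1 : ∀ ξ : ℝ, Complex.exp ((c + 2 * Real.pi * ξ * Complex.I) * x) /
      (c + 2 * Real.pi * ξ * Complex.I) ^ 2 = Complex.exp (c * x) *
      (Complex.exp (((2 * Real.pi * inner ℝ ξ x : ℝ) : ℂ) * Complex.I) •
        (1 / (c + 2 * Real.pi * ξ * Complex.I : ℂ) ^ 2)) := by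
    intro ξ
    rw [smul_eq_mul, ← mul_assoc, ← Complex.exp_add, mul_one_div]
    congr 2
    simp
    ring
  simp_rw [h1]
  rw [integral_const_mul, hinv]
  simp only [g]
  push_cast
  rw [mul_left_comm, ← Complex.exp_add]
  simp

end Kernel

/-! ### Truncation of Dirichlet series -/

section Truncation

open MeasureTheory

theorem integrable_exp_div_sq_verticalLine {c : ℝ} (hc : 0 < c) (x : ℝ) :
    Integrable fun ξ : ℝ => Complex.exp ((c + 2 * Real.pi * ξ * Complex.I) * x) /
      (c + 2 * Real.pi * ξ * Complex.I) ^ 2 := by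
  refine ((integrable_norm_rpow_neg_verticalLine hc one_lt_two).const_mul (Real.exp (c * x))).mono'
    ?_ (Eventually.of_forall fun ξ => ?_)
  · refine Continuous.aestronglyMeasurable ?_
    exact Continuous.div (by fun_prop) (by fun_prop) fun ξ =>
      pow_ne_zero _ (verticalLine_ne_zero hc ξ)
  · rw [Real.rpow_neg (norm_nonneg _), norm_div, Complex.norm_exp, div_eq_mul_inv]
    simp

/-- Interpolates between the bounds `2 ‖z‖`, good near `0`, and `2`, good far away. -/
theorem norm_one_sub_exp_neg_le {z : ℂ} (hz : 0 ≤ z.re) {θ : ℝ} (h0 : 0 ≤ θ) (h1 : θ ≤ 1) :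
    ‖1 - Complex.exp (-z)‖ ≤ 2 * ‖z‖ ^ θ := by
  rcases le_total ‖z‖ 1 with h | h
  · have h2 : ‖Complex.exp (-z) - 1‖ ≤ 2 * ‖-z‖ := Complex.norm_exp_sub_one_le (by simpa using h)
    rw [norm_sub_rev]
    rw [norm_neg] at h2
    refine h2.trans ?_
    gcongr
    calc ‖z‖ = ‖z‖ ^ (1 : ℝ) := (Real.rpow_one _).symm
      _ ≤ ‖z‖ ^ θ := by
        rcases (norm_nonneg z).eq_or_lt with hz0 | hz0
        · rw [← hz0, Real.zero_rpow one_ne_zero]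
          exact Real.rpow_nonneg le_rfl _
        · exact Real.rpow_le_rpow_of_exponent_ge hz0 h h1
  · have h2 : ‖1 - Complex.exp (-z)‖ ≤ 2 := by
      refine (norm_sub_le _ _).trans ?_
      have : ‖Complex.exp (-z)‖ ≤ 1 := by
        rw [Complex.norm_exp]
        simpa using hz
      rw [norm_one]; linarith
    have h3 : 1 ≤ ‖z‖ ^ θ := Real.one_le_rpow h h0
    linarith

theorem rpow_log_sub_log_mul_le {N : ℕ} (hN : 1 ≤ N) {c c' : ℝ} (h0 : 0 ≤ c') (h1 : c' ≤ 1)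
    (hc : c' ≤ c) :
    (Real.log (N + 1) - Real.log N) ^ (-c') * Real.exp (-c * Real.log N) ≤ 2 := by
  have hN1 : (1 : ℝ) ≤ N := by exact_mod_cast hN
  have hN0 : (0 : ℝ) < N := by linarith
  have hδ : 1 / ((N : ℝ) + 1) ≤ Real.log (N + 1) - Real.log N := by
    rw [← Real.log_div (by positivity) (by positivity)]
    refine le_trans (le_of_eq ?_) (Real.one_sub_inv_le_log_of_pos (by positivity))
    field_simp
    ring
  have hexp : Real.exp (-c * Real.log N) = (N : ℝ) ^ (-c) := by
    rw [Real.rpow_def_of_pos hN0, mul_comm]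
  calc (Real.log (N + 1) - Real.log N) ^ (-c') * Real.exp (-c * Real.log N)
      ≤ (1 / ((N : ℝ) + 1)) ^ (-c') * (N : ℝ) ^ (-c') := by
        rw [hexp]
        gcongr ?_ * ?_
        · exact Real.rpow_le_rpow_of_nonpos (by positivity) hδ (by linarith)
        · exact Real.rpow_le_rpow_of_exponent_le hN1 (by linarith)
    _ = (((N : ℝ) + 1) / N) ^ c' := by
        rw [← Real.mul_rpow (by positivity) (by positivity), Real.rpow_neg (by positivity),
          ← Real.inv_rpow (by positivity)]
        congr 1
        field_simp
    _ ≤ (2 : ℝ) ^ c' := by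
        gcongr
        rw [div_le_iff₀ hN0]; linarith
    _ ≤ 2 ^ (1 : ℝ) := Real.rpow_le_rpow_of_exponent_le one_le_two h1
    _ = 2 := Real.rpow_one 2

/-- A difference of two ramps with corners at `log N` and `log (N + 1)` is a step of height `δ` on
the frequencies `log n`. Its integral representation writes the tail as a weighted integral of the
full sum over a vertical line in the half-plane. Dividing by `δ` costs a power `N ^ c'`, which the
decay `N ^ (-σ)` of the kernel absorbs. The constant depends on `s` alone. -/
theorem exists_norm_dirichlet_tail_le {s : ℂ} (hs : 0 < s.re) : ∃ C : ℝ, 0 ≤ C ∧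
    ∀ {ι : Type} (S : Finset ι) (c : ι → ℂ) (n : ι → ℕ) (M : ℝ), (∀ α ∈ S, n α ≠ 0) →
      (∀ w : ℂ, 0 < w.re → ‖∑ α ∈ S, c α * (n α : ℂ) ^ (-w)‖ ≤ M) → ∀ N : ℕ, 1 ≤ N →
        ‖∑ α ∈ S with N < n α, c α * (n α : ℂ) ^ (-s)‖ ≤ C * M := by
  -- With `Re v = σ`, the shifted argument `s - v` also has real part `σ > 0`.
  set σ : ℝ := s.re / 2 with hσ
  have hσ0 : 0 < σ := by positivity
  set c' : ℝ := min σ (1 / 2) with hc'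
  have hc'0 : 0 < c' := by positivity
  have hc'1 : c' ≤ 1 := (min_le_right _ _).trans (by norm_num)
  have hc'σ : c' ≤ σ := min_le_left _ _
  let v : ℝ → ℂ := fun ξ => σ + 2 * Real.pi * ξ * Complex.I
  have hv0 : ∀ ξ, v ξ ≠ 0 := fun ξ => verticalLine_ne_zero hσ0 ξ
  have hvre : ∀ ξ, (v ξ).re = σ := fun ξ => by simp [v]
  set K : ℝ := ∫ ξ : ℝ, ‖v ξ‖ ^ (-(1 + c')) with hK
  have hKint : Integrable fun ξ : ℝ => ‖v ξ‖ ^ (-(1 + c')) :=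
    integrable_norm_rpow_neg_verticalLine hσ0 (by linarith)
  have hK0 : 0 ≤ K := integral_nonneg fun ξ => by positivity
  refine ⟨4 * K, by positivity, ?_⟩
  intro ι S c n M hn0 hM N hN
  have hM0 : 0 ≤ M := (norm_nonneg _).trans (hM 1 (by simp))
  have hN1 : (1 : ℝ) ≤ N := by exact_mod_cast hN
  set a : ℝ := Real.log N with ha
  set b : ℝ := Real.log (N + 1) with hb
  set δ : ℝ := b - a with hδ
  have hδ0 : 0 < δ := sub_pos.2 (Real.log_lt_log (by linarith) (by linarith))
  let u : ι → ℝ := fun α => Real.log (n α)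
  -- No integer lies strictly between `N` and `N + 1`, so the sloping part of the ramp difference is
  -- never met.
  have hlow : ∀ α ∈ S, max (u α - b) 0 - max (u α - a) 0 = if N < n α then -δ else 0 := by
    intro α hα
    have hnpos : (0 : ℝ) < n α := by exact_mod_cast Nat.pos_of_ne_zero (hn0 α hα)
    split_ifs with h
    · have h1 : b ≤ u α := Real.log_le_log (by positivity) (by exact_mod_cast h)
      rw [max_eq_left (by linarith), max_eq_left (by linarith)]
      ring
    · have h1 : u α ≤ a := Real.log_le_log hnpos (by exact_mod_cast not_lt.1 h)
      rw [max_eq_right (by linarith), max_eq_right (by linarith), sub_zero]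
  have hint : ∀ x : ℝ, Integrable fun ξ : ℝ => Complex.exp (v ξ * x) / v ξ ^ 2 :=
    fun x => integrable_exp_div_sq_verticalLine hσ0 x
  have hterm : ∀ α, ((max (u α - b) 0 - max (u α - a) 0 : ℝ) : ℂ) =
      ∫ ξ : ℝ, (Complex.exp (v ξ * (u α - b : ℝ)) / v ξ ^ 2 -
        Complex.exp (v ξ * (u α - a : ℝ)) / v ξ ^ 2) := by
    intro α
    rw [integral_sub (hint _) (hint _), integral_exp_div_sq_verticalLine hσ0,
      integral_exp_div_sq_verticalLine hσ0]
    push_cast; rfl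
  have hsum : (-δ : ℂ) * ∑ α ∈ S with N < n α, c α * (n α : ℂ) ^ (-s) =
      ∫ ξ : ℝ, (∑ α ∈ S, c α * (n α : ℂ) ^ (-(s - v ξ))) *
        ((Complex.exp (-(v ξ * b)) - Complex.exp (-(v ξ * a))) / v ξ ^ 2) := by
    have h1 : (-δ : ℂ) * ∑ α ∈ S with N < n α, c α * (n α : ℂ) ^ (-s) =
        ∑ α ∈ S, c α * (n α : ℂ) ^ (-s) * ((max (u α - b) 0 - max (u α - a) 0 : ℝ) : ℂ) := by
      rw [Finset.mul_sum, Finset.sum_filter]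
      refine Finset.sum_congr rfl fun α hα => ?_
      rw [hlow α hα]
      split_ifs
      · push_cast; ring
      · simp
    rw [h1]
    simp_rw [hterm, ← integral_const_mul]
    have hI : ∀ α ∈ S, Integrable fun ξ : ℝ => c α * (n α : ℂ) ^ (-s) *
        (Complex.exp (v ξ * (u α - b : ℝ)) / v ξ ^ 2 -
          Complex.exp (v ξ * (u α - a : ℝ)) / v ξ ^ 2) :=
      fun α _ => ((hint _).sub (hint _)).const_mul _
    rw [← integral_finsetSum _ hI]
    congr 1
    ext ξ
    rw [Finset.sum_mul]
    refine Finset.sum_congr rfl fun α hα => ?_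
    have hne : (n α : ℂ) ≠ 0 := by exact_mod_cast hn0 α hα
    have h2 : (n α : ℂ) ^ (-(s - v ξ)) = (n α : ℂ) ^ (-s) * Complex.exp (v ξ * u α) := by
      rw [show -(s - v ξ) = -s + v ξ by ring, Complex.cpow_add _ _ hne,
        Complex.cpow_def_of_ne_zero hne (v ξ), ← Complex.natCast_log, mul_comm (v ξ)]
    have h3 : ∀ y : ℝ, Complex.exp (v ξ * (u α - y : ℝ)) =
        Complex.exp (v ξ * u α) * Complex.exp (-(v ξ * y)) := fun y => by
      rw [← Complex.exp_add]
      congr 1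
      push_cast; ring
    rw [h2, h3, h3]
    ring
  -- The exponent `1 - c'` leaves `‖v‖ ^ (-(1 + c'))`, which is just integrable, and a factor `δ ^
  -- (1 - c')`.
  have hbound : ∀ ξ : ℝ, ‖(∑ α ∈ S, c α * (n α : ℂ) ^ (-(s - v ξ))) *
        ((Complex.exp (-(v ξ * b)) - Complex.exp (-(v ξ * a))) / v ξ ^ 2)‖ ≤
      M * (2 * Real.exp (-σ * a) * δ ^ (1 - c')) * ‖v ξ‖ ^ (-(1 + c')) := by
    intro ξ
    have h1 : ‖∑ α ∈ S, c α * (n α : ℂ) ^ (-(s - v ξ))‖ ≤ M :=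
      hM _ (by rw [Complex.sub_re, hvre]; linarith)
    have h2 : Complex.exp (-(v ξ * b)) - Complex.exp (-(v ξ * a)) =
        -(Complex.exp (-(v ξ * a)) * (1 - Complex.exp (-(v ξ * δ)))) := by
      rw [mul_sub, mul_one, ← Complex.exp_add, neg_sub]
      congr 3
      rw [hδ]; push_cast; ring
    have h3 : ‖Complex.exp (-(v ξ * a))‖ = Real.exp (-σ * a) := by
      rw [Complex.norm_exp]
      simp [hvre]
    have h4 := norm_one_sub_exp_neg_le (z := v ξ * δ) (θ := 1 - c')
      (by rw [Complex.re_mul_ofReal, hvre]; positivity) (by linarith) (by linarith)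
    rw [norm_mul, Complex.norm_real, Real.norm_of_nonneg hδ0.le,
      Real.mul_rpow (norm_nonneg _) hδ0.le] at h4
    have hvpos : 0 < ‖v ξ‖ := norm_pos_iff.2 (hv0 ξ)
    have h5 : ‖v ξ‖ ^ (1 - c') / ‖v ξ‖ ^ 2 = ‖v ξ‖ ^ (-(1 + c')) := by
      rw [← Real.rpow_natCast, ← Real.rpow_sub hvpos]
      congr 1
      push_cast; ring
    rw [norm_mul, norm_div, h2, norm_neg, norm_mul, h3, norm_pow]
    calc _ ≤ M * (Real.exp (-σ * a) * (2 * (‖v ξ‖ ^ (1 - c') * δ ^ (1 - c'))) / ‖v ξ‖ ^ 2) := by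
          gcongr
      _ = M * (2 * Real.exp (-σ * a) * δ ^ (1 - c')) * (‖v ξ‖ ^ (1 - c') / ‖v ξ‖ ^ 2) := by ring
      _ = _ := by rw [h5]
  have hfin : δ * ‖∑ α ∈ S with N < n α, c α * (n α : ℂ) ^ (-s)‖ ≤
      M * (2 * Real.exp (-σ * a) * δ ^ (1 - c')) * K := by
    have h1 := norm_integral_le_of_norm_le (hKint.const_mul
      (M * (2 * Real.exp (-σ * a) * δ ^ (1 - c')))) (Eventually.of_forall hbound)
    rw [← hsum, integral_const_mul, norm_mul, norm_neg, Complex.norm_real,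
      Real.norm_of_nonneg hδ0.le] at h1
    exact h1
  have h6 : δ ^ (-c') * Real.exp (-σ * a) ≤ 2 := rpow_log_sub_log_mul_le hN hc'0.le hc'1 hc'σ
  have h7 : δ ^ (1 - c') = δ * δ ^ (-c') := by
    rw [sub_eq_add_neg, Real.rpow_add hδ0, Real.rpow_one]
  rw [h7] at hfin
  have h8 : δ * ‖∑ α ∈ S with N < n α, c α * (n α : ℂ) ^ (-s)‖ ≤ δ * (4 * K * M) := by
    calc _ ≤ _ := hfin
      _ = δ * (2 * M * K * (δ ^ (-c') * Real.exp (-σ * a))) := by ring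
      _ ≤ δ * (2 * M * K * 2) := by gcongr
      _ = _ := by ring
  exact le_of_mul_le_mul_left h8 hδ0

end Truncation

/-! ### Bohr lifts are Dirichlet series -/

theorem bohrIndex_add (α β : ℕ →₀ ℕ) : bohrIndex (α + β) = bohrIndex α * bohrIndex β :=
  Finsupp.prod_add_index' (fun _ => pow_zero _) fun _ _ _ => pow_add _ _ _

theorem exists_bohrIndex_eq {n : ℕ} (hn : n ≠ 0) : ∃ α, bohrIndex α = n := by
  induction n using Nat.recOnMul with
  | zero => exact absurd rfl hn
  | one => exact ⟨0, Finsupp.prod_zero_index⟩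
  | prime p hp =>
    obtain ⟨i, hi⟩ := (Nat.range_nth_of_infinite Nat.infinite_setOfPred_prime).symm ▸
      (show p ∈ {p | Nat.Prime p} from hp)
    refine ⟨Finsupp.single i 1, ?_⟩
    exact (Finsupp.prod_single_index (h := fun i k => nthPrime i ^ k) (pow_zero _)).trans
      ((pow_one _).trans hi)
  | mul a b ha hb =>
    obtain ⟨α, hα⟩ := ha (left_ne_zero_of_mul hn)
    obtain ⟨β, hβ⟩ := hb (right_ne_zero_of_mul hn)
    exact ⟨α + β, by rw [bohrIndex_add, hα, hβ]⟩

/-- The multi-index of exponents of `n`. -/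
noncomputable def bohrExponent (n : ℕ) : ℕ →₀ ℕ := Function.invFun bohrIndex n

theorem bohrIndex_bohrExponent {n : ℕ} (hn : n ≠ 0) : bohrIndex (bohrExponent n) = n :=
  Function.invFun_eq (exists_bohrIndex_eq hn)

theorem bohrExponent_bohrIndex (α : ℕ →₀ ℕ) : bohrExponent (bohrIndex α) = α :=
  bohrIndex_injective (bohrIndex_bohrExponent (bohrIndex_ne_zero α))

theorem sum_Icc_coeff_bohrExponent (Q : MvPolynomial ℕ ℂ) (s : ℂ) (N : ℕ) :
    ∑ n ∈ Finset.Icc 1 N, MvPolynomial.coeff (bohrExponent n) Q / (n : ℂ) ^ s =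
      ∑ α ∈ Q.support with bohrIndex α ≤ N, MvPolynomial.coeff α Q * (bohrIndex α : ℂ) ^ (-s) := by
  symm
  refine Finset.sum_of_injOn bohrIndex bohrIndex_injective.injOn ?_ ?_ ?_
  · intro α hα
    have := (Finset.mem_filter.1 hα).2
    exact Finset.mem_coe.2 (Finset.mem_Icc.2 ⟨Nat.one_le_iff_ne_zero.2 (bohrIndex_ne_zero α), this⟩)
  · intro n hn hnot
    rw [Finset.mem_Icc] at hn
    have hn0 : n ≠ 0 := by omega
    have : bohrExponent n ∉ Q.support := fun h => hnot
      ⟨bohrExponent n, Finset.mem_coe.2 (Finset.mem_filter.2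
        ⟨h, by rw [bohrIndex_bohrExponent hn0]; exact hn.2⟩), bohrIndex_bohrExponent hn0⟩
    rw [MvPolynomial.notMem_support_iff.1 this, zero_div]
  · intro α _
    rw [bohrExponent_bohrIndex, Complex.cpow_neg, div_eq_mul_inv]

theorem exists_norm_pullback_sub_sum_le (s : rightHalfPlane) : ∃ C : ℝ, 0 ≤ C ∧
    ∀ (Q : MvPolynomial ℕ ℂ) (N : ℕ), 1 ≤ N →
      ‖pullback bohrPoint (MvPolynomial.aeval coord Q) s -
        ∑ n ∈ Finset.Icc 1 N, MvPolynomial.coeff (bohrExponent n) Q / (n : ℂ) ^ (s : ℂ)‖ ≤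
      C * ‖pullback bohrPoint (MvPolynomial.aeval coord Q)‖ := by
  obtain ⟨C, hC, H⟩ := exists_norm_dirichlet_tail_le s.2
  refine ⟨C, hC, fun Q N hN => ?_⟩
  have := H Q.support (fun α => MvPolynomial.coeff α Q) bohrIndex
    ‖pullback bohrPoint (MvPolynomial.aeval coord Q)‖ (fun α _ => bohrIndex_ne_zero α)
    (fun w hw => by
      have := pullback_bohrPoint_aeval Q ⟨w, hw⟩
      simp only at this
      rw [← this]
      exact BoundedContinuousFunction.norm_coe_le_norm _ _) N hN
  convert! this using 2
  rw [pullback_bohrPoint_aeval, sum_Icc_coeff_bohrExponent, sub_eq_iff_eq_add,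
    ← Finset.sum_filter_add_sum_filter_not Q.support (fun α => N < bohrIndex α)]
  simp only [not_lt]

theorem tendsto_sum_coeff_bohrExponent (Q : MvPolynomial ℕ ℂ) (s : rightHalfPlane) :
    Tendsto (fun N : ℕ => ∑ n ∈ Finset.Icc 1 N,
      MvPolynomial.coeff (bohrExponent n) Q / (n : ℂ) ^ (s : ℂ)) atTop
      (𝓝 (pullback bohrPoint (MvPolynomial.aeval coord Q) s)) := by
  refine tendsto_const_nhds.congr' ?_
  filter_upwards [eventually_ge_atTop (Q.support.sup bohrIndex)] with N hN
  rw [pullback_bohrPoint_aeval, sum_Icc_coeff_bohrExponent, Finset.filter_true_of_mem]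
  exact fun α hα => (Finset.le_sup hα).trans hN

theorem exists_seq_aeval_tendsto {g : C(ClosedPolydisc, ℂ)} (hg : g ∈ polydiscAlgebra) :
    ∃ Q : ℕ → MvPolynomial ℕ ℂ, Tendsto (fun k => MvPolynomial.aeval coord (Q k)) atTop (𝓝 g) := by
  have h1 : g ∈ closure (Algebra.adjoin ℂ (range coord) : Set C(ClosedPolydisc, ℂ)) :=
    polydiscAlgebra_le_coordClosure hg
  obtain ⟨x, hx, hlim⟩ := mem_closure_iff_seq_limit.1 h1
  rw [Algebra.adjoin_range_eq_range_aeval] at hx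
  choose Q hQ using hx
  refine ⟨Q, ?_⟩
  convert! hlim using 2 with k
  exact hQ k

/-- Coefficients of approximating polynomials converge because the norm bounds them. The partial-sum
estimate is uniform in `N`, which permits exchanging the limits in `k` and `N`. -/
theorem exists_dirichletSeries {g : C(ClosedPolydisc, ℂ)} (hg : g ∈ polydiscAlgebra) :
    ∃ a : ℕ → ℂ, ∀ s : rightHalfPlane,
      Tendsto (fun N : ℕ => ∑ n ∈ Finset.Icc 1 N, a n / (n : ℂ) ^ (s : ℂ)) atTop
        (𝓝 (g (bohrPoint s))) := by
  obtain ⟨Q, hQ⟩ := exists_seq_aeval_tendsto hg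
  have hf : Tendsto (fun k => pullback bohrPoint (MvPolynomial.aeval coord (Q k))) atTop
      (𝓝 (pullback bohrPoint g)) := ((continuous_pullback bohrPoint).tendsto g).comp hQ
  set f := fun k => pullback bohrPoint (MvPolynomial.aeval coord (Q k)) with hfdef
  have hsub : ∀ k l, pullback bohrPoint (MvPolynomial.aeval coord (Q k - Q l)) = f k - f l :=
    fun k l => by rw [map_sub, map_sub]
  have hcauchy : ∀ α, ∃ A : ℂ, Tendsto (fun k => MvPolynomial.coeff α (Q k)) atTop (𝓝 A) := by
    intro α
    refine cauchySeq_tendsto_of_complete (Metric.cauchySeq_iff.2 fun ε hε => ?_)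
    obtain ⟨K, hK⟩ := Metric.cauchySeq_iff.1 hf.cauchySeq ε hε
    refine ⟨K, fun k hk l hl => lt_of_le_of_lt ?_ (hK k hk l hl)⟩
    rw [dist_eq_norm, dist_eq_norm, ← hsub, ← MvPolynomial.coeff_sub]
    exact norm_coeff_le_norm_pullback _ _
  choose A hA using hcauchy
  refine ⟨fun n => A (bohrExponent n), fun s => ?_⟩
  obtain ⟨C, hC, H⟩ := exists_norm_pullback_sub_sum_le s
  have hfs : ∀ k, Tendsto (fun l => f k s - f l s) atTop (𝓝 (f k s - g (bohrPoint s))) := fun k =>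
    tendsto_const_nhds.sub (((continuous_eval_const (F := rightHalfPlane →ᵇ ℂ) s).tendsto (pullback bohrPoint g)).comp hf)
  have hS : ∀ k N, Tendsto (fun l => ∑ n ∈ Finset.Icc 1 N,
      MvPolynomial.coeff (bohrExponent n) (Q k - Q l) / (n : ℂ) ^ (s : ℂ)) atTop
      (𝓝 (∑ n ∈ Finset.Icc 1 N, (MvPolynomial.coeff (bohrExponent n) (Q k) - A (bohrExponent n)) /
        (n : ℂ) ^ (s : ℂ))) := fun k N => by
    refine tendsto_finsetSum _ fun n _ => Tendsto.div_const ?_ _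
    simp only [MvPolynomial.coeff_sub]
    exact tendsto_const_nhds.sub (hA _)
  have key : ∀ k N, 1 ≤ N → ‖(f k s - g (bohrPoint s)) -
      ∑ n ∈ Finset.Icc 1 N, (MvPolynomial.coeff (bohrExponent n) (Q k) - A (bohrExponent n)) /
        (n : ℂ) ^ (s : ℂ)‖ ≤ C * ‖f k - pullback bohrPoint g‖ := by
    intro k N hN
    refine le_of_tendsto_of_tendsto ((hfs k).sub (hS k N)).norm
      ((tendsto_const_nhds.sub hf).norm.const_mul C) (Eventually.of_forall fun l => ?_)
    have := H (Q k - Q l) N hN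
    rw [hsub] at this
    exact this
  rw [Metric.tendsto_atTop]
  intro ε hε
  have h1 : Tendsto (fun k => C * ‖f k - pullback bohrPoint g‖) atTop (𝓝 0) := by
    have := (tendsto_iff_norm_sub_tendsto_zero.1 hf).const_mul C
    rwa [mul_zero] at this
  obtain ⟨k, hk⟩ := (h1.eventually (gt_mem_nhds (half_pos hε))).exists
  obtain ⟨N₀, hN₀⟩ := Metric.tendsto_atTop.1 (tendsto_sum_coeff_bohrExponent (Q k) s) _ (half_pos hε)
  refine ⟨max N₀ 1, fun N hN => ?_⟩
  have h2 := key k N ((le_max_right _ _).trans hN)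
  have h3 := hN₀ N ((le_max_left _ _).trans hN)
  rw [dist_eq_norm] at h3 ⊢
  have h4 : ∑ n ∈ Finset.Icc 1 N, A (bohrExponent n) / (n : ℂ) ^ (s : ℂ) - g (bohrPoint s) =
      ((f k s - g (bohrPoint s)) - ∑ n ∈ Finset.Icc 1 N,
        (MvPolynomial.coeff (bohrExponent n) (Q k) - A (bohrExponent n)) / (n : ℂ) ^ (s : ℂ)) +
      (∑ n ∈ Finset.Icc 1 N, MvPolynomial.coeff (bohrExponent n) (Q k) / (n : ℂ) ^ (s : ℂ) -
        f k s) := by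
    simp only [sub_div, Finset.sum_sub_distrib]
    ring
  rw [h4]
  calc _ ≤ _ := norm_add_le _ _
    _ < ε / 2 + ε / 2 := add_lt_add (h2.trans_lt hk) h3
    _ = ε := add_halves ε

theorem uniformContinuous_natCast_cpow_neg {p : ℕ} (hp : p ≠ 0) :
    UniformContinuous fun s : rightHalfPlane => (p : ℂ) ^ (-(s : ℂ)) := by
  have hp' : (p : ℂ) ≠ 0 := by exact_mod_cast hp
  have hd : ∀ s ∈ rightHalfPlane, HasDerivWithinAt (fun s : ℂ => (p : ℂ) ^ (-s))
      ((p : ℂ) ^ (-s) * Complex.log p * -1) rightHalfPlane s := fun s _ =>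
    ((hasDerivAt_neg s).const_cpow (Or.inl hp')).hasDerivWithinAt
  have hconv : Convex ℝ rightHalfPlane := convex_halfSpace_re_gt 0
  have hlip : ∀ s t : rightHalfPlane, dist ((p : ℂ) ^ (-(s : ℂ))) ((p : ℂ) ^ (-(t : ℂ))) ≤
      ‖Complex.log p‖ * dist s t := by
    intro s t
    rw [dist_eq_norm, Subtype.dist_eq, dist_eq_norm]
    refine hconv.norm_image_sub_le_of_norm_hasDerivWithin_le hd (fun x hx => ?_) t.2 s.2
    rw [norm_mul, norm_mul, norm_neg, norm_one, mul_one]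
    exact mul_le_of_le_one_left (norm_nonneg _) (norm_natCast_cpow_neg_le_one hp (le_of_lt hx))
  exact (LipschitzWith.of_dist_le_mul (K := ‖Complex.log p‖₊) hlip).uniformContinuous

/-- The Lipschitz constants `log pᵢ` are unbounded, but the product uniformity asks only for each
coordinate separately. -/
theorem uniformContinuous_bohrPoint : UniformContinuous bohrPoint := by
  rw [uniformContinuous_pi]
  intro i
  exact (uniformContinuous_natCast_cpow_neg (prime_nthPrime i).ne_zero).subtype_mk _

theorem pullback_bohrPoint_mem {g : C(ClosedPolydisc, ℂ)} (hg : g ∈ polydiscAlgebra) :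
    (fun s => g (bohrPoint s)) ∈ dirichletFunctions :=
  ⟨(CompactSpace.uniformContinuous_of_continuous g.continuous).comp uniformContinuous_bohrPoint,
    exists_dirichletSeries hg⟩

/-! ### Uniformly continuous functions on convex sets -/

/-- The segment is cut into pieces shorter than `δ`. This controls growth on the half-plane, making
Gaussian means converge, and gives boundedness on the ball. -/
theorem UniformContinuous.exists_dist_le_add_mul_dist {E F : Type*} [NormedAddCommGroup E]
    [NormedSpace ℝ E] [PseudoMetricSpace F] {s : Set E} (hs : Convex ℝ s) {f : s → F}
    (hf : UniformContinuous f) {η : ℝ} (hη : 0 < η) :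
    ∃ B : ℝ, 0 ≤ B ∧ ∀ x y : s, dist (f x) (f y) ≤ η + B * dist x y := by
  obtain ⟨δ, hδ, H⟩ := Metric.uniformContinuous_iff.1 hf η hη
  refine ⟨η / δ, by positivity, fun x y => ?_⟩
  -- The `+ 1` makes each piece strictly shorter than `δ`.
  set k : ℕ := ⌊dist x y / δ⌋₊ + 1 with hk
  have hk0 : (0 : ℝ) < k := by positivity
  have hmem : ∀ j : ℕ, (x : E) + (min ((j : ℝ) / k) 1) • ((y : E) - x) ∈ s := fun j =>
    hs.add_smul_sub_mem x.2 y.2 ⟨by positivity, min_le_right _ _⟩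
  let p : ℕ → s := fun j => ⟨_, hmem j⟩
  have hp0 : p 0 = x := by ext; simp [p]
  have hpk : p k = y := by ext; simp [p]
  have hstep : ∀ j, j < k → dist (f (p j)) (f (p (j + 1))) ≤ η := by
    intro j hj
    refine (H ?_).le
    have h1 : ((j : ℝ) / k) ≤ 1 := by
      rw [div_le_one hk0]; exact_mod_cast hj.le
    have h2 : (((j + 1 : ℕ) : ℝ) / k) ≤ 1 := by
      rw [div_le_one hk0]; exact_mod_cast hj
    have h3 : (p j : E) - p (j + 1) = (-(1 / (k : ℝ))) • ((y : E) - x) := by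
      simp only [p, min_eq_left h1, min_eq_left h2, add_sub_add_left_eq_sub, ← sub_smul]
      congr 1
      push_cast
      field_simp
      ring
    rw [Subtype.dist_eq, dist_eq_norm, h3, norm_smul, norm_neg, Real.norm_of_nonneg (by positivity),
      ← dist_eq_norm, dist_comm, ← Subtype.dist_eq, one_div, inv_mul_lt_iff₀ hk0]
    have := Nat.lt_floor_add_one (dist x y / δ)
    rw [div_lt_iff₀ hδ] at this
    rw [hk]; push_cast; exact this
  have hsum := dist_le_range_sum_dist (fun j => f (p j)) k
  simp only [hp0, hpk] at hsum
  refine hsum.trans ((Finset.sum_le_sum fun j hj => hstep j (Finset.mem_range.1 hj)).trans ?_)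
  rw [Finset.sum_const, Finset.card_range, nsmul_eq_mul, hk]
  have := Nat.floor_le (show 0 ≤ dist x y / δ by positivity)
  push_cast
  calc _ ≤ (dist x y / δ + 1) * η := by gcongr
    _ = _ := by ring

theorem convex_rightHalfPlane : Convex ℝ rightHalfPlane := convex_halfSpace_re_gt 0

/-! ### Partial sums of Dirichlet series on vertical lines -/

theorem sum_Icc_mul_eq_abel (b φ : ℕ → ℂ) (N : ℕ) :
    ∑ n ∈ Finset.Icc 1 N, b n * φ n = (∑ n ∈ Finset.Icc 1 N, b n) * φ (N + 1) +
      ∑ n ∈ Finset.Icc 1 N, (∑ k ∈ Finset.Icc 1 n, b k) * (φ n - φ (n + 1)) := by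
  induction N with
  | zero => simp
  | succ N ih =>
    rw [Finset.sum_Icc_succ_top (by omega), ih, Finset.sum_Icc_succ_top (by omega : 1 ≤ N + 1)
      (fun n => (∑ k ∈ Finset.Icc 1 n, b k) * (φ n - φ (n + 1))),
      Finset.sum_Icc_succ_top (by omega) b]
    ring

theorem norm_cpow_neg_sub_cpow_neg_le {z : ℂ} (hz : 0 ≤ z.re) {n : ℕ} (hn : n ≠ 0) :
    ‖(n : ℂ) ^ (-z) - ((n + 1 : ℕ) : ℂ) ^ (-z)‖ ≤ ‖z‖ * (n : ℝ) ^ (-(1 + z.re)) := by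
  have hn0 : (0 : ℝ) < n := by exact_mod_cast Nat.pos_of_ne_zero hn
  by_cases hz0 : z = 0
  · simp [hz0]
  have hd : ∀ x ∈ Icc (n : ℝ) (n + 1), HasDerivWithinAt (fun x : ℝ => (x : ℂ) ^ (-z))
      (-z * (x : ℂ) ^ (-z - 1)) (Icc (n : ℝ) (n + 1)) x := by
    intro x hx
    have hx0 : x ≠ 0 := (hn0.trans_le hx.1).ne'
    have h1 : HasDerivAt (fun x : ℂ => x ^ (-z)) (-z * (x : ℂ) ^ (-z - 1)) (x : ℂ) := by
      have := (hasDerivAt_id (x : ℂ)).cpow_const (c := -z) (Or.inl (by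
        simpa using hn0.trans_le hx.1))
      simpa using this
    exact h1.comp_ofReal.hasDerivWithinAt
  have := (convex_Icc (n : ℝ) (n + 1)).norm_image_sub_le_of_norm_hasDerivWithin_le hd
    (C := ‖z‖ * (n : ℝ) ^ (-(1 + z.re))) (fun x hx => by
      have hx0 : 0 < x := hn0.trans_le hx.1
      rw [norm_mul, norm_neg, Complex.norm_cpow_eq_rpow_re_of_pos hx0]
      gcongr ?_ * ?_
      have : (-z - 1).re = -(1 + z.re) := by simp; ring
      rw [this]
      exact Real.rpow_le_rpow_of_nonpos hn0 hx.1 (by linarith))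
    (right_mem_Icc.2 (by linarith)) (left_mem_Icc.2 (by linarith))
  simpa using this

/-- Abel summation against the bounded partial sums at the real point `Re s / 2`. The increments of
`n ^ (-z)` bring the factor `‖z‖`, hence linear growth in `t`; this is the majorant for dominated
convergence when the series converges only conditionally. -/
theorem exists_norm_sum_div_cpow_le {a : ℕ → ℂ} (ha : ∀ s : ℂ, 0 < s.re → ∃ L : ℂ,
      Tendsto (fun N : ℕ => ∑ n ∈ Finset.Icc 1 N, a n / (n : ℂ) ^ s) atTop (𝓝 L))
    {s : ℂ} (hs : 0 < s.re) : ∃ C : ℝ, 0 ≤ C ∧ ∀ (N : ℕ) (t : ℝ),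
      ‖∑ n ∈ Finset.Icc 1 N, a n / (n : ℂ) ^ (s + t * Complex.I)‖ ≤ C * (1 + |t|) := by
  set σ : ℝ := s.re / 2 with hσ
  have hσ0 : 0 < σ := by positivity
  obtain ⟨L, hL⟩ := ha σ (by simpa using hσ0)
  obtain ⟨M, hM⟩ := hL.norm.bddAbove_range
  have hM' : ∀ N, ‖∑ n ∈ Finset.Icc 1 N, a n / (n : ℂ) ^ (σ : ℂ)‖ ≤ M := fun N =>
    hM (mem_range_self N)
  have hM0 : 0 ≤ M := (norm_nonneg _).trans (hM' 0)
  have hsummable : Summable fun n : ℕ => (n : ℝ) ^ (-(1 + σ)) :=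
    Real.summable_nat_rpow.2 (by linarith)
  set R : ℝ := ∑' n : ℕ, (n : ℝ) ^ (-(1 + σ)) with hR
  have hR0 : 0 ≤ R := tsum_nonneg fun n => by positivity
  set D : ℝ := ‖s - σ‖ + 1 with hD
  have hD0 : 0 ≤ D := by positivity
  refine ⟨M + M * D * R, by positivity, fun N t => ?_⟩
  set z : ℂ := s - σ + t * Complex.I with hz
  have hzre : z.re = σ := by simp [hz, hσ]; ring
  have hznorm : ‖z‖ ≤ D * (1 + |t|) := by
    have : ‖z‖ ≤ ‖s - σ‖ + |t| := by
      refine (norm_add_le _ _).trans ?_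
      simp
    have h1 : 0 ≤ ‖s - σ‖ * |t| := by positivity
    rw [hD]; nlinarith [norm_nonneg (s - σ)]
  have hterm : ∀ n ∈ Finset.Icc 1 N, a n / (n : ℂ) ^ (s + t * Complex.I) =
      a n / (n : ℂ) ^ (σ : ℂ) * (n : ℂ) ^ (-z) := by
    intro n hn
    have hn0 : (n : ℂ) ≠ 0 := by
      exact_mod_cast (Nat.one_le_iff_ne_zero.1 (Finset.mem_Icc.1 hn).1)
    rw [div_eq_mul_inv, div_eq_mul_inv, ← Complex.cpow_neg, ← Complex.cpow_neg, mul_assoc,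
      ← Complex.cpow_add _ _ hn0]
    congr 2
    rw [hz]; ring
  rw [Finset.sum_congr rfl hterm, sum_Icc_mul_eq_abel]
  have h1 : ‖((N + 1 : ℕ) : ℂ) ^ (-z)‖ ≤ 1 :=
    norm_natCast_cpow_neg_le_one (Nat.succ_ne_zero N) (by rw [hzre]; exact hσ0.le)
  have h2 : ‖∑ n ∈ Finset.Icc 1 N, (∑ k ∈ Finset.Icc 1 n, a k / (k : ℂ) ^ (σ : ℂ)) *
      ((n : ℂ) ^ (-z) - ((n + 1 : ℕ) : ℂ) ^ (-z))‖ ≤ M * ‖z‖ * R := by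
    calc _ ≤ ∑ n ∈ Finset.Icc 1 N, M * ‖z‖ * (n : ℝ) ^ (-(1 + σ)) := by
          refine norm_sum_le_of_le _ fun n hn => ?_
          rw [norm_mul, mul_assoc]
          gcongr
          · exact hM' n
          · rw [← hzre]
            exact norm_cpow_neg_sub_cpow_neg_le (by rw [hzre]; exact hσ0.le)
              (Nat.one_le_iff_ne_zero.1 (Finset.mem_Icc.1 hn).1)
      _ = M * ‖z‖ * ∑ n ∈ Finset.Icc 1 N, (n : ℝ) ^ (-(1 + σ)) := by rw [Finset.mul_sum]
      _ ≤ _ := by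
          gcongr
          exact hsummable.sum_le_tsum _ fun n _ => by positivity
  calc _ ≤ M * 1 + M * ‖z‖ * R := by
        refine (norm_add_le _ _).trans (add_le_add ?_ h2)
        rw [norm_mul]
        gcongr
        exact hM' N
    _ ≤ M * (1 + |t|) + M * (D * (1 + |t|)) * R := by
        gcongr
        linarith [abs_nonneg t]
    _ = _ := by ring

theorem exists_norm_coeff_le_mul {a : ℕ → ℂ} (ha : ∀ s : ℂ, 0 < s.re → ∃ L : ℂ,
      Tendsto (fun N : ℕ => ∑ n ∈ Finset.Icc 1 N, a n / (n : ℂ) ^ s) atTop (𝓝 L)) :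
    ∃ C : ℝ, ∀ n : ℕ, n ≠ 0 → ‖a n‖ ≤ C * n := by
  obtain ⟨C, -, hC⟩ := exists_norm_sum_div_cpow_le ha (s := 1) (by simp)
  refine ⟨2 * C, fun n hn => ?_⟩
  obtain ⟨m, rfl⟩ := Nat.exists_eq_succ_of_ne_zero hn
  have h1 := hC (m + 1) 0
  have h2 := hC m 0
  rw [Finset.sum_Icc_succ_top (by omega)] at h1
  simp only [Complex.ofReal_zero, zero_mul, add_zero, abs_zero, mul_one, Complex.cpow_one] at h1 h2
  have h3 : ‖a (m + 1) / ((m + 1 : ℕ) : ℂ)‖ ≤ 2 * C := by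
    have := norm_sub_le (∑ n ∈ Finset.Icc 1 m, a n / (n : ℂ) + a (m + 1) / ((m + 1 : ℕ) : ℂ))
      (∑ n ∈ Finset.Icc 1 m, a n / (n : ℂ))
    rw [add_sub_cancel_left] at this
    linarith
  rw [norm_div, Complex.norm_natCast, div_le_iff₀ (by positivity)] at h3
  exact h3

/-! ### Gaussian means -/

section Gaussian

open MeasureTheory

theorem integral_cexp_mul_gaussian (x : ℝ) :
    ∫ τ : ℝ, Complex.exp (Complex.I * x * τ) * (Real.exp (-Real.pi * τ ^ 2) : ℂ) =
      (Real.exp (-(x ^ 2) / (4 * Real.pi)) : ℂ) := by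
  have h := fourierIntegral_gaussian (b := Real.pi) (by simpa using Real.pi_pos) x
  have hpi : (Real.pi : ℂ) ≠ 0 := by exact_mod_cast Real.pi_ne_zero
  rw [div_self hpi, Complex.one_cpow, one_mul] at h
  push_cast
  rw [← h]

theorem integral_gaussian_pi : ∫ τ : ℝ, Real.exp (-Real.pi * τ ^ 2) = 1 := by
  rw [integral_gaussian, div_self Real.pi_ne_zero, Real.sqrt_one]

theorem integrable_gaussian_pi : Integrable fun τ : ℝ => Real.exp (-Real.pi * τ ^ 2) :=
  integrable_exp_neg_mul_sq Real.pi_pos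

theorem integrable_abs_mul_gaussian_pi :
    Integrable fun τ : ℝ => |τ| * Real.exp (-Real.pi * τ ^ 2) := by
  have := (integrable_mul_exp_neg_mul_sq Real.pi_pos).norm
  simpa [abs_of_pos (Real.exp_pos _)] using this

theorem summable_mul_exp_neg_log_sq {c : ℝ} (hc : 0 < c) :
    Summable fun n : ℕ => (n : ℝ) * Real.exp (-c * Real.log n ^ 2) := by
  -- The maximum of `3 x - c x ^ 2`, for `x = log n`, is `9 / (4 c)`.
  have hs : Summable fun n : ℕ => Real.exp (9 / (4 * c)) * (n : ℝ) ^ (-2 : ℝ) :=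
    (Real.summable_nat_rpow.2 (by norm_num)).mul_left _
  refine hs.of_nonneg_of_le (fun n => by positivity) fun n => ?_
  rcases Nat.eq_zero_or_pos n with rfl | hn
  · simp
  have hn0 : (0 : ℝ) < n := by exact_mod_cast hn
  rw [Real.rpow_def_of_pos hn0, ← Real.exp_add]
  nth_rewrite 1 [← Real.exp_log hn0]
  rw [← Real.exp_add]
  apply Real.exp_le_exp.2
  set x := Real.log n
  have : 9 / (4 * c) + x * -2 - (x + -c * x ^ 2) = (2 * c * x - 3) ^ 2 / (4 * c) := by
    field_simp
    ring
  have h2 : 0 ≤ (2 * c * x - 3) ^ 2 / (4 * c) := by positivity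
  linarith

/-- The displacement of a point of the half-plane along the vertical line through it. -/
def verticalShift (s : rightHalfPlane) (t : ℝ) : rightHalfPlane :=
  ⟨s + t * Complex.I, by
    have := s.2
    simpa [rightHalfPlane] using this⟩

theorem dist_verticalShift (s : rightHalfPlane) (t : ℝ) : dist (verticalShift s t) s = |t| := by
  rw [Subtype.dist_eq, dist_eq_norm]
  simp [verticalShift]

theorem continuous_verticalShift (s : rightHalfPlane) : Continuous (verticalShift s) := by
  unfold verticalShift
  fun_prop

variable {f : rightHalfPlane → ℂ} {a : ℕ → ℂ}

theorem integrable_comp_verticalShift_mul_gaussian (hf : UniformContinuous f) (s : rightHalfPlane)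
    (δ : ℝ) : Integrable fun τ : ℝ =>
      f (verticalShift s (δ * τ)) * (Real.exp (-Real.pi * τ ^ 2) : ℂ) := by
  obtain ⟨B, hB, H⟩ := hf.exists_dist_le_add_mul_dist convex_rightHalfPlane one_pos
  refine Integrable.mono' (g := fun τ : ℝ => (‖f s‖ + 1) * Real.exp (-Real.pi * τ ^ 2) +
    B * |δ| * (|τ| * Real.exp (-Real.pi * τ ^ 2)))
    ((integrable_gaussian_pi.const_mul _).add (integrable_abs_mul_gaussian_pi.const_mul _)) ?_
    (Eventually.of_forall fun τ => ?_)
  · refine Continuous.aestronglyMeasurable (Continuous.mul ?_ (by fun_prop))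
    exact hf.continuous.comp ((continuous_verticalShift s).comp (by fun_prop))
  · rw [norm_mul, Complex.norm_real, Real.norm_of_nonneg (Real.exp_pos _).le]
    have h1 := H (verticalShift s (δ * τ)) s
    rw [dist_verticalShift, abs_mul, dist_eq_norm] at h1
    have h2 := norm_sub_norm_le (f (verticalShift s (δ * τ))) (f s)
    have h3 : ‖f (verticalShift s (δ * τ))‖ ≤ ‖f s‖ + 1 + B * |δ| * |τ| := by linarith
    calc _ ≤ (‖f s‖ + 1 + B * |δ| * |τ|) * Real.exp (-Real.pi * τ ^ 2) := by gcongr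
      _ = _ := by ring

theorem exists_norm_gaussianMean_sub_le (hf : UniformContinuous f) {ε : ℝ} (hε : 0 < ε) :
    ∃ δ : ℝ, 0 < δ ∧ ∀ s : rightHalfPlane,
      ‖(∫ τ : ℝ, f (verticalShift s (δ * τ)) * (Real.exp (-Real.pi * τ ^ 2) : ℂ)) - f s‖ ≤ ε := by
  obtain ⟨B, hB, H⟩ := hf.exists_dist_le_add_mul_dist convex_rightHalfPlane (half_pos hε)
  set K : ℝ := ∫ τ : ℝ, |τ| * Real.exp (-Real.pi * τ ^ 2) with hK
  have hK0 : 0 ≤ K := integral_nonneg fun τ => by positivity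
  refine ⟨ε / (2 * (B * K + 1)), by positivity, fun s => ?_⟩
  set δ : ℝ := ε / (2 * (B * K + 1)) with hδ
  have hδ0 : 0 < δ := by positivity
  have h1 : f s = ∫ τ : ℝ, f s * (Real.exp (-Real.pi * τ ^ 2) : ℂ) := by
    rw [integral_const_mul, integral_complex_ofReal, integral_gaussian_pi]
    simp
  have hGc : Integrable fun τ : ℝ => (Real.exp (-Real.pi * τ ^ 2) : ℂ) :=
    integrable_gaussian_pi.ofReal
  conv_lhs => rw [h1]
  rw [← integral_sub (integrable_comp_verticalShift_mul_gaussian hf s δ)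
    (hGc.const_mul (f s))]
  have h2 : ∀ τ : ℝ, ‖f (verticalShift s (δ * τ)) * (Real.exp (-Real.pi * τ ^ 2) : ℂ) -
      f s * (Real.exp (-Real.pi * τ ^ 2) : ℂ)‖ ≤ ε / 2 * Real.exp (-Real.pi * τ ^ 2) +
        B * δ * (|τ| * Real.exp (-Real.pi * τ ^ 2)) := by
    intro τ
    rw [← sub_mul, norm_mul, Complex.norm_real, Real.norm_of_nonneg (Real.exp_pos _).le]
    have h3 := H (verticalShift s (δ * τ)) s
    rw [dist_verticalShift, abs_mul, dist_eq_norm, abs_of_pos hδ0] at h3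
    calc _ ≤ (ε / 2 + B * (δ * |τ|)) * Real.exp (-Real.pi * τ ^ 2) := by gcongr
      _ = _ := by ring
  refine (norm_integral_le_of_norm_le ((integrable_gaussian_pi.const_mul _).add
    (integrable_abs_mul_gaussian_pi.const_mul _)) (Eventually.of_forall h2)).trans ?_
  rw [integral_add' (integrable_gaussian_pi.const_mul _)
    (integrable_abs_mul_gaussian_pi.const_mul _), integral_const_mul, integral_const_mul,
    integral_gaussian_pi, ← hK]
  have h4 : B * δ * K ≤ ε / 2 := by
    have : B * δ * K = ε / 2 * (B * K / (B * K + 1)) := by rw [hδ]; field_simp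
    rw [this]
    refine mul_le_of_le_one_right (by positivity) ?_
    rw [div_le_one (by positivity)]; linarith
  linarith

/-- Averaging along vertical lines multiplies `aₙ` by the Fourier transform of the Gaussian at `-δ
log n`. -/
theorem tendsto_sum_gaussianMean
    (ha : ∀ s : rightHalfPlane,
      Tendsto (fun N : ℕ => ∑ n ∈ Finset.Icc 1 N, a n / (n : ℂ) ^ (s : ℂ)) atTop (𝓝 (f s)))
    (δ : ℝ) (s : rightHalfPlane) :
    Tendsto (fun N : ℕ => ∑ n ∈ Finset.Icc 1 N,
        a n * (Real.exp (-((δ * Real.log n) ^ 2) / (4 * Real.pi)) : ℂ) / (n : ℂ) ^ (s : ℂ)) atTop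
      (𝓝 (∫ τ : ℝ, f (verticalShift s (δ * τ)) * (Real.exp (-Real.pi * τ ^ 2) : ℂ))) := by
  have hint : ∀ n : ℕ, Integrable fun τ : ℝ =>
      Complex.exp (Complex.I * (-(δ * Real.log n) : ℝ) * τ) *
        (Real.exp (-Real.pi * τ ^ 2) : ℂ) := by
    intro n
    refine integrable_gaussian_pi.mono' (by fun_prop) (Eventually.of_forall fun τ => ?_)
    have h0 : Complex.I * (-(δ * Real.log n) : ℝ) * τ =
        ((-(δ * Real.log n) * τ : ℝ) : ℂ) * Complex.I := by push_cast; ring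
    rw [norm_mul, h0, Complex.norm_exp_ofReal_mul_I, Complex.norm_real,
      Real.norm_of_nonneg (Real.exp_pos _).le, one_mul]
  have h1 : ∀ N : ℕ, ∑ n ∈ Finset.Icc 1 N,
      a n * (Real.exp (-((δ * Real.log n) ^ 2) / (4 * Real.pi)) : ℂ) / (n : ℂ) ^ (s : ℂ) =
      ∫ τ : ℝ, (∑ n ∈ Finset.Icc 1 N, a n / (n : ℂ) ^ ((verticalShift s (δ * τ) : ℂ))) *
        (Real.exp (-Real.pi * τ ^ 2) : ℂ) := by
    intro N
    have h2 : ∀ n ∈ Finset.Icc 1 N,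
        a n * (Real.exp (-((δ * Real.log n) ^ 2) / (4 * Real.pi)) : ℂ) / (n : ℂ) ^ (s : ℂ) =
        ∫ τ : ℝ, a n / (n : ℂ) ^ (s : ℂ) *
          (Complex.exp (Complex.I * (-(δ * Real.log n) : ℝ) * τ) *
            (Real.exp (-Real.pi * τ ^ 2) : ℂ)) := by
      intro n _
      rw [integral_const_mul, integral_cexp_mul_gaussian, neg_sq]
      ring
    rw [Finset.sum_congr rfl h2, ← integral_finsetSum _ fun n _ => (hint n).const_mul _]
    congr 1
    ext τ
    rw [Finset.sum_mul]
    refine Finset.sum_congr rfl fun n hn => ?_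
    have hn0 : (n : ℂ) ≠ 0 := by
      exact_mod_cast (Nat.one_le_iff_ne_zero.1 (Finset.mem_Icc.1 hn).1)
    have h3 : ((verticalShift s (δ * τ) : ℂ)) = s + (δ * τ : ℝ) * Complex.I := rfl
    rw [h3, ← mul_assoc, div_eq_mul_inv, div_eq_mul_inv, ← Complex.cpow_neg, ← Complex.cpow_neg,
      neg_add, Complex.cpow_add _ _ hn0, Complex.cpow_def_of_ne_zero hn0 (-(_ * Complex.I)),
      ← Complex.natCast_log, mul_assoc (a n)]
    congr 4
    push_cast; ring
  simp_rw [h1]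
  obtain ⟨C, hC, H⟩ := exists_norm_sum_div_cpow_le (a := a) (fun s hs => ⟨_, ha ⟨s, hs⟩⟩) s.2
  refine tendsto_integral_of_dominated_convergence
    (fun τ : ℝ => C * Real.exp (-Real.pi * τ ^ 2) +
      C * |δ| * (|τ| * Real.exp (-Real.pi * τ ^ 2))) (fun N => ?_)
    ((integrable_gaussian_pi.const_mul _).add (integrable_abs_mul_gaussian_pi.const_mul _))
    (fun N => Eventually.of_forall fun τ => ?_) (Eventually.of_forall fun τ => ?_)
  · refine Continuous.aestronglyMeasurable (Continuous.mul ?_ (by fun_prop))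
    refine continuous_finsetSum _ fun n hn => ?_
    have hn0 : (n : ℂ) ≠ 0 := by
      exact_mod_cast (Nat.one_le_iff_ne_zero.1 (Finset.mem_Icc.1 hn).1)
    refine Continuous.div continuous_const (Continuous.const_cpow ?_ (Or.inl hn0)) fun τ => ?_
    · exact continuous_subtype_val.comp ((continuous_verticalShift s).comp (by fun_prop))
    · simp [Complex.cpow_eq_zero_iff, hn0]
  · rw [norm_mul, Complex.norm_real, Real.norm_of_nonneg (Real.exp_pos _).le]
    have h4 := H N (δ * τ)
    rw [abs_mul] at h4
    calc _ ≤ C * (1 + |δ| * |τ|) * Real.exp (-Real.pi * τ ^ 2) := by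
          gcongr
          exact h4
      _ = _ := by ring
  · exact (ha _).mul_const _

/-- The Gaussian factor in `log n` decays faster than any power of `n` and so beats `aₙ = O(n)`: the
smoothed series has a summable majorant on the whole half-plane and can be cut off. -/
theorem exists_dirichletPolynomial_close (hf : f ∈ dirichletFunctions) {ε : ℝ} (hε : 0 < ε) :
    ∃ (c : ℕ → ℂ) (N : ℕ), ∀ s : rightHalfPlane,
      ‖(∑ n ∈ Finset.Icc 1 N, c n / (n : ℂ) ^ (s : ℂ)) - f s‖ ≤ ε := by
  obtain ⟨huc, a, ha⟩ := hf
  obtain ⟨δ, hδ, H⟩ := exists_norm_gaussianMean_sub_le huc (half_pos hε)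
  obtain ⟨C, hC⟩ := exists_norm_coeff_le_mul (a := a) fun s hs => ⟨_, ha ⟨s, hs⟩⟩
  let c : ℕ → ℂ := fun n => a n * (Real.exp (-((δ * Real.log n) ^ 2) / (4 * Real.pi)) : ℂ)
  set b : ℕ → ℝ := fun n => C * ((n : ℝ) * Real.exp (-(δ ^ 2 / (4 * Real.pi)) * Real.log n ^ 2))
    with hb
  have hbs : Summable b := (summable_mul_exp_neg_log_sq (by positivity)).mul_left C
  have hcb : ∀ n ≠ 0, ∀ s : rightHalfPlane, ‖c n / (n : ℂ) ^ (s : ℂ)‖ ≤ b n := by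
    intro n hn s
    have h1 : ‖(n : ℂ) ^ (-(s : ℂ))‖ ≤ 1 := norm_natCast_cpow_neg_le_one hn (le_of_lt s.2)
    rw [div_eq_mul_inv, ← Complex.cpow_neg, norm_mul]
    refine (mul_le_of_le_one_right (norm_nonneg _) h1).trans ?_
    simp only [c, hb]
    rw [norm_mul, Complex.norm_real, Real.norm_of_nonneg (Real.exp_pos _).le, ← mul_assoc]
    have h2 : -((δ * Real.log n) ^ 2) / (4 * Real.pi) =
        -(δ ^ 2 / (4 * Real.pi)) * Real.log n ^ 2 := by ring
    rw [h2]
    gcongr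
    exact hC n hn
  have hb0 : ∀ n, 0 ≤ b n := fun n => by
    rcases eq_or_ne n 0 with rfl | hn
    · simp [hb]
    · exact (norm_nonneg _).trans (hcb n hn ⟨1, by simp [rightHalfPlane]⟩)
  have hlimb : Tendsto (fun N => ∑ n ∈ Finset.Icc 1 N, b n) atTop (𝓝 (∑' n, b n)) := by
    refine (hbs.hasSum.tendsto_sum_nat.comp (tendsto_add_atTop_nat 1)).congr fun N => ?_
    symm
    refine Finset.sum_subset (fun n hn => ?_) fun n hn hn' => ?_
    · simp only [Finset.mem_Icc, Finset.mem_range] at hn ⊢; omega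
    · have : n = 0 := by simp only [Finset.mem_Icc, Finset.mem_range] at hn hn'; omega
      simp [hb, this]
  obtain ⟨N, hN⟩ := (hlimb.eventually (lt_mem_nhds (sub_lt_self _ (half_pos hε)))).exists
  refine ⟨c, N, fun s => ?_⟩
  have htail : ∀ M, N ≤ M → ‖∑ n ∈ Finset.Icc 1 N, c n / (n : ℂ) ^ (s : ℂ) -
      ∑ n ∈ Finset.Icc 1 M, c n / (n : ℂ) ^ (s : ℂ)‖ ≤ ε / 2 := by
    intro M hM
    have hsub : Finset.Icc 1 N ⊆ Finset.Icc 1 M := Finset.Icc_subset_Icc_right hM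
    have h1 : ‖∑ n ∈ Finset.Icc 1 M \ Finset.Icc 1 N, c n / (n : ℂ) ^ (s : ℂ)‖ ≤
        ∑ n ∈ Finset.Icc 1 M \ Finset.Icc 1 N, b n := by
      refine norm_sum_le_of_le _ fun n hn => hcb n ?_ s
      have := (Finset.mem_Icc.1 (Finset.mem_sdiff.1 hn).1).1
      omega
    have h2 := Finset.sum_sdiff (f := b) hsub
    have h3 : ∑ n ∈ Finset.Icc 1 M, b n ≤ ∑' n, b n := hbs.sum_le_tsum _ fun n _ => hb0 n
    rw [← Finset.sum_sdiff hsub, sub_add_cancel_right, norm_neg]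
    linarith
  have hlim := tendsto_sum_gaussianMean ha δ s
  have h1 := le_of_tendsto (tendsto_const_nhds.sub hlim).norm
    ((eventually_ge_atTop N).mono fun M hM => htail M hM)
  calc _ ≤ _ := norm_sub_le_norm_sub_add_norm_sub _ _ _
    _ ≤ ε / 2 + ε / 2 := add_le_add h1 (H s)
    _ = ε := add_halves ε

end Gaussian

/-! ### Dirichlet series in `A(ℂ₊)` are Bohr lifts -/

theorem exists_polydiscAlgebra_eq_dirichletPolynomial (c : ℕ → ℂ) (N : ℕ) :
    ∃ g ∈ polydiscAlgebra, ∀ s : rightHalfPlane,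
      g (bohrPoint s) = ∑ n ∈ Finset.Icc 1 N, c n / (n : ℂ) ^ (s : ℂ) := by
  let Q : MvPolynomial ℕ ℂ := ∑ n ∈ Finset.Icc 1 N, MvPolynomial.monomial (bohrExponent n) (c n)
  have hQ : MvPolynomial.aeval coord Q ∈ polydiscAlgebra := by
    have : (MvPolynomial.aeval coord : MvPolynomial ℕ ℂ →ₐ[ℂ] C(ClosedPolydisc, ℂ)).range ≤
        polydiscAlgebra := by
      rw [← Algebra.adjoin_range_eq_range_aeval, Algebra.adjoin_le_iff]
      rintro _ ⟨i, rfl⟩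
      exact coord_mem_polydiscAlgebra i
    exact this ⟨Q, rfl⟩
  refine ⟨_, hQ, fun s => ?_⟩
  rw [map_sum, ContinuousMap.sum_apply]
  refine Finset.sum_congr rfl fun n hn => ?_
  have hn0 : n ≠ 0 := Nat.one_le_iff_ne_zero.1 (Finset.mem_Icc.1 hn).1
  conv_rhs => rw [← bohrIndex_bohrExponent hn0, div_eq_mul_inv, ← Complex.cpow_neg,
    bohrIndex_cpow, bohrIndex_bohrExponent hn0]
  rw [MvPolynomial.aeval_monomial, ContinuousMap.mul_apply, Finsupp.prod,
    ContinuousMap.prod_apply]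
  rfl

theorem exists_polydiscAlgebra_eq_of_mem_dirichletFunctions {f : rightHalfPlane → ℂ}
    (hf : f ∈ dirichletFunctions) :
    ∃ g ∈ polydiscAlgebra, ∀ s, f s = g (bohrPoint s) := by
  refine exists_polydiscAlgebra_eq_of_approx isometry_pullbackHom_bohrPoint hf.1.continuous
    fun ε hε => ?_
  obtain ⟨c, N, h⟩ := exists_dirichletPolynomial_close hf hε
  obtain ⟨g, hg, hgs⟩ := exists_polydiscAlgebra_eq_dirichletPolynomial c N
  exact ⟨g, hg, fun s => by rw [hgs]; exact h s⟩

/-! ### Holomorphic functions on normed spaces -/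

section Holomorphic

variable {E : Type*} [NormedAddCommGroup E] [NormedSpace ℂ E]

theorem add_smul_mem_ball {x u : E} {R : ℝ} (hR : 0 < R) (hu : ‖u‖ ≤ R) {w : ℂ}
    (hw : w ∈ ball (0 : ℂ) 1) : x + w • u ∈ ball x R := by
  rw [mem_ball_zero_iff] at hw
  rw [mem_ball_iff_norm, add_sub_cancel_left, norm_smul]
  nlinarith [norm_nonneg w, norm_nonneg u]

theorem differentiableOn_comp_line {F : E → ℂ} {x u : E} {R : ℝ} (hR : 0 < R) (hu : ‖u‖ ≤ R)
    (hF : DifferentiableOn ℂ F (ball x R)) :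
    DifferentiableOn ℂ (fun w : ℂ => F (x + w • u)) (ball 0 1) :=
  hF.comp (by fun_prop) fun _ hw => add_smul_mem_ball hR hu hw

theorem taylorCoeff_zero (f : ℂ → ℂ) : taylorCoeff f 0 = f 0 := by
  simp [taylorCoeff]

theorem taylorCoeff_one_comp_line {F : E → ℂ} {x : E} (hF : DifferentiableAt ℂ F x) (u : E) :
    taylorCoeff (fun w : ℂ => F (x + w • u)) 1 = fderiv ℂ F x u := by
  have h1 : HasDerivAt (fun w : ℂ => x + w • u) u 0 := by
    simpa using ((hasDerivAt_id (0 : ℂ)).smul_const u).const_add x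
  have h2 : HasFDerivAt F (fderiv ℂ F x) (x + (0 : ℂ) • u) := by
    simpa using hF.hasFDerivAt
  have h3 := h2.comp_hasDerivAt (0 : ℂ) h1
  rw [taylorCoeff, iteratedDeriv_one]
  simp only [Nat.factorial_one, Nat.cast_one, inv_one, one_mul]
  exact h3.deriv

theorem norm_fderiv_apply_le_of_bounded {F : E → ℂ} {x u : E} {R C : ℝ} (hR : 0 < R)
    (hu : ‖u‖ ≤ R) (hF : DifferentiableOn ℂ F (ball x R)) (hC : ∀ y ∈ ball x R, ‖F y‖ ≤ C) :
    ‖fderiv ℂ F x u‖ ≤ C := by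
  rw [← taylorCoeff_one_comp_line (hF.differentiableAt (ball_mem_nhds x hR))]
  exact norm_taylorCoeff_le (differentiableOn_comp_line hR hu hF)
    (fun w hw => hC _ (add_smul_mem_ball hR hu hw)) 1

theorem norm_fderiv_le_of_bounded {F : E → ℂ} {x : E} {R C : ℝ} (hR : 0 < R)
    (hF : DifferentiableOn ℂ F (ball x R)) (hC : ∀ y ∈ ball x R, ‖F y‖ ≤ C) :
    ‖fderiv ℂ F x‖ ≤ C / R := by
  have hC0 : 0 ≤ C := (norm_nonneg _).trans (hC x (mem_ball_self hR))
  refine ContinuousLinearMap.opNorm_le_bound _ (by positivity) fun h => ?_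
  rcases eq_or_ne h 0 with rfl | hh
  · simp
  have hh' : 0 < ‖h‖ := norm_pos_iff.2 hh
  have h1 := norm_fderiv_apply_le_of_bounded (u := ((R / ‖h‖ : ℝ) : ℂ) • h) hR (by
    rw [norm_smul, Complex.norm_real, Real.norm_of_nonneg (by positivity),
      div_mul_cancel₀ _ hh'.ne']) hF hC
  rw [map_smul, norm_smul, Complex.norm_real, Real.norm_of_nonneg (by positivity)] at h1
  rw [div_mul_eq_mul_div, le_div_iff₀ hR]
  rw [div_mul_eq_mul_div, div_le_iff₀ hh'] at h1
  linarith

theorem norm_sub_sub_fderiv_le_of_bounded {F : E → ℂ} {x u : E} {R C : ℝ} (hR : 0 < R)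
    (hu : ‖u‖ ≤ R) (hF : DifferentiableOn ℂ F (ball x R)) (hC : ∀ y ∈ ball x R, ‖F y‖ ≤ C)
    {w : ℂ} (hw : ‖w‖ ≤ 1 / 2) :
    ‖F (x + w • u) - F x - w * fderiv ℂ F x u‖ ≤ 2 * C * ‖w‖ ^ 2 := by
  have hC0 : 0 ≤ C := (norm_nonneg _).trans (hC x (mem_ball_self hR))
  set φ : ℂ → ℂ := fun w => F (x + w • u) with hφ
  have hφd := differentiableOn_comp_line hR hu hF
  have hφC : ∀ w ∈ ball (0 : ℂ) 1, ‖φ w‖ ≤ C := fun w hw => hC _ (add_smul_mem_ball hR hu hw)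
  have h1 := hasSum_taylorCoeff hφd (w := w) (by rw [mem_ball_zero_iff]; linarith)
  have hc1 : taylorCoeff φ 1 = fderiv ℂ F x u :=
    taylorCoeff_one_comp_line (hF.differentiableAt (ball_mem_nhds x hR)) u
  have hc0 : taylorCoeff φ 0 = F x := by rw [taylorCoeff_zero]; simp [hφ]
  have h2 : HasSum (fun n => if n < 2 then 0 else taylorCoeff φ n * w ^ n)
      (F (x + w • u) - F x - w * fderiv ℂ F x u) := by
    have h3 : HasSum (fun n => if n < 2 then taylorCoeff φ n * w ^ n else 0)
        (F x + w * fderiv ℂ F x u) := by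
      have : F x + w * fderiv ℂ F x u =
          ∑ n ∈ Finset.range 2, (if n < 2 then taylorCoeff φ n * w ^ n else 0) := by
        rw [Finset.sum_range_succ, Finset.sum_range_one]
        simp [hc0, hc1, mul_comm]
      rw [this]
      exact hasSum_sum_of_ne_finset_zero fun n hn => by
        rw [if_neg (by simpa using hn)]
    have h4 := h1.sub h3
    have h5 : (fun n => if n < 2 then 0 else taylorCoeff φ n * w ^ n) = fun n =>
        taylorCoeff φ n * w ^ n - if n < 2 then taylorCoeff φ n * w ^ n else 0 := by
      funext n
      split_ifs <;> simp
    rw [h5, sub_sub]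
    exact h4
  have h5 := norm_le_of_hasSum_of_geometric_tail (K := C) (r := ‖w‖) (M := 2) (norm_nonneg _)
    (by linarith) h2 (fun j hj => if_pos hj) fun j => by
      split_ifs
      · rw [norm_zero]; positivity
      · rw [norm_mul, norm_pow]
        gcongr
        exact norm_taylorCoeff_le hφd hφC j
  refine h5.trans ?_
  rw [div_le_iff₀ (by linarith)]
  have : 0 ≤ C * ‖w‖ ^ 2 := by positivity
  nlinarith

/-- The common bound gives a second-order Taylor remainder uniform in `n`. Hence convergence of
values forces convergence of the derivatives in each direction, and the limit functional inherits
both the bound `C / R` and the remainder estimate. -/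
theorem differentiableAt_of_tendsto_of_bounded {F : ℕ → E → ℂ} {G : E → ℂ} {x : E} {R C : ℝ}
    (hR : 0 < R) (hF : ∀ n, DifferentiableOn ℂ (F n) (ball x R))
    (hC : ∀ n, ∀ y ∈ ball x R, ‖F n y‖ ≤ C)
    (hlim : ∀ y ∈ ball x R, Tendsto (fun n => F n y) atTop (𝓝 (G y))) :
    DifferentiableAt ℂ G x := by
  have hC0 : 0 ≤ C := (norm_nonneg _).trans (hC 0 x (mem_ball_self hR))
  have hx := hlim x (mem_ball_self hR)
  have hsmall : ∀ u : E, ‖u‖ ≤ R → CauchySeq fun n => fderiv ℂ (F n) x u := by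
    intro u hu
    rw [Metric.cauchySeq_iff']
    intro ε hε
    -- After division by `t` the two remainders total `4 C t ≤ ε / 3`.
    set t : ℝ := min (1 / 2) (ε / (12 * (C + 1))) with ht
    have ht0 : 0 < t := by positivity
    have htn : ‖(t : ℂ)‖ = t := by rw [Complex.norm_real, Real.norm_of_nonneg ht0.le]
    have ht1 : ‖(t : ℂ)‖ ≤ 1 / 2 := htn.trans_le (min_le_left _ _)
    have htw : (t : ℂ) ∈ ball (0 : ℂ) 1 := by rw [mem_ball_zero_iff]; linarith
    have hcau := ((hlim _ (add_smul_mem_ball hR hu htw)).sub hx).cauchySeq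
    obtain ⟨N, hN⟩ := Metric.cauchySeq_iff'.1 hcau (t * (ε / 3)) (by positivity)
    refine ⟨N, fun n hn => ?_⟩
    have h1 := norm_sub_sub_fderiv_le_of_bounded hR hu (hF n) (hC n) ht1
    have h2 := norm_sub_sub_fderiv_le_of_bounded hR hu (hF N) (hC N) ht1
    have h3 := hN n hn
    rw [dist_eq_norm] at h3 ⊢
    rw [htn] at h1 h2
    have h4 : (t : ℂ) * (fderiv ℂ (F n) x u - fderiv ℂ (F N) x u) =
        (F n (x + (t : ℂ) • u) - F n x - (F N (x + (t : ℂ) • u) - F N x)) -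
        (F n (x + (t : ℂ) • u) - F n x - t * fderiv ℂ (F n) x u) +
        (F N (x + (t : ℂ) • u) - F N x - t * fderiv ℂ (F N) x u) := by ring
    have h5 : t * ‖fderiv ℂ (F n) x u - fderiv ℂ (F N) x u‖ <
        t * (ε / 3) + 2 * C * t ^ 2 + 2 * C * t ^ 2 := by
      rw [← htn, ← norm_mul, h4, htn]
      refine lt_of_le_of_lt (norm_add_le _ _) (add_lt_add_of_lt_of_le ?_ h2)
      exact lt_of_le_of_lt (norm_sub_le _ _) (add_lt_add_of_lt_of_le h3 h1)
    have h6 : t * (C + 1) ≤ ε / 12 := by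
      have : t ≤ ε / (12 * (C + 1)) := min_le_right _ _
      rw [le_div_iff₀ (by positivity)] at this
      linarith
    have h7 : t * ‖fderiv ℂ (F n) x u - fderiv ℂ (F N) x u‖ < t * ε := by
      have : 4 * (C * t) ≤ ε / 3 := by nlinarith
      nlinarith
    exact lt_of_mul_lt_mul_left h7 ht0.le
  have hcauchy : ∀ h : E, ∃ L : ℂ, Tendsto (fun n => fderiv ℂ (F n) x h) atTop (𝓝 L) := by
    intro h
    set k : ℝ := (‖h‖ + 1) / R with hk
    have hk0 : 0 < k := by positivity
    have hkc : (k : ℂ) ≠ 0 := by exact_mod_cast hk0.ne'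
    have hu : ‖(k : ℂ)⁻¹ • h‖ ≤ R := by
      rw [norm_smul, norm_inv, Complex.norm_real, Real.norm_of_nonneg hk0.le,
        inv_mul_le_iff₀ hk0, hk, div_mul_cancel₀ _ hR.ne']
      linarith
    obtain ⟨L, hL⟩ := cauchySeq_tendsto_of_complete (hsmall _ hu)
    refine ⟨k * L, (hL.const_mul (k : ℂ)).congr fun n => ?_⟩
    rw [map_smul, smul_eq_mul, mul_inv_cancel_left₀ hkc]
  choose L hL using hcauchy
  let L₁ : E →ₗ[ℂ] ℂ := linearMapOfTendsto L (fun n => (fderiv ℂ (F n) x : E →ₗ[ℂ] ℂ))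
    (l := atTop) (tendsto_pi_nhds.2 hL)
  let L₂ : E →L[ℂ] ℂ := L₁.mkContinuous (C / R) fun h =>
    le_of_tendsto (hL h).norm (Eventually.of_forall fun n =>
      (fderiv ℂ (F n) x).le_of_opNorm_le (norm_fderiv_le_of_bounded hR (hF n) (hC n)) h)
  have hL₂ : ∀ h, L₂ h = L h := fun h => rfl
  refine HasFDerivAt.differentiableAt (f' := L₂) ?_
  rw [hasFDerivAt_iff_isLittleO_nhds_zero]
  have hO : (fun h : E => G (x + h) - G x - L₂ h) =O[𝓝 0] fun h : E => ‖h‖ ^ 2 := by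
    refine Asymptotics.IsBigO.of_bound (2 * C / R ^ 2) ?_
    filter_upwards [ball_mem_nhds (0 : E) (half_pos hR)] with h hh
    rw [mem_ball_zero_iff] at hh
    rcases eq_or_ne h 0 with rfl | hne
    · simp
    have hh0 : 0 < ‖h‖ := norm_pos_iff.2 hne
    set k : ℝ := ‖h‖ / R with hk
    have hk0 : 0 < k := by positivity
    have hkc : (k : ℂ) ≠ 0 := by exact_mod_cast hk0.ne'
    have hkn : ‖(k : ℂ)‖ = k := by rw [Complex.norm_real, Real.norm_of_nonneg hk0.le]
    have hu : ‖(k : ℂ)⁻¹ • h‖ ≤ R := by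
      rw [norm_smul, norm_inv, hkn, inv_mul_le_iff₀ hk0, hk, div_mul_cancel₀ _ hR.ne']
    have hkw : ‖(k : ℂ)‖ ≤ 1 / 2 := by
      rw [hkn, hk, div_le_iff₀ hR]; linarith
    have hxh : x + h ∈ ball x R := by
      rw [mem_ball_iff_norm, add_sub_cancel_left]; linarith
    have hb : ∀ n, ‖F n (x + h) - F n x - fderiv ℂ (F n) x h‖ ≤ 2 * C * k ^ 2 := fun n => by
      have := norm_sub_sub_fderiv_le_of_bounded hR hu (hF n) (hC n) hkw
      rwa [smul_inv_smul₀ hkc, map_smul, smul_eq_mul, mul_inv_cancel_left₀ hkc, hkn] at this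
    have := le_of_tendsto (((hlim _ hxh).sub hx).sub (hL h)).norm (Eventually.of_forall hb)
    rw [hL₂]
    refine this.trans (le_of_eq ?_)
    rw [norm_pow, norm_norm, hk, div_pow]
    ring
  refine hO.trans_isLittleO ?_
  have := (Asymptotics.isLittleO_norm_pow_id (E' := E) one_lt_two)
  exact this

theorem exists_norm_fderiv_le {F : E → ℂ} (hF : Differentiable ℂ F) (x : E) :
    ∃ R > 0, ∃ C : ℝ, 0 ≤ C ∧ ∀ y ∈ ball x R, ‖fderiv ℂ F y‖ ≤ C := by
  obtain ⟨R, hR, h⟩ := Metric.continuousAt_iff.1 hF.continuous.continuousAt 1 one_pos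
  refine ⟨R / 2, by positivity, (‖F x‖ + 1) / (R / 2), by positivity, fun y hy => ?_⟩
  refine norm_fderiv_le_of_bounded (half_pos hR) hF.differentiableOn fun z hz => ?_
  have h1 := h (x := z) (by
    rw [mem_ball] at *
    linarith [dist_triangle z y x])
  rw [dist_eq_norm] at h1
  linarith [norm_sub_norm_le (F z) (F x)]

theorem differentiable_fderiv_apply {F : E → ℂ} (hF : Differentiable ℂ F) (v : E) :
    Differentiable ℂ fun x => fderiv ℂ F x v := by
  intro x
  obtain ⟨R, hR, C, hC, hfd⟩ := exists_norm_fderiv_le hF x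
  obtain ⟨n₀, hn₀⟩ := exists_nat_gt (2 * ‖v‖ / R)
  have hn₀0 : (0 : ℝ) < n₀ := lt_of_le_of_lt (by positivity) hn₀
  -- The offset `n₀` keeps every increment `v / c n` shorter than `R / 2`, so the difference
  -- quotients stay where the derivative is bounded.
  let c : ℕ → ℂ := fun n => ((n + n₀ : ℕ) : ℂ)
  have hcn : ∀ n, ‖c n‖ = ((n + n₀ : ℕ) : ℝ) := fun n => Complex.norm_natCast _
  have hcge : ∀ n, (n₀ : ℝ) ≤ ‖c n‖ := fun n => by rw [hcn]; push_cast; linarith [n.cast_nonneg (α := ℝ)]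
  refine differentiableAt_of_tendsto_of_bounded (F := fun n y => c n • (F (y + (c n)⁻¹ • v) - F y))
    (R := R / 2) (C := C * ‖v‖) (half_pos hR) (fun n => ?_) (fun n y hy => ?_) fun y _ => ?_
  · refine Differentiable.differentiableOn ?_
    have h1 : Differentiable ℂ fun y : E => F (y + (c n)⁻¹ • v) := hF.comp (by fun_prop)
    exact (h1.sub hF).const_smul (c n)
  · have hpos : 0 < ‖c n‖ := hn₀0.trans_le (hcge n)
    have h1 : ‖(c n)⁻¹ • v‖ < R / 2 := by
      rw [norm_smul, norm_inv, inv_mul_lt_iff₀ hpos]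
      rw [div_lt_iff₀ hR] at hn₀
      nlinarith [hcge n]
    have h2 : y + (c n)⁻¹ • v ∈ ball x R := by
      rw [mem_ball_iff_norm] at *
      have : y + (c n)⁻¹ • v - x = (y - x) + (c n)⁻¹ • v := by abel
      rw [this]
      linarith [norm_add_le (y - x) ((c n)⁻¹ • v)]
    have h3 : y ∈ ball x R := ball_subset_ball (by linarith) hy
    have h4 := (convex_ball x R).norm_image_sub_le_of_norm_fderiv_le (𝕜 := ℂ)
      (fun z _ => hF z) hfd h3 h2
    rw [add_sub_cancel_left, norm_smul, norm_inv] at h4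
    rw [norm_smul]
    calc _ ≤ ‖c n‖ * (C * (‖c n‖⁻¹ * ‖v‖)) := by gcongr
      _ = _ := by field_simp
  · refine (hF y).hasFDerivAt.lim v ?_
    simp_rw [hcn]
    exact tendsto_natCast_atTop_atTop.comp (tendsto_add_atTop_nat n₀)

end Holomorphic

/-! ### Coordinates on `c₀` -/

theorem norm_apply_le_norm_c0 (x : C₀(ℕ, ℂ)) (i : ℕ) : ‖x i‖ ≤ ‖x‖ := by
  rw [← ZeroAtInftyContinuousMap.norm_toBCF_eq_norm]
  exact x.toBCF.norm_coe_le_norm i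

theorem norm_le_of_forall_c0 {x : C₀(ℕ, ℂ)} {r : ℝ} (hr : 0 ≤ r) (h : ∀ i, ‖x i‖ ≤ r) :
    ‖x‖ ≤ r := by
  rw [← ZeroAtInftyContinuousMap.norm_toBCF_eq_norm]
  exact (BoundedContinuousFunction.norm_le hr).2 h

/-- The `i`-th coordinate functional on `c₀`. -/
noncomputable def evalC0 (i : ℕ) : C₀(ℕ, ℂ) →L[ℂ] ℂ :=
  LinearMap.mkContinuous ⟨⟨fun x => x i, fun _ _ => rfl⟩, fun _ _ => rfl⟩ 1 fun x => by
    rw [one_mul]; exact norm_apply_le_norm_c0 x i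

@[simp] theorem evalC0_apply (i : ℕ) (x : C₀(ℕ, ℂ)) : evalC0 i x = x i := rfl

/-- The `i`-th unit vector of `c₀`. -/
noncomputable def unitVector (i : ℕ) : C₀(ℕ, ℂ) where
  toFun j := if j = i then 1 else 0
  continuous_toFun := continuous_of_discreteTopology
  zero_at_infty' := by
    rw [cocompact_eq_cofinite]
    refine tendsto_const_nhds.congr' ?_
    filter_upwards [(finite_singleton i).compl_mem_cofinite] with j hj
    rw [if_neg (by simpa using hj)]

theorem unitVector_apply (i j : ℕ) : unitVector i j = if j = i then 1 else 0 := rfl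

theorem sum_smul_unitVector_apply (s : Finset ℕ) (z : ℕ → ℂ) (j : ℕ) :
    (∑ i ∈ s, z i • unitVector i) j = if j ∈ s then z j else 0 := by
  rw [← evalC0_apply, map_sum]
  simp [unitVector_apply]

theorem norm_sum_smul_unitVector_le (s : Finset ℕ) {z : ℕ → ℂ} {r : ℝ} (hr : 0 ≤ r)
    (h : ∀ i ∈ s, ‖z i‖ ≤ r) : ‖∑ i ∈ s, z i • unitVector i‖ ≤ r := by
  refine norm_le_of_forall_c0 hr fun j => ?_
  rw [sum_smul_unitVector_apply]
  split_ifs with hj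
  · exact h j hj
  · simpa using hr

theorem tendsto_sum_smul_unitVector (x : C₀(ℕ, ℂ)) :
    Tendsto (fun N => ∑ i ∈ Finset.range N, x i • unitVector i) atTop (𝓝 x) := by
  rw [Metric.tendsto_atTop]
  intro ε hε
  have h0 : Tendsto x atTop (𝓝 0) := by
    have := x.zero_at_infty'
    rwa [cocompact_eq_cofinite, Nat.cofinite_eq_atTop] at this
  obtain ⟨N, hN⟩ := Metric.tendsto_atTop.1 h0 (ε / 2) (half_pos hε)
  refine ⟨N, fun M hM => ?_⟩
  rw [dist_eq_norm]
  refine lt_of_le_of_lt (norm_le_of_forall_c0 (half_pos hε).le fun j => ?_) (half_lt_self hε)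
  rw [ZeroAtInftyContinuousMap.sub_apply, sum_smul_unitVector_apply]
  split_ifs with hj
  · simpa using (half_pos hε).le
  · rw [Finset.mem_range, not_lt] at hj
    have := hN j (hM.trans hj)
    rw [dist_zero_right] at this
    simpa using this.le

/-! ### Restriction of the polydisc algebra to the unit ball of `c₀` -/

theorem norm_lt_one_of_mem_unitBallC0 {x : C₀(ℕ, ℂ)} (hx : x ∈ unitBallC0) : ‖x‖ < 1 :=
  mem_ball_zero_iff.1 hx

/-- The inclusion of the unit ball of `c₀` in the closed polydisc. -/
noncomputable def ballPoint : C(unitBallC0, ClosedPolydisc) where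
  toFun x i := ⟨(x : C₀(ℕ, ℂ)) i, by
    rw [mem_closedBall_zero_iff]
    exact (norm_apply_le_norm_c0 _ i).trans (norm_lt_one_of_mem_unitBallC0 x.2).le⟩
  continuous_toFun := continuous_pi fun i =>
    ((evalC0 i).continuous.comp continuous_subtype_val).subtype_mk _

@[simp] theorem ballPoint_apply (x : unitBallC0) (i : ℕ) :
    (ballPoint x i : ℂ) = (x : C₀(ℕ, ℂ)) i := rfl

theorem uniformContinuous_ballPoint : UniformContinuous ballPoint := by
  rw [uniformContinuous_pi]
  exact fun i => ((evalC0 i).uniformContinuous.comp uniformContinuous_subtype_val).subtype_mk _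

/-- A point of the open polydisc need not tend to zero and may have supremum 1; truncation cures
both. -/
theorem truncate_mem_range_ballPoint {z : ClosedPolydisc}
    (hz : ∀ j, (z j : ℂ) ∈ ball (0 : ℂ) 1) (N : ℕ) : ∃ x, ballPoint x = truncate N z := by
  obtain ⟨r, hr0, hr1, hr⟩ : ∃ r : ℝ, 0 ≤ r ∧ r < 1 ∧ ∀ i ∈ Finset.range N, ‖(z i : ℂ)‖ ≤ r := by
    refine ⟨((Finset.range N).sup fun i => ‖(z i : ℂ)‖₊ : NNReal), NNReal.coe_nonneg _, ?_, ?_⟩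
    · refine NNReal.coe_lt_one.2 ((Finset.sup_lt_iff (by simp)).2 fun i _ => ?_)
      have := mem_ball_zero_iff.1 (hz i)
      exact_mod_cast this
    · intro i hi
      exact_mod_cast Finset.le_sup (f := fun i => ‖(z i : ℂ)‖₊) hi
  have hmem : ∑ i ∈ Finset.range N, (z i : ℂ) • unitVector i ∈ unitBallC0 :=
    mem_ball_zero_iff.2 ((norm_sum_smul_unitVector_le _ hr0 hr).trans_lt hr1)
  refine ⟨⟨_, hmem⟩, ?_⟩
  ext i
  rw [ballPoint_apply]
  simp only [sum_smul_unitVector_apply, truncate_apply, Finset.mem_range]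
  split_ifs <;> rfl

theorem isometry_pullbackHom_ballPoint : Isometry (pullbackHom ballPoint) := by
  refine isometry_pullbackHom fun g _ => norm_le_of_forall_openPolydisc (norm_nonneg _) fun z hz => ?_
  have h1 : Tendsto (fun N => g (truncate N z)) atTop (𝓝 (g z)) :=
    ((continuous_eval_const (F := C(ClosedPolydisc, ℂ)) z).tendsto g).comp (tendsto_comp_truncate g)
  refine le_of_tendsto h1.norm (Eventually.of_forall fun N => ?_)
  obtain ⟨x, hx⟩ := truncate_mem_range_ballPoint hz N
  rw [← hx]
  exact (pullback ballPoint g).norm_coe_le_norm x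

theorem differentiable_eval_c0 (Q : MvPolynomial ℕ ℂ) :
    Differentiable ℂ fun x : C₀(ℕ, ℂ) => MvPolynomial.eval (fun i => x i) Q := by
  induction Q using MvPolynomial.induction_on with
  | C a => simp
  | add p q hp hq =>
    simp only [map_add]
    exact hp.fun_add hq
  | mul_X p i hp =>
    simp only [map_mul, MvPolynomial.eval_X]
    exact hp.fun_mul (evalC0 i).differentiable

theorem aeval_coord_ballPoint (Q : MvPolynomial ℕ ℂ) (x : unitBallC0) :
    MvPolynomial.aeval coord Q (ballPoint x) =
      MvPolynomial.eval (fun i => (x : C₀(ℕ, ℂ)) i) Q := by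
  rw [aeval_coord_apply, MvPolynomial.eval_eq]
  rfl

theorem pullback_ballPoint_mem {g : C(ClosedPolydisc, ℂ)} (hg : g ∈ polydiscAlgebra) :
    (fun x => g (ballPoint x)) ∈ ballFunctions := by
  classical
  refine ⟨(CompactSpace.uniformContinuous_of_continuous g.continuous).comp
    uniformContinuous_ballPoint, fun x => if h : x ∈ unitBallC0 then g (ballPoint ⟨x, h⟩) else 0,
    ?_, fun x => ?_⟩
  · intro x hx
    obtain ⟨Q, hQ⟩ := exists_seq_aeval_tendsto hg
    obtain ⟨C, hC⟩ := hQ.norm.bddAbove_range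
    obtain ⟨R, hR, hsub⟩ := Metric.isOpen_iff.1 isOpen_ball x hx
    refine DifferentiableAt.differentiableWithinAt ?_
    refine differentiableAt_of_tendsto_of_bounded
      (F := fun k (y : C₀(ℕ, ℂ)) => MvPolynomial.eval (fun i => y i) (Q k)) (C := C) hR
      (fun k => (differentiable_eval_c0 (Q k)).differentiableOn) (fun k y hy => ?_) fun y hy => ?_
    · have := aeval_coord_ballPoint (Q k) ⟨y, hsub hy⟩
      simp only at this
      rw [← this]
      exact (ContinuousMap.norm_coe_le_norm _ _).trans (hC (mem_range_self k))
    · have hy' : y ∈ unitBallC0 := hsub hy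
      simp only [hy', dite_true]
      refine (((continuous_eval_const (F := C(ClosedPolydisc, ℂ)) (ballPoint ⟨y, hy'⟩)).tendsto
        g).comp hQ).congr fun k => ?_
      exact aeval_coord_ballPoint (Q k) ⟨y, hy'⟩
  · simp only [x.2, dite_true]

/-! ### A Schur-type lemma -/

/-- Baire's theorem on the Cantor space of subsets `S`: the subsums are continuous in `S` and
converge pointwise, hence are nearly Cauchy uniformly on some open set. Switching a far coordinate
`k` stays in that set and isolates the entry `b k k`. -/
theorem tendsto_diagonal_zero_of_tendsto_subsums {b : ℕ → ℕ → ℂ} (hb : ∀ k, Summable fun j => ‖b k j‖)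
    (h : ∀ S : ℕ → Bool, ∃ L : ℂ, Tendsto (fun k => ∑' j, if S j then b k j else 0) atTop (𝓝 L)) :
    Tendsto (fun k => b k k) atTop (𝓝 0) := by
  let σ : ℕ → (ℕ → Bool) → ℂ := fun k S => ∑' j, if S j then b k j else 0
  have hite : ∀ (k : ℕ) (S : ℕ → Bool) (j : ℕ), ‖(if S j then b k j else 0 : ℂ)‖ ≤ ‖b k j‖ := by
    intro k S j
    split_ifs
    · exact le_rfl
    · simp
  have hσc : ∀ k, Continuous (σ k) := fun k => by
    refine continuous_tsum (fun j => ?_) (hb k) fun j S => hite k S j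
    exact (continuous_of_discreteTopology (f := fun s : Bool => if s then b k j else 0)).comp
      (continuous_apply j)
  have hσs : ∀ (k : ℕ) (S : ℕ → Bool), Summable fun j => (if S j then b k j else 0 : ℂ) := fun k S =>
    Summable.of_norm_bounded (hb k) (hite k S)
  have hdiff : ∀ (k n : ℕ) (S : ℕ → Bool),
      σ n (Function.update S k true) - σ n (Function.update S k false) = b n k := by
    intro k n S
    simp only [σ]
    rw [← (hσs n _).tsum_sub (hσs n _), tsum_eq_single k]
    · simp
    · intro j hj
      simp [hj]
  rw [Metric.tendsto_atTop]
  intro ε hε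
  let E : ℕ → Set (ℕ → Bool) := fun n => {S | ∀ k, n ≤ k → ‖σ k S - σ n S‖ ≤ ε / 4}
  have hE : ∀ n, IsClosed (E n) := fun n => by
    have : E n = ⋂ k, ⋂ _ : n ≤ k, {S | ‖σ k S - σ n S‖ ≤ ε / 4} := by
      ext S; simp [E]
    rw [this]
    exact isClosed_iInter fun k => isClosed_iInter fun _ =>
      isClosed_le ((hσc k).sub (hσc n)).norm continuous_const
  have hU : ⋃ n, E n = univ := by
    refine eq_univ_of_forall fun S => mem_iUnion.2 ?_
    obtain ⟨L, hL⟩ := h S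
    obtain ⟨n, hn⟩ := Metric.cauchySeq_iff'.1 hL.cauchySeq (ε / 4) (by positivity)
    refine ⟨n, fun k hk => ?_⟩
    have := hn k hk
    rw [dist_eq_norm] at this
    exact this.le
  obtain ⟨n, S, hS⟩ := nonempty_interior_of_iUnion_of_closed hE hU
  have hupd : ∀ c : Bool, Tendsto (fun k => Function.update S k c) atTop (𝓝 S) := fun c => by
    rw [tendsto_pi_nhds]
    intro j
    refine tendsto_const_nhds.congr' ?_
    filter_upwards [eventually_gt_atTop j] with k hk
    simp [hk.ne]
  have hmem : ∀ c : Bool, ∀ᶠ k in atTop, Function.update S k c ∈ E n := fun c =>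
    ((hupd c).eventually (isOpen_interior.mem_nhds hS)).mono fun _ hk => interior_subset hk
  have hrow : ∀ᶠ k in atTop, ‖b n k‖ < ε / 4 :=
    ((hb n).tendsto_atTop_zero).eventually (gt_mem_nhds (by positivity))
  obtain ⟨K, hK⟩ := eventually_atTop.1 ((((hmem true).and (hmem false)).and hrow).and
    (eventually_ge_atTop n))
  refine ⟨K, fun k hk => ?_⟩
  obtain ⟨⟨⟨h1, h2⟩, h3⟩, h4⟩ := hK k hk
  have h5 := h1 k h4
  have h6 := h2 k h4
  rw [dist_zero_right]
  have h7 : b k k = (σ k (Function.update S k true) - σ n (Function.update S k true)) -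
      (σ k (Function.update S k false) - σ n (Function.update S k false)) + b n k := by
    rw [← hdiff k k S, ← hdiff k n S]; ring
  rw [h7]
  refine lt_of_le_of_lt (norm_add_le _ _) ?_
  have := norm_sub_le (σ k (Function.update S k true) - σ n (Function.update S k true))
    (σ k (Function.update S k false) - σ n (Function.update S k false))
  linarith

/-! ### Disjointly supported sequences in `c₀` -/

theorem norm_sum_smul_le_of_disjoint {v : ℕ → C₀(ℕ, ℂ)} (hv : ∀ k, ‖v k‖ ≤ 1)
    (hd : ∀ j k i, j ≠ k → v j i ≠ 0 → v k i = 0) (s : Finset ℕ) {θ : ℕ → ℂ}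
    (hθ : ∀ k, ‖θ k‖ ≤ 1) : ‖∑ k ∈ s, θ k • v k‖ ≤ 1 := by
  refine norm_le_of_forall_c0 zero_le_one fun i => ?_
  rw [← evalC0_apply, map_sum]
  simp only [map_smul, evalC0_apply, smul_eq_mul]
  by_cases h : ∃ k ∈ s, v k i ≠ 0
  · obtain ⟨k, hk, hki⟩ := h
    rw [Finset.sum_eq_single_of_mem k hk fun j _ hj => by rw [hd k j i hj.symm hki, mul_zero],
      norm_mul]
    exact mul_le_one₀ (hθ k) (norm_nonneg _) ((norm_apply_le_norm_c0 _ i).trans (hv k))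
  · push Not at h
    rw [Finset.sum_eq_zero fun k hk => by rw [h k hk, mul_zero], norm_zero]
    exact zero_le_one

/-- Unimodular `θ k` align the values of `ℓ`, while disjointness keeps the combined vector in the
unit ball. -/
theorem summable_norm_apply_of_disjoint {v : ℕ → C₀(ℕ, ℂ)} (hv : ∀ k, ‖v k‖ ≤ 1)
    (hd : ∀ j k i, j ≠ k → v j i ≠ 0 → v k i = 0) (ℓ : C₀(ℕ, ℂ) →L[ℂ] ℂ) :
    Summable fun k => ‖ℓ (v k)‖ := by
  have hθ : ∀ k, ∃ θ : ℂ, ‖θ‖ = 1 ∧ (‖ℓ (v k)‖ : ℂ) = θ * ℓ (v k) := fun k =>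
    RCLike.exists_norm_eq_mul_self (ℓ (v k))
  choose θ hθ1 hθ2 using hθ
  refine summable_of_sum_le (c := ‖ℓ‖) (fun k => norm_nonneg _) fun s => ?_
  have h1 : ((∑ k ∈ s, ‖ℓ (v k)‖ : ℝ) : ℂ) = ℓ (∑ k ∈ s, θ k • v k) := by
    rw [map_sum]
    push_cast
    refine Finset.sum_congr rfl fun k _ => ?_
    rw [map_smul, smul_eq_mul, hθ2]
  have h2 : ‖ℓ (∑ k ∈ s, θ k • v k)‖ ≤ ‖ℓ‖ :=
    (ℓ.le_opNorm _).trans (mul_le_of_le_one_right (norm_nonneg _)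
      (norm_sum_smul_le_of_disjoint hv hd s fun k => (hθ1 k).le))
  rw [← h1, Complex.norm_real] at h2
  exact (le_abs_self _).trans h2

/-! ### Homogeneous polynomials on `c₀` -/

/-- Entire functions on a complex normed space that are homogeneous of degree `m`. -/
structure IsHomogeneousPolynomial {E : Type*} [NormedAddCommGroup E] [NormedSpace ℂ E] (m : ℕ)
    (P : E → ℂ) : Prop where
  differentiable : Differentiable ℂ P
  map_smul : ∀ (c : ℂ) (x : E), P (c • x) = c ^ m * P x

theorem IsHomogeneousPolynomial.fderiv_smul {E : Type*} [NormedAddCommGroup E] [NormedSpace ℂ E]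
    {m : ℕ} {P : E → ℂ} (hP : IsHomogeneousPolynomial (m + 1) P) (c : ℂ) (x v : E) :
    fderiv ℂ P (c • x) v = c ^ m * fderiv ℂ P x v := by
  have hne : ∀ c : ℂ, c ≠ 0 → fderiv ℂ P (c • x) v = c ^ m * fderiv ℂ P x v := by
    intro c hc
    have h1 : HasFDerivAt (fun y => P (c • y)) ((fderiv ℂ P (c • x)).comp
        (c • ContinuousLinearMap.id ℂ E)) x :=
      (hP.differentiable (c • x)).hasFDerivAt.comp x ((hasFDerivAt_id x).const_smul c)
    have h2 : HasFDerivAt (fun y => P (c • y)) (c ^ (m + 1) • fderiv ℂ P x) x := by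
      simp only [hP.map_smul]
      exact (hP.differentiable x).hasFDerivAt.const_mul (c ^ (m + 1))
    have h3 := DFunLike.congr_fun (h1.unique h2) v
    simp only [ContinuousLinearMap.comp_apply, _root_.smul_apply,
      ContinuousLinearMap.id_apply, _root_.map_smul, smul_eq_mul, pow_succ] at h3
    refine mul_left_cancel₀ hc (h3.trans ?_)
    ring
  -- The chain rule leaves a factor `c` to cancel; `c = 0` is reached by continuity.
  have hcont : Continuous fun y => fderiv ℂ P y v :=
    (differentiable_fderiv_apply hP.differentiable v).continuous
  have h := Continuous.ext_on (dense_compl_singleton (0 : ℂ))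
    (f := fun c : ℂ => fderiv ℂ P (c • x) v) (g := fun c => c ^ m * fderiv ℂ P x v)
    (hcont.comp (by fun_prop)) (by fun_prop) fun c hc => hne c hc
  exact congrFun h c

/-- The partial sums `w K` need not converge in `c₀`, but they stay in the unit ball, so the
derivatives along them are locally bounded and converge pointwise. -/
theorem IsHomogeneousPolynomial.tsum_fderiv {m : ℕ} {P : C₀(ℕ, ℂ) → ℂ}
    (hP : IsHomogeneousPolynomial (m + 1) P) {v : ℕ → C₀(ℕ, ℂ)} (hv : ∀ k, ‖v k‖ ≤ 1)
    (hd : ∀ j k i, j ≠ k → v j i ≠ 0 → v k i = 0) (S : ℕ → Bool) :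
    IsHomogeneousPolynomial m fun x => ∑' k, if S k then fderiv ℂ P x (v k) else 0 := by
  let w : ℕ → C₀(ℕ, ℂ) := fun K => ∑ k ∈ Finset.range K, (if S k then 1 else 0 : ℂ) • v k
  have hw : ∀ K, ‖w K‖ ≤ 1 := fun K => norm_sum_smul_le_of_disjoint hv hd _ fun k => by
    split_ifs <;> simp
  have hsum : ∀ x, Summable fun k => (if S k then fderiv ℂ P x (v k) else 0 : ℂ) := fun x =>
    Summable.of_norm_bounded (summable_norm_apply_of_disjoint hv hd (fderiv ℂ P x)) fun k => by
      split_ifs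
      · exact le_rfl
      · simp
  have hpart : ∀ x K, fderiv ℂ P x (w K) =
      ∑ k ∈ Finset.range K, if S k then fderiv ℂ P x (v k) else 0 := fun x K => by
    simp only [w, map_sum, _root_.map_smul, smul_eq_mul, ite_mul, one_mul, zero_mul]
  refine ⟨fun x => ?_, fun c x => ?_⟩
  · obtain ⟨R, hR, C, hC, hfd⟩ := exists_norm_fderiv_le hP.differentiable x
    refine differentiableAt_of_tendsto_of_bounded (F := fun K y => fderiv ℂ P y (w K)) (C := C) hR
      (fun K => (differentiable_fderiv_apply hP.differentiable _).differentiableOn)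
      (fun K y hy => ?_) fun y _ => ?_
    · calc _ ≤ C * ‖w K‖ := (fderiv ℂ P y).le_of_opNorm_le (hfd y hy) _
        _ ≤ C := mul_le_of_le_one_right hC (hw K)
    · simp only [hpart]
      exact (hsum y).hasSum.tendsto_sum_nat
  · rw [← tsum_mul_left]
    congr 1
    ext k
    rw [hP.fderiv_smul]
    split_ifs <;> simp

/-- The point of `c₀` with the first `N` coordinates of `z`. -/
noncomputable def headC0 (N : ℕ) (z : ClosedPolydisc) : C₀(ℕ, ℂ) :=
  ∑ i ∈ Finset.range N, (z i : ℂ) • unitVector i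

theorem headC0_apply (N : ℕ) (z : ClosedPolydisc) (i : ℕ) :
    headC0 N z i = if i < N then (z i : ℂ) else 0 := by
  rw [headC0, sum_smul_unitVector_apply (z := fun i => (z i : ℂ))]
  simp only [Finset.mem_range]

theorem norm_headC0_le (N : ℕ) (z : ClosedPolydisc) : ‖headC0 N z‖ ≤ 1 :=
  norm_sum_smul_unitVector_le _ zero_le_one fun i _ => mem_closedBall_zero_iff.1 (z i).2

theorem comp_headC0_mem {P : C₀(ℕ, ℂ) → ℂ} (hP : Differentiable ℂ P) (N : ℕ) :
    ∃ g ∈ polydiscAlgebra, ∀ z, g z = P (headC0 N z) := by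
  refine ⟨⟨fun z => P (headC0 N z), hP.continuous.comp (by unfold headC0; fun_prop)⟩, ?_,
    fun z => rfl⟩
  intro z _ i
  refine ⟨fun w => P (∑ j ∈ Finset.range N, (if j = i then w else (z j : ℂ)) • unitVector j),
    Differentiable.differentiableOn (hP.comp ?_), fun w _ => ?_⟩
  · refine Differentiable.fun_sum fun j _ => Differentiable.smul_const ?_ _
    by_cases h : j = i
    · simp only [h, if_true]; exact differentiable_id
    · simp only [h, if_false]; exact differentiable_const _
  · simp only [ContinuousMap.coe_mk, headC0]
    congr 1
    refine Finset.sum_congr rfl fun j _ => ?_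
    by_cases h : j = i
    · subst h; simp
    · simp [h]

theorem exists_extension_of_tail {P : C₀(ℕ, ℂ) → ℂ} (hP : Differentiable ℂ P)
    (h : ∀ ε > 0, ∃ N, ∀ M, N ≤ M → ∀ z, ‖P (headC0 M z) - P (headC0 N z)‖ ≤ ε) :
    ∃ g ∈ polydiscAlgebra, ∀ (x : C₀(ℕ, ℂ)) (z : ClosedPolydisc), (∀ i, (z i : ℂ) = x i) →
      P x = g z := by
  choose g hg hgP using comp_headC0_mem hP
  have hcau : CauchySeq g := by
    rw [Metric.cauchySeq_iff']
    intro ε hε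
    obtain ⟨N, hN⟩ := h (ε / 2) (half_pos hε)
    refine ⟨N, fun M hM => lt_of_le_of_lt ?_ (half_lt_self hε)⟩
    rw [dist_eq_norm, ContinuousMap.norm_le _ (half_pos hε).le]
    intro z
    rw [ContinuousMap.sub_apply, hgP, hgP]
    exact hN M hM z
  obtain ⟨G, hG⟩ := cauchySeq_tendsto_of_complete hcau
  refine ⟨G, isClosed_polydiscAlgebra.mem_of_tendsto hG (Eventually.of_forall hg),
    fun x z hz => ?_⟩
  have h1 : Tendsto (fun N => g N z) atTop (𝓝 (G z)) :=
    ((continuous_eval_const (F := C(ClosedPolydisc, ℂ)) z).tendsto G).comp hG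
  have h2 : Tendsto (fun N => g N z) atTop (𝓝 (P x)) := by
    refine ((hP.continuous.tendsto x).comp (tendsto_sum_smul_unitVector x)).congr fun N => ?_
    rw [hgP]
    simp only [Function.comp_apply, headC0, hz]
  exact tendsto_nhds_unique h2 h1

/-- The mean value inequality on the segment between the two heads; its direction `v` is a block of
coordinates in `[N, M)`. -/
theorem exists_fderiv_large_of_tail {P : C₀(ℕ, ℂ) → ℂ} (hP : Differentiable ℂ P) {ε : ℝ} {N M : ℕ}
    {z : ClosedPolydisc} (h : ε < ‖P (headC0 M z) - P (headC0 N z)‖) (hNM : N ≤ M) :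
    ∃ x v : C₀(ℕ, ℂ), ‖x‖ ≤ 1 ∧ ‖v‖ ≤ 1 ∧ (∀ i, v i ≠ 0 → N ≤ i ∧ i < M) ∧
      ε < ‖fderiv ℂ P x v‖ := by
  set a := headC0 N z with ha
  set v := headC0 M z - a with hv
  obtain ⟨t, ht, hlt⟩ : ∃ t ∈ Ico (0 : ℝ) 1, ε < ‖fderiv ℂ P (a + t • v) v‖ := by
    by_contra! hcon
    have hderiv : ∀ t ∈ Icc (0 : ℝ) 1, HasDerivWithinAt (fun t : ℝ => P (a + t • v))
        (fderiv ℂ P (a + t • v) v) (Icc (0 : ℝ) 1) t := by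
      intro t _
      have h1 : HasDerivAt (fun t : ℝ => a + t • v) v t := by
        simpa using ((hasDerivAt_id t).smul_const v).const_add a
      exact (((hP _).hasFDerivAt.restrictScalars ℝ).comp_hasDerivAt t h1).hasDerivWithinAt
    have := norm_image_sub_le_of_norm_deriv_le_segment_01' hderiv hcon
    simp only [one_smul, zero_smul, add_zero, hv, add_sub_cancel] at this
    exact absurd h (not_lt.2 this)
  have hvi : ∀ i, v i = if N ≤ i ∧ i < M then (z i : ℂ) else 0 := by
    intro i
    rw [hv, ha, ZeroAtInftyContinuousMap.sub_apply, headC0_apply, headC0_apply]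
    by_cases h1 : i < N
    · simp [h1, h1.trans_le hNM]
    · simp [h1, not_lt.1 h1]
  refine ⟨a + t • v, v, ?_, ?_, fun i hi => ?_, hlt⟩
  · have := (convex_closedBall (0 : C₀(ℕ, ℂ)) 1).add_smul_sub_mem
      (mem_closedBall_zero_iff.2 (norm_headC0_le N z))
      (mem_closedBall_zero_iff.2 (norm_headC0_le M z)) ⟨ht.1, ht.2.le⟩
    exact mem_closedBall_zero_iff.1 this
  · refine norm_le_of_forall_c0 zero_le_one fun i => ?_
    rw [hvi]
    split_ifs
    · exact mem_closedBall_zero_iff.1 (z i).2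
    · simp
  · by_contra hcon
    exact hi (by rw [hvi, if_neg hcon])

/-- If the heads of `P` were not uniformly Cauchy, a gliding hump would give points `x k` and
disjoint blocks `v k` with `‖fderiv ℂ P (x k) (v k)‖ > ε`. Each subsum of derivatives along the
blocks has lower degree, so it extends to the polydisc and converges along a coordinatewise
convergent subsequence of the `x k`. The Schur-type lemma then sends the diagonal to zero. -/
theorem IsHomogeneousPolynomial.exists_extension (m : ℕ) : ∀ {P : C₀(ℕ, ℂ) → ℂ},
    IsHomogeneousPolynomial m P → ∃ g ∈ polydiscAlgebra,
      ∀ (x : C₀(ℕ, ℂ)) (z : ClosedPolydisc), (∀ i, (z i : ℂ) = x i) → P x = g z := by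
  induction m with
  | zero =>
    intro P hP
    refine ⟨algebraMap ℂ _ (P 0), polydiscAlgebra.algebraMap_mem _, fun x z _ => ?_⟩
    have := hP.map_smul 0 x
    rw [zero_smul, pow_zero, one_mul] at this
    exact this.symm
  | succ m ih =>
    intro P hP
    refine exists_extension_of_tail hP.differentiable ?_
    by_contra! hcon
    obtain ⟨ε, hε, hcon⟩ := hcon
    have hstep : ∀ N, ∃ M, ∃ x v : C₀(ℕ, ℂ), ‖x‖ ≤ 1 ∧ ‖v‖ ≤ 1 ∧
        (∀ i, v i ≠ 0 → N ≤ i ∧ i < M) ∧ ε < ‖fderiv ℂ P x v‖ ∧ N ≤ M := fun N => by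
      obtain ⟨M, hM, z, hz⟩ := hcon N
      obtain ⟨x, v, h1, h2, h3, h4⟩ := exists_fderiv_large_of_tail hP.differentiable hz hM
      exact ⟨M, x, v, h1, h2, h3, h4, hM⟩
    choose M x₀ v₀ hx₀ hv₀ hsupp hbig hM using hstep
    -- Each block begins no earlier than the previous one ends.
    let ν : ℕ → ℕ := fun k => M^[k] 0
    have hνsucc : ∀ k, ν (k + 1) = M (ν k) := fun k => Function.iterate_succ_apply' M k 0
    have hν : Monotone ν := monotone_nat_of_le_succ fun k => by rw [hνsucc]; exact hM _
    have hdisj : ∀ j k i, j ≠ k → v₀ (ν j) i ≠ 0 → v₀ (ν k) i = 0 := by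
      intro j k i hjk hj
      by_contra hk
      obtain ⟨h1, h2⟩ := hsupp _ i hj
      obtain ⟨h3, h4⟩ := hsupp _ i hk
      rw [← hνsucc] at h2 h4
      rcases lt_or_gt_of_ne hjk with h | h
      · have := hν (Nat.succ_le_of_lt h)
        simp only [Nat.succ_eq_add_one] at this
        omega
      · have := hν (Nat.succ_le_of_lt h)
        simp only [Nat.succ_eq_add_one] at this
        omega
    let ζ : ℕ → ClosedPolydisc := fun k i => ⟨x₀ (ν k) i, by
      rw [mem_closedBall_zero_iff]
      exact (norm_apply_le_norm_c0 _ i).trans (hx₀ _)⟩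
    obtain ⟨ζ', φ, hφ, hlim⟩ := CompactSpace.tendsto_subseq ζ
    have hdisj' : ∀ j k i, j ≠ k → v₀ (ν (φ j)) i ≠ 0 → v₀ (ν (φ k)) i = 0 := fun j k i hjk =>
      hdisj _ _ i (hφ.injective.ne hjk)
    have hdiag := tendsto_diagonal_zero_of_tendsto_subsums
      (b := fun k j => fderiv ℂ P (x₀ (ν (φ k))) (v₀ (ν (φ j))))
      (fun k => summable_norm_apply_of_disjoint (fun j => hv₀ _) hdisj' _) fun S => by
        obtain ⟨g, -, hgP⟩ := ih (hP.tsum_fderiv (fun j => hv₀ (ν (φ j))) hdisj' S)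
        refine ⟨g ζ', ((g.continuous.tendsto ζ').comp hlim).congr fun k => ?_⟩
        exact (hgP (x₀ (ν (φ k))) (ζ (φ k)) fun i => rfl).symm
    have h1 := hdiag.norm
    rw [norm_zero] at h1
    obtain ⟨k, hk⟩ := (h1.eventually (gt_mem_nhds hε)).exists
    exact absurd hk (not_lt.2 (hbig _).le)

/-! ### Homogeneous expansion on the unit ball of `c₀` -/

/-- With no smoothness required, homogeneity of the Taylor coefficients holds for every vector and
every scalar, also outside the ball. -/
theorem iteratedDeriv_comp_mul_left (f : ℂ → ℂ) (c : ℂ) (n : ℕ) :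
    iteratedDeriv n (fun w => f (c * w)) = fun w => c ^ n * iteratedDeriv n f (c * w) := by
  induction n with
  | zero => simp
  | succ n ih =>
    rw [iteratedDeriv_succ, ih, iteratedDeriv_succ]
    funext w
    rw [deriv_const_mul_field, deriv_comp_mul_left, smul_eq_mul, pow_succ, mul_assoc]

theorem taylorCoeff_comp_mul_left (f : ℂ → ℂ) (c : ℂ) (n : ℕ) :
    taylorCoeff (fun w => f (c * w)) n = c ^ n * taylorCoeff f n := by
  simp only [taylorCoeff, iteratedDeriv_comp_mul_left, mul_zero]
  ring

section Expansion

variable {E : Type*} [NormedAddCommGroup E] [NormedSpace ℂ E] {F : E → ℂ} {C : ℝ}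

theorem smul_mem_unitBall {x : E} (hx : x ∈ ball (0 : E) 1) {w : ℂ} (hw : ‖w‖ ≤ 1) :
    w • x ∈ ball (0 : E) 1 := by
  rw [mem_ball_zero_iff] at *
  rw [norm_smul]
  nlinarith [norm_nonneg w, norm_nonneg x]

theorem differentiableOn_radial (hF : DifferentiableOn ℂ F (ball 0 1)) {x : E}
    (hx : x ∈ ball (0 : E) 1) : DifferentiableOn ℂ (fun w : ℂ => F (w • x)) (ball 0 1) :=
  hF.comp (by fun_prop) fun _ hw => smul_mem_unitBall hx (mem_ball_zero_iff.1 hw).le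

/-- On the ball the coefficient is a bounded limit of root-of-unity means of dilates of `F`, hence
holomorphic; homogeneity carries this to the whole space. -/
theorem isHomogeneousPolynomial_taylorCoeff (hF : DifferentiableOn ℂ F (ball 0 1))
    (hC : ∀ y ∈ ball (0 : E) 1, ‖F y‖ ≤ C) (m : ℕ) :
    IsHomogeneousPolynomial m fun x => taylorCoeff (fun w : ℂ => F (w • x)) m := by
  have hhom : ∀ (c : ℂ) (x : E), taylorCoeff (fun w : ℂ => F (w • c • x)) m =
      c ^ m * taylorCoeff (fun w : ℂ => F (w • x)) m := by
    intro c x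
    rw [← taylorCoeff_comp_mul_left]
    simp only [smul_smul, mul_comm c]
  have hball : ∀ x ∈ ball (0 : E) 1,
      DifferentiableAt ℂ (fun x => taylorCoeff (fun w : ℂ => F (w • x)) m) x := by
    intro x hx
    obtain ⟨R, hR, hsub⟩ := Metric.isOpen_iff.1 isOpen_ball x hx
    have hr0 : (0 : ℝ) ≤ 1 / 2 := by norm_num
    have hr1 : (1 / 2 : ℝ) < 1 := by norm_num
    have hpt : ∀ M l : ℕ, ‖(((1 / 2 : ℝ) : ℂ) * rootUnity M ^ l)‖ ≤ 1 := fun M l =>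
      (mem_ball_zero_iff.1 (mul_rootUnity_pow_mem_ball hr0 hr1 M l)).le
    have h1 : DifferentiableAt ℂ
        (fun x => taylorCoeff (fun w : ℂ => F (w • x)) m * ((1 / 2 : ℝ) : ℂ) ^ m) x := by
      refine differentiableAt_of_tendsto_of_bounded
        (F := fun n y => rootMean (n + (m + 1)) m (1 / 2) fun w : ℂ => F (w • y)) (C := C) hR
        (fun n => ?_) (fun n y hy => ?_) fun y hy => ?_
      · unfold rootMean
        refine DifferentiableOn.const_mul (DifferentiableOn.fun_sum fun l _ =>
          DifferentiableOn.const_mul ?_ _) _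
        exact hF.comp (by fun_prop) fun y hy => smul_mem_unitBall (hsub hy) (hpt _ l)
      · rw [rootMean, norm_mul, norm_inv, Complex.norm_natCast]
        have h2 : ‖∑ l ∈ Finset.range (n + (m + 1)), (rootUnity (n + (m + 1)) ^ l)⁻¹ ^ m *
            F ((((1 / 2 : ℝ) : ℂ) * rootUnity (n + (m + 1)) ^ l) • y)‖ ≤
            ((n + (m + 1) : ℕ) : ℝ) * C := by
          refine (norm_sum_le_of_le (n := fun _ => C) _ fun l _ => ?_).trans
            (by rw [Finset.sum_const, Finset.card_range, nsmul_eq_mul])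
          rw [norm_mul, norm_pow, norm_inv, norm_pow, norm_rootUnity, one_pow, inv_one, one_pow,
            one_mul]
          exact hC _ (smul_mem_unitBall (hsub hy) (hpt _ l))
        rw [inv_mul_le_iff₀ (by positivity)]
        exact h2
      · have hd := differentiableOn_radial hF (hsub hy)
        have hb : ∀ w ∈ ball (0 : ℂ) 1, ‖F (w • y)‖ ≤ C := fun w hw =>
          hC _ (smul_mem_unitBall (hsub hy) (mem_ball_zero_iff.1 hw).le)
        rw [tendsto_iff_norm_sub_tendsto_zero]
        refine squeeze_zero (fun _ => norm_nonneg _) (fun n => norm_rootMean_sub_le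
          (M := n + (m + 1)) (by omega) (by omega) hr0 hr1 (norm_taylorCoeff_le hd hb)
          fun w hw => hasSum_taylorCoeff hd hw) ?_
        have h2 := (((tendsto_pow_atTop_nhds_zero_of_lt_one hr0 hr1).comp
          (tendsto_add_atTop_nat (m + 1))).const_mul C).div_const (1 - 1 / 2 : ℝ)
        simpa using h2
    have h3 := h1.mul_const ((((1 / 2 : ℝ) : ℂ) ^ m)⁻¹)
    have h4 : (((1 / 2 : ℝ) : ℂ) ^ m) ≠ 0 := pow_ne_zero _ (by norm_num)
    simpa only [mul_assoc, mul_inv_cancel₀ h4, mul_one] using h3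
  refine ⟨fun x => ?_, hhom⟩
  set k : ℝ := ‖x‖ + 1 with hk
  have hk0 : 0 < k := by positivity
  have hkc : (k : ℂ) ≠ 0 := by exact_mod_cast hk0.ne'
  have hx : (k : ℂ)⁻¹ • x ∈ ball (0 : E) 1 := by
    rw [mem_ball_zero_iff, norm_smul, norm_inv, Complex.norm_real, Real.norm_of_nonneg hk0.le,
      inv_mul_lt_iff₀ hk0]
    linarith
  have h5 : (fun x => taylorCoeff (fun w : ℂ => F (w • x)) m) = fun y =>
      (k : ℂ) ^ m * taylorCoeff (fun w : ℂ => F (w • (k : ℂ)⁻¹ • y)) m := by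
    funext y
    rw [← hhom, smul_inv_smul₀ hkc]
  rw [h5]
  refine DifferentiableAt.const_mul ?_ _
  exact DifferentiableAt.comp (f := fun y : E => (k : ℂ)⁻¹ • y) x (hball _ hx) (by fun_prop)

theorem norm_sub_sum_taylorCoeff_le (hF : DifferentiableOn ℂ F (ball 0 1))
    (hC : ∀ y ∈ ball (0 : E) 1, ‖F y‖ ≤ C) {x : E} (hx : x ∈ ball (0 : E) 1) {r : ℝ} (hr0 : 0 ≤ r)
    (hr1 : r < 1) (M : ℕ) :
    ‖F ((r : ℂ) • x) - ∑ m ∈ Finset.range M, taylorCoeff (fun w : ℂ => F (w • x)) m * (r : ℂ) ^ m‖ ≤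
      C * r ^ M / (1 - r) := by
  have hd := differentiableOn_radial hF hx
  have hb : ∀ w ∈ ball (0 : ℂ) 1, ‖F (w • x)‖ ≤ C := fun w hw =>
    hC _ (smul_mem_unitBall hx (mem_ball_zero_iff.1 hw).le)
  have hrn : ‖(r : ℂ)‖ = r := by rw [Complex.norm_real, Real.norm_of_nonneg hr0]
  have h1 := hasSum_taylorCoeff hd (w := r) (by rw [mem_ball_zero_iff, hrn]; exact hr1)
  have h2 : HasSum
      (fun m => if m < M then taylorCoeff (fun w : ℂ => F (w • x)) m * (r : ℂ) ^ m else 0)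
      (∑ m ∈ Finset.range M,
        if m < M then taylorCoeff (fun w : ℂ => F (w • x)) m * (r : ℂ) ^ m else 0) :=
    hasSum_sum_of_ne_finset_zero fun m hm => if_neg (by simpa using hm)
  rw [Finset.sum_congr rfl fun m hm => if_pos (Finset.mem_range.1 hm)] at h2
  refine norm_le_of_hasSum_of_geometric_tail hr0 hr1 (h1.sub h2) (fun m hm => ?_) fun m => ?_
  · rw [if_pos hm, sub_self]
  · have h3 : ‖taylorCoeff (fun w : ℂ => F (w • x)) m * (r : ℂ) ^ m‖ ≤ C * r ^ m := by
      rw [norm_mul, norm_pow, hrn]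
      gcongr
      exact norm_taylorCoeff_le hd hb m
    split_ifs
    · rw [sub_self, norm_zero]
      exact (norm_nonneg _).trans h3
    · rwa [sub_zero]

end Expansion

/-- Uniform continuity allows replacing `F x` by `F (r x)`, whose homogeneous expansion converges
uniformly on the ball; the terms extend to the polydisc one by one. -/
theorem exists_polydiscAlgebra_eq_of_mem_ballFunctions {f : unitBallC0 → ℂ}
    (hf : f ∈ ballFunctions) : ∃ g ∈ polydiscAlgebra, ∀ x, f x = g (ballPoint x) := by
  obtain ⟨huc, F, hF, hfF⟩ := hf
  have hconv : Convex ℝ unitBallC0 := convex_ball 0 1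
  obtain ⟨B, hB, HB⟩ := huc.exists_dist_le_add_mul_dist hconv one_pos
  have h0 : (0 : C₀(ℕ, ℂ)) ∈ unitBallC0 := mem_ball_self one_pos
  set C : ℝ := ‖F 0‖ + (1 + B) with hCdef
  have hC : ∀ y ∈ ball (0 : C₀(ℕ, ℂ)) 1, ‖F y‖ ≤ C := by
    intro y hy
    have h1 := HB ⟨y, hy⟩ ⟨0, h0⟩
    rw [hfF, hfF, dist_eq_norm, Subtype.dist_eq, dist_eq_norm, sub_zero] at h1
    have h2 := norm_sub_norm_le (F y) (F 0)
    have h3 : B * ‖y‖ ≤ B := mul_le_of_le_one_right hB (mem_ball_zero_iff.1 hy).le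
    simp only at h1
    linarith
  have hC0 : 0 ≤ C := (norm_nonneg _).trans (hC 0 h0)
  choose G hG hGF using fun m =>
    (isHomogeneousPolynomial_taylorCoeff hF hC m).exists_extension m
  refine exists_polydiscAlgebra_eq_of_approx isometry_pullbackHom_ballPoint huc.continuous
    fun ε hε => ?_
  obtain ⟨δ, hδ, Hδ⟩ := Metric.uniformContinuous_iff.1 huc (ε / 2) (half_pos hε)
  set r : ℝ := 1 - min (1 / 2) (δ / 2) with hr
  have hmin : 0 < min (1 / 2) (δ / 2) := by positivity
  have hr0 : 0 ≤ r := by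
    have : min (1 / 2) (δ / 2) ≤ 1 / 2 := min_le_left _ _
    linarith
  have hr1 : r < 1 := by linarith
  have hrδ : 1 - r < δ := by
    have : min (1 / 2) (δ / 2) ≤ δ / 2 := min_le_right _ _
    linarith
  have hlim : Tendsto (fun M : ℕ => C * r ^ M / (1 - r)) atTop (𝓝 0) := by
    have := ((tendsto_pow_atTop_nhds_zero_of_lt_one hr0 hr1).const_mul C).div_const (1 - r)
    simpa using this
  obtain ⟨M, hM⟩ := (hlim.eventually (gt_mem_nhds (half_pos hε))).exists
  refine ⟨∑ m ∈ Finset.range M, (r : ℂ) ^ m • G m, Subalgebra.sum_mem _ fun m _ =>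
    Subalgebra.smul_mem _ (hG m) _, fun x => ?_⟩
  have hrn : ‖(r : ℂ)‖ = r := by rw [Complex.norm_real, Real.norm_of_nonneg hr0]
  have h1 : (∑ m ∈ Finset.range M, (r : ℂ) ^ m • G m) (ballPoint x) =
      ∑ m ∈ Finset.range M, taylorCoeff (fun w : ℂ => F (w • (x : C₀(ℕ, ℂ)))) m * (r : ℂ) ^ m := by
    rw [ContinuousMap.sum_apply]
    refine Finset.sum_congr rfl fun m _ => ?_
    rw [ContinuousMap.smul_apply, smul_eq_mul, hGF m x (ballPoint x) fun i => rfl, mul_comm]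
  have h2 := norm_sub_sum_taylorCoeff_le hF hC x.2 hr0 hr1 M
  have hrx : (r : ℂ) • (x : C₀(ℕ, ℂ)) ∈ unitBallC0 :=
    smul_mem_unitBall x.2 (hrn.trans_le hr1.le)
  have h3 : ‖F ((r : ℂ) • (x : C₀(ℕ, ℂ))) - f x‖ < ε / 2 := by
    have h4 : dist (⟨_, hrx⟩ : unitBallC0) x < δ := by
      rw [Subtype.dist_eq, dist_eq_norm]
      have h5 : (r : ℂ) • (x : C₀(ℕ, ℂ)) - x = ((r - 1 : ℝ) : ℂ) • (x : C₀(ℕ, ℂ)) := by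
        push_cast
        module
      have h6 : ‖(x : C₀(ℕ, ℂ))‖ < 1 := norm_lt_one_of_mem_unitBallC0 x.2
      rw [h5, norm_smul, Complex.norm_real, Real.norm_eq_abs, abs_of_neg (by linarith)]
      nlinarith [norm_nonneg (x : C₀(ℕ, ℂ))]
    have h7 := Hδ h4
    rwa [hfF, dist_eq_norm] at h7
  rw [h1]
  rw [norm_sub_rev] at h2
  calc _ ≤ _ := norm_sub_le_norm_sub_add_norm_sub _ _ _
    _ ≤ ε / 2 + ε / 2 := add_le_add (h2.trans hM.le) h3.le
    _ = ε := add_halves ε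

theorem mainTheorem3 :
    -- `A(D̄^ℕ)` is a Banach algebra
    CompleteSpace polydiscAlgebra ∧
    -- `A(ℂ₊)` consists of bounded functions, is a Banach algebra with the supremum norm, and
    -- is isometrically isomorphic to `A(D̄^ℕ)`
    (∃ A : Subalgebra ℂ (rightHalfPlane →ᵇ ℂ),
      (fun f : rightHalfPlane →ᵇ ℂ => (f : rightHalfPlane → ℂ)) '' (A : Set (rightHalfPlane →ᵇ ℂ))
        = dirichletFunctions ∧
      CompleteSpace A ∧
      ∃ e : polydiscAlgebra ≃ₐ[ℂ] A, Isometry e) ∧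
    -- the same for `A_u(B_{c₀})`
    (∃ U : Subalgebra ℂ (unitBallC0 →ᵇ ℂ),
      (fun f : unitBallC0 →ᵇ ℂ => (f : unitBallC0 → ℂ)) '' (U : Set (unitBallC0 →ᵇ ℂ))
        = ballFunctions ∧
      CompleteSpace U ∧
      ∃ e : polydiscAlgebra ≃ₐ[ℂ] U, Isometry e) := by
  exact ⟨completeSpace_polydiscAlgebra,
    exists_algEquiv_of_isometry isometry_pullbackHom_bohrPoint (fun _ => pullback_bohrPoint_mem)
      fun _ => exists_polydiscAlgebra_eq_of_mem_dirichletFunctions,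
    exists_algEquiv_of_isometry isometry_pullbackHom_ballPoint (fun _ => pullback_ballPoint_mem)
      fun _ => exists_polydiscAlgebra_eq_of_mem_ballFunctions⟩
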